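/- **Theorem.** A matching multicut of a finite simple graph $G$ is a partition $\{A_1,\dots,A_k\}$ of $V(G)$ into nonempty parts such that every vertex of $A_i$ has at most one neighbor outside $A_i$, for each $i$. The problem Enum Matching Multicut takes a graph $G$ and an integer $\ell\ge 0$, and asks to list all matching multicuts of $G$ with at least $\ell$ parts, each exactly once. The distance to cluster $\mathrm{dc}(G)$ is the minimum size of a set $U\subseteq V(G)$ such that every connected component of $G\setminus U$ is a clique. There is an algorithm (for a random access machine with addition, truncated subtraction and indirect addressing, under the uniform cost measure) that solves Enum Matching Multicut and that, on every input $(G,\ell)$ with $|V(G)|=n$ and for every integer $t \ge \mathrm{dc}(G)$, has delay $$2^{\mathcal{O}(t^3\log t)}+n^{\mathcal{O}(1)}.$$ That is, at most so many steps are made before the first solution is output, between any two consecutive solutions, and between the last solution and termination (in total, if there is no solution). Explicitly, there is a constant $C$, independent of $G$, $\ell$, $n$ and $t$, such that the delay is at most $2^{C t^3\log_2 t}+C(n+1)^C$, with $0^3\log_2 0:=0$. -/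

import Mathlib

namespace MatchingMulticut

/-! ### Graphs -/

/-- A cluster graph: every connected component is a clique. -/
def IsClusterGraph {V : Type*} (G : SimpleGraph V) : Prop :=
  ∀ c : G.ConnectedComponent, G.IsClique c.supp

/-- The vertex-deletion distance to cluster of `G`: the least cardinality of a vertex set `U`
such that `G - U` is a cluster graph (`U = V` always qualifies). -/
noncomputable def distToCluster {V : Type*} [Fintype V] (G : SimpleGraph V) : ℕ :=
  sInf {k | ∃ U : Finset V, U.card = k ∧ IsClusterGraph (G.induce {v | v ∉ U})}

/-- A partition of the vertex set (into nonempty parts) is a matching multicut if every vertex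
has at most one neighbor outside its own part. -/
def IsMatchingMulticut {V : Type*} [Fintype V] [DecidableEq V] (G : SimpleGraph V)
    (P : Finpartition (Finset.univ : Finset V)) : Prop :=
  ∀ A ∈ P.parts, ∀ v ∈ A, {w | G.Adj v w ∧ w ∉ A}.encard ≤ 1

/-- The solutions of Enum Matching Multicut on `(G, ℓ)`: the matching multicuts of `G` on at
least `ℓ` parts. -/
def IsSolution {V : Type*} [Fintype V] [DecidableEq V] (G : SimpleGraph V) (ℓ : ℕ)
    (P : Finpartition (Finset.univ : Finset V)) : Prop :=
  IsMatchingMulticut G P ∧ ℓ ≤ P.parts.card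

/-! ### Random access machine with uniform cost

Finitely many registers (those that the program mentions) and an infinite memory, all holding
natural numbers. Arithmetic is addition and truncated subtraction only, so that the uniform cost
measure is the standard, polynomially reasonable one. -/

/-- Programs; every argument except `k` in `const r k` is the index of a register. -/
inductive Prog : Type
  /-- do nothing -/
  | skip
  /-- `r := k` -/
  | const (r k : ℕ)
  /-- `r := a + b` -/
  | add (r a b : ℕ)
  /-- `r := a - b`, truncated at `0` -/
  | sub (r a b : ℕ)
  /-- `r := mem[a]` -/
  | load (r a : ℕ)
  /-- `mem[a] := b` -/
  | store (a b : ℕ)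
  /-- append the content of `r` to the word that is being output -/
  | write (r : ℕ)
  /-- declare the word that is being output complete and start a new, empty one -/
  | emit
  | seq (p q : Prog)
  /-- `if r ≠ 0 then p else q` -/
  | branch (r : ℕ) (p q : Prog)
  /-- `while r ≠ 0 do p` -/
  | loop (r : ℕ) (p : Prog)

/-- The content of the registers and of the memory. -/
@[ext] structure State where
  reg : ℕ → ℕ
  mem : ℕ → ℕ

/-- What an observer sees in one step of a computation. -/
inductive Event : Type
  /-- a step without output -/
  | tick
  /-- a number is appended to the current output word -/
  | wrote (x : ℕ)
  /-- the current output word is completed -/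
  | emitted
  deriving DecidableEq

/-- The state with register `r` set to `x`. -/
def State.setReg (s : State) (r x : ℕ) : State := ⟨Function.update s.reg r x, s.mem⟩

/-- The state with memory cell `a` set to `x`. -/
def State.setMem (s : State) (a x : ℕ) : State := ⟨s.reg, Function.update s.mem a x⟩

/-- `Exec p s tr s'`: started in state `s`, the program `p` halts in state `s'`, and `tr` lists
the steps that it makes, one event for each. Every elementary instruction (`skip` included) and
every evaluation of the test of a `branch` or `loop` is one step, so the running time is
`tr.length`. -/
inductive Exec : Prog → State → List Event → State → Prop
  | skip (s : State) : Exec .skip s [.tick] s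
  | const (s : State) (r k : ℕ) : Exec (.const r k) s [.tick] (s.setReg r k)
  | add (s : State) (r a b : ℕ) :
      Exec (.add r a b) s [.tick] (s.setReg r (s.reg a + s.reg b))
  | sub (s : State) (r a b : ℕ) :
      Exec (.sub r a b) s [.tick] (s.setReg r (s.reg a - s.reg b))
  | load (s : State) (r a : ℕ) :
      Exec (.load r a) s [.tick] (s.setReg r (s.mem (s.reg a)))
  | store (s : State) (a b : ℕ) :
      Exec (.store a b) s [.tick] (s.setMem (s.reg a) (s.reg b))
  | write (s : State) (r : ℕ) : Exec (.write r) s [.wrote (s.reg r)] s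
  | emit (s : State) : Exec .emit s [.emitted] s
  | seq {p q : Prog} {s s' s'' : State} {t₁ t₂ : List Event}
      (h₁ : Exec p s t₁ s') (h₂ : Exec q s' t₂ s'') : Exec (.seq p q) s (t₁ ++ t₂) s''
  | branch_true {r : ℕ} {p q : Prog} {s s' : State} {t₁ : List Event}
      (hr : s.reg r ≠ 0) (h : Exec p s t₁ s') : Exec (.branch r p q) s (.tick :: t₁) s'
  | branch_false {r : ℕ} {p q : Prog} {s s' : State} {t₁ : List Event}
      (hr : s.reg r = 0) (h : Exec q s t₁ s') : Exec (.branch r p q) s (.tick :: t₁) s'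
  | loop_done {r : ℕ} {p : Prog} {s : State}
      (hr : s.reg r = 0) : Exec (.loop r p) s [.tick] s
  | loop_again {r : ℕ} {p : Prog} {s s' s'' : State} {t₁ t₂ : List Event}
      (hr : s.reg r ≠ 0) (h₁ : Exec p s t₁ s') (h₂ : Exec (.loop r p) s' t₂ s'') :
      Exec (.loop r p) s (.tick :: (t₁ ++ t₂)) s''

/-- Computations are deterministic: the run of a program from a given state is unique. -/
theorem Exec.unique {p : Prog} {s s₁ s₂ : State} {t₁ t₂ : List Event}
    (h₁ : Exec p s t₁ s₁) (h₂ : Exec p s t₂ s₂) : t₁ = t₂ ∧ s₁ = s₂ := by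
  induction h₁ generalizing t₂ s₂ with
  | seq _ _ ih₁ ih₂ =>
    cases h₂ with
    | seq g₁ g₂ =>
      obtain ⟨rfl, rfl⟩ := ih₁ g₁
      obtain ⟨rfl, rfl⟩ := ih₂ g₂
      exact ⟨rfl, rfl⟩
  | branch_true hr _ ih =>
    cases h₂ with
    | branch_true _ g => obtain ⟨rfl, rfl⟩ := ih g; exact ⟨rfl, rfl⟩
    | branch_false hr' _ => exact absurd hr' hr
  | branch_false hr _ ih =>
    cases h₂ with
    | branch_true hr' _ => exact absurd hr hr'
    | branch_false _ g => obtain ⟨rfl, rfl⟩ := ih g; exact ⟨rfl, rfl⟩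
  | loop_done hr =>
    cases h₂ with
    | loop_done _ => exact ⟨rfl, rfl⟩
    | loop_again hr' _ _ => exact absurd hr hr'
  | loop_again hr _ _ ih₁ ih₂ =>
    cases h₂ with
    | loop_done hr' => exact absurd hr' hr
    | loop_again _ g₁ g₂ =>
      obtain ⟨rfl, rfl⟩ := ih₁ g₁
      obtain ⟨rfl, rfl⟩ := ih₂ g₂
      exact ⟨rfl, rfl⟩
  | _ => cases h₂; exact ⟨rfl, rfl⟩

/-! ### Input, output, delay -/

open Classical in
/-- The initial state on input `(G, ℓ)`: register `0` holds the number `n` of vertices, register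
`1` holds `ℓ`, the memory holds the adjacency matrix of `G` row by row from address `0` on, and
everything else is `0`. -/
noncomputable def inputState {n : ℕ} (G : SimpleGraph (Fin n)) (ℓ : ℕ) : State where
  reg r := if r = 0 then n else if r = 1 then ℓ else 0
  mem a := if ∃ i j : Fin n, G.Adj i j ∧ a = i * n + j then 1 else 0

/-- The phases of a computation: the trace cut at the completions of output words. The first
phase ends with the first completed word, and the last one with the halting of the machine. -/
def phases (tr : List Event) : List (List Event) := tr.splitOn .emitted

/-- The word written in a sequence of steps. -/
def wordOf (seg : List Event) : List ℕ :=
  seg.filterMap fun e => match e with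
    | .wrote x => some x
    | _ => none

/-- The completed output words of a computation, in order. -/
def outputs (tr : List Event) : List (List ℕ) := (phases tr).dropLast.map wordOf

/-- The word `w` describes the partition `P` of `{0, …, n - 1}`: it has length `n`, and two
vertices are in the same part if and only if their labels in `w` agree. -/
def Describes {n : ℕ} (w : List ℕ) (P : Finpartition (Finset.univ : Finset (Fin n))) : Prop :=
  w.length = n ∧ ∀ i j : Fin n, w[(i : ℕ)]? = w[(j : ℕ)]? ↔ P.part i = P.part j

/-- The output of the computation `tr` is a list of all solutions of `(G, ℓ)`, each of them
exactly once. -/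
def EnumeratesSolutions {n : ℕ} (G : SimpleGraph (Fin n)) (ℓ : ℕ) (tr : List Event) : Prop :=
  ∃ sols : List (Finpartition (Finset.univ : Finset (Fin n))),
    sols.Nodup ∧ (∀ P, P ∈ sols ↔ IsSolution G ℓ P) ∧ List.Forall₂ Describes (outputs tr) sols

/-- The delay of the computation `tr` is at most `D`: at most `D` steps are made before the first
solution is output, between any two consecutive solutions, and from the last solution to the
halting of the machine (and in total, if there is no solution). -/
def DelayAtMost (tr : List Event) (D : ℝ) : Prop :=
  ∀ seg ∈ phases tr, (seg.length : ℝ) ≤ D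

end MatchingMulticut

/-! Let `U` meet every induced path on three vertices, so that the components outside `U` are
cliques. A greedy maximal family of disjoint induced paths provides such a set: every cluster
deletion set contains a vertex of each of these paths, whence `k = |U| ≤ 3 dc(G)` (`card_hit_le`,
`Inst.k_ofGraph_le`).

In a matching multicut, all vertices of a clique component other than one fixed vertex lie in a
common part (`Inst.Good.eq_of_comp`), so two labels describe a component. Once `U` is labeled,
different components interact only through the set of those vertices of `U` that already have a
neighbor with another label, and through the number of labels that are new outside `U`. The
solutions are therefore paths in a layered graph whose nodes record this information. Labels are
canonical: a class of `U` is named by its least index, and the other parts are named `k`, `k + 1`, …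
in the order in which they appear. This makes the correspondence between accepted paths and
solutions a bijection (`isMM_labeling`, `card_labels`, `exists_path`, `path_unique`).

Paths in a layered graph are counted backwards by dynamic programming, and path number `r` is read
off from the counts (`accepted_path`, `path_injective`, `exists_path_eq`). Hence no search is
needed: preprocessing and the output of one solution are both polynomial in the number `B ^ 5` of
nodes per layer, with `B = k ^ k + 2 ^ k + 2 n + 5`. As `B` is a sum of a term in `k` and a term in
`n`, a power of it splits, up to constants, into a power of each. This leaves `t ^ O(t)` plus a
polynomial in `n`, which is within the required bound.

For the machine, all predicates are written as expressions with bounded sums and folds. One compiler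
is verified for them (`wp_compile`), with a cost polynomial in the range of the bounded operators
(`cost_le_pow`); `Hoare` triples compose such polynomial bounds. -/

namespace MatchingMulticut

/-! ### Silent runs -/

/-- Started in `s`, the program `p` halts without output after at most `T` steps, in a state
that satisfies `Q`. -/
def WP (p : Prog) (s : State) (T : ℕ) (Q : State → Prop) : Prop :=
  ∃ tr s', Exec p s tr s' ∧ (∀ e ∈ tr, e = Event.tick) ∧ tr.length ≤ T ∧ Q s'

infixr:60 " ;; " => Prog.seq

section Rules

variable {p q : Prog} {s : State} {T T' : ℕ} {Q Q' : State → Prop}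

theorem WP.mono (h : WP p s T Q) (hT : T ≤ T') (hQ : ∀ s', Q s' → Q' s') : WP p s T' Q' := by
  obtain ⟨tr, s', h1, h2, h3, h4⟩ := h
  exact ⟨tr, s', h1, h2, h3.trans hT, hQ _ h4⟩

theorem WP.mono_time (h : WP p s T Q) (hT : T ≤ T') : WP p s T' Q := h.mono hT fun _ h => h

theorem WP.const {r k : ℕ} (h : Q (s.setReg r k)) : WP (.const r k) s 1 Q :=
  ⟨_, _, .const s r k, by simp, by simp, h⟩

theorem WP.add {r a b : ℕ} (h : Q (s.setReg r (s.reg a + s.reg b))) : WP (.add r a b) s 1 Q :=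
  ⟨_, _, .add s r a b, by simp, by simp, h⟩

theorem WP.sub {r a b : ℕ} (h : Q (s.setReg r (s.reg a - s.reg b))) : WP (.sub r a b) s 1 Q :=
  ⟨_, _, .sub s r a b, by simp, by simp, h⟩

theorem WP.load {r a : ℕ} (h : Q (s.setReg r (s.mem (s.reg a)))) : WP (.load r a) s 1 Q :=
  ⟨_, _, .load s r a, by simp, by simp, h⟩

theorem WP.store {a b : ℕ} (h : Q (s.setMem (s.reg a) (s.reg b))) : WP (.store a b) s 1 Q :=
  ⟨_, _, .store s a b, by simp, by simp, h⟩

theorem WP.seq (h : WP p s T fun s' => WP q s' T' Q) : WP (p ;; q) s (T + T') Q := by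
  obtain ⟨tr, s', h1, h2, h3, tr', s'', g1, g2, g3, g4⟩ := h
  refine ⟨tr ++ tr', s'', .seq h1 g1, ?_, by simp; omega, g4⟩
  intro e he
  rcases List.mem_append.1 he with he | he
  exacts [h2 e he, g2 e he]

theorem WP.branch {r : ℕ} (h : WP (if s.reg r ≠ 0 then p else q) s T Q) :
    WP (.branch r p q) s (T + 1) Q := by
  obtain ⟨tr, s', h1, h2, h3, h4⟩ := h
  refine ⟨.tick :: tr, s', ?_, by simpa using h2, by simp; omega, h4⟩
  split_ifs at h1 with h
  · exact .branch_true h h1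
  · exact .branch_false (not_not.1 h) h1

/-- The invariant is indexed by the round, so it also determines the number of rounds: the test
succeeds in `I i` for `i < M` and fails in `I M`. No separate termination measure is needed. -/
theorem WP.loop {r M : ℕ} {I : ℕ → State → Prop} (h0 : I 0 s)
    (hstep : ∀ i < M, ∀ s, I i s → s.reg r ≠ 0 ∧ WP p s T (I (i + 1)))
    (hend : ∀ s, I M s → s.reg r = 0) :
    WP (.loop r p) s (M * (T + 1) + 1) (I M) := by
  suffices H : ∀ k i s, i + k = M → I i s → WP (.loop r p) s (k * (T + 1) + 1) (I M) from
    H M 0 s (by omega) h0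
  intro k
  induction k with
  | zero =>
    intro i s hi hI
    obtain rfl : i = M := by omega
    exact ⟨_, _, .loop_done (hend s hI), by simp, by simp, hI⟩
  | succ k ih =>
    intro i s hi hI
    obtain ⟨hr, tr, s', h1, h2, h3, h4⟩ := hstep i (by omega) s hI
    obtain ⟨tr', s'', g1, g2, g3, g4⟩ := ih (i + 1) s' (by omega) h4
    refine ⟨_, s'', .loop_again hr h1 g1, ?_, ?_, g4⟩
    · intro e he
      simp only [List.mem_cons, List.mem_append] at he
      rcases he with he | he | he
      exacts [he, h2 e he, g2 e he]
    · simp only [List.length_cons, List.length_append]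
      rw [Nat.succ_mul]
      omega

end Rules

/-! ### A language of expressions -/

/-- The number of global variables: registers `0, …, numGlobals - 1`. -/
abbrev numGlobals : ℕ := 24

/-- Expressions. The local variables of an expression form a list, `var i` is its `i`-th entry.
The bounded operators `sum` and `fold` range over the numbers below global variable `2`; `sum`
appends its index to the local variables, `fold` its index and its accumulator. In `call f k as`
the local variables of `f` are the values of `as`. -/
inductive Ex : Type
  | var (i : ℕ)
  | glob (g : Fin 24)
  | const (k : ℕ)
  | add (a b : Ex)
  | sub (a b : Ex)
  | load (a : Ex)
  | ite (c a b : Ex)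
  | sum (e : Ex)
  | fold (e₀ e : Ex)
  | call (f : Ex) (k : ℕ) (as : Fin k → Ex)

namespace Ex

/-- The value of an expression. -/
def eval (γ μ : ℕ → ℕ) : Ex → List ℕ → ℕ
  | var i, ρ => ρ.getD i 0
  | glob g, _ => γ g
  | const k, _ => k
  | add a b, ρ => a.eval γ μ ρ + b.eval γ μ ρ
  | sub a b, ρ => a.eval γ μ ρ - b.eval γ μ ρ
  | load a, ρ => μ (a.eval γ μ ρ)
  | ite c a b, ρ => if c.eval γ μ ρ ≠ 0 then a.eval γ μ ρ else b.eval γ μ ρ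
  | sum e, ρ => ∑ j ∈ Finset.range (γ 2), e.eval γ μ (ρ ++ [j])
  | fold e₀ e, ρ => Nat.rec (e₀.eval γ μ ρ) (fun j acc => e.eval γ μ (ρ ++ [j, acc])) (γ 2)
  | call f _ as, ρ => f.eval γ μ (List.ofFn fun i => (as i).eval γ μ ρ)

/-- The program that computes an expression whose local variables are in the registers `fr`; the
result goes to register `D`, and no register below `D` is changed. -/
def compile : Ex → List ℕ → ℕ → Prog
  -- A copy is an addition to zero. Clearing `D` first is safe because the source register lies
  -- below `D`.
  | var i, fr, D => if h : i < fr.length then .const D 0 ;; .add D D fr[i] else .const D 0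
  | glob g, _, D => .const D 0 ;; .add D D g
  | const k, _, D => .const D k
  | add a b, fr, D => a.compile fr D ;; b.compile fr (D + 1) ;; .add D D (D + 1)
  | sub a b, fr, D => a.compile fr D ;; b.compile fr (D + 1) ;; .sub D D (D + 1)
  | load a, fr, D => a.compile fr D ;; .load D D
  | ite c a b, fr, D => c.compile fr D ;; .branch D (a.compile fr D) (b.compile fr D)
  -- `D` holds the partial sum, `D + 1` the index and `D + 2` the number of remaining rounds. The
  -- body works from `D + 3` on, and that register is reused for the constant 1.
  | sum e, fr, D =>
    .const D 0 ;; .const (D + 1) 0 ;; .const (D + 2) 0 ;; .add (D + 2) (D + 2) 2 ;;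
    .loop (D + 2) (e.compile (fr ++ [D + 1]) (D + 3) ;; .add D D (D + 3) ;;
      .const (D + 3) 1 ;; .add (D + 1) (D + 1) (D + 3) ;; .sub (D + 2) (D + 2) (D + 3))
  | fold e₀ e, fr, D =>
    -- As for `sum`, except that `D` is the accumulator and is passed to the body after the index.
    e₀.compile fr D ;; .const (D + 1) 0 ;; .const (D + 2) 0 ;; .add (D + 2) (D + 2) 2 ;;
    .loop (D + 2) (e.compile (fr ++ [D + 1, D]) (D + 3) ;; .const D 0 ;; .add D D (D + 3) ;;
      .const (D + 3) 1 ;; .add (D + 1) (D + 1) (D + 3) ;; .sub (D + 2) (D + 2) (D + 3))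
  | call f k as, fr, D =>
    (List.ofFn fun i : Fin k => (as i).compile fr (D + i)).foldr Prog.seq
      (f.compile (List.ofFn fun i : Fin k => D + i) (D + k + 1) ;;
        .const D 0 ;; .add D D (D + k + 1))

/-- A bound on the running time of `compile`, where the bounded operators range up to `N`. -/
def cost (N : ℕ) : Ex → ℕ
  | var _ => 2
  | glob _ => 2
  | const _ => 1
  | add a b => a.cost N + (b.cost N + 1)
  | sub a b => a.cost N + (b.cost N + 1)
  | load a => a.cost N + 1
  | ite c a b => c.cost N + (a.cost N + b.cost N + 1)
  | sum e => N * (e.cost N + 5) + 5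
  | fold e₀ e => e₀.cost N + (N * (e.cost N + 6) + 4)
  | call f k as => (∑ i : Fin k, (as i).cost N) + (f.cost N + 2)

/-- Measuring in a base `W ≥ N + 2` keeps the bound a pure power: a factor 2 is paid for by one more
exponent, and so is the factor `N + 1` of a bounded operator. -/
theorem cost_le_pow (e : Ex) : ∃ c, ∀ N W, N + 2 ≤ W → e.cost N ≤ W ^ c := by
  have two {N W : ℕ} (h : N + 2 ≤ W) (c : ℕ) : 2 * W ^ c ≤ W ^ (c + 1) := by
    rw [pow_succ']; exact Nat.mul_le_mul_right _ (by omega)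
  have up {N W : ℕ} (h : N + 2 ≤ W) {a b : ℕ} (hab : a ≤ b) : W ^ a ≤ W ^ b :=
    Nat.pow_le_pow_right (by omega) hab
  have one {N W : ℕ} (h : N + 2 ≤ W) (c : ℕ) : 1 ≤ W ^ c := Nat.one_le_pow _ _ (by omega)
  induction e with
  | var | glob => exact ⟨1, fun N W h => by simp [cost]; omega⟩
  | const => exact ⟨1, fun N W h => by simp [cost]; omega⟩
  | add a b iha ihb | sub a b iha ihb =>
    obtain ⟨c, hc⟩ := iha
    obtain ⟨d, hd⟩ := ihb
    refine ⟨c + d + 2, fun N W h => ?_⟩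
    have := hc N W h; have := hd N W h
    have := up h (show c ≤ c + d by omega); have := up h (show d ≤ c + d by omega)
    have := two h (c + d); have := two h (c + d + 1); have := one h (c + d)
    simp only [cost, Nat.add_assoc, Nat.reduceAdd] at *; omega
  | load a iha =>
    obtain ⟨c, hc⟩ := iha
    refine ⟨c + 1, fun N W h => ?_⟩
    have := hc N W h; have := two h c; have := one h c
    simp only [cost]; omega
  | ite x a b ihx iha ihb =>
    obtain ⟨c, hc⟩ := iha
    obtain ⟨d, hd⟩ := ihb
    obtain ⟨f, hf⟩ := ihx
    refine ⟨c + d + f + 2, fun N W h => ?_⟩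
    have := hc N W h; have := hd N W h; have := hf N W h
    have := up h (show c ≤ c + d + f by omega); have := up h (show d ≤ c + d + f by omega)
    have := up h (show f ≤ c + d + f by omega)
    have := two h (c + d + f); have := two h (c + d + f + 1); have := one h (c + d + f)
    simp only [cost, Nat.add_assoc, Nat.reduceAdd] at *; omega
  | sum e ih =>
    obtain ⟨c, hc⟩ := ih
    refine ⟨c + 5, fun N W h => ?_⟩
    have h1 := hc N W h
    have h2 := two h c; have h3 := two h (c + 1); have h4 := two h (c + 2); have h6 := one h c
    have h9 := two h (c + 3); have h10 := two h (c + 4)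
    have h5 : (N + 1) * W ^ (c + 3) ≤ W * W ^ (c + 3) := Nat.mul_le_mul_right _ (by omega)
    simp only [Nat.add_assoc, Nat.reduceAdd] at *
    have h7 : N * (e.cost N + 5) ≤ N * W ^ (c + 3) := Nat.mul_le_mul_left _ (by omega)
    simp only [cost]
    rw [← pow_succ', add_mul] at h5
    simp only [Nat.add_assoc, Nat.reduceAdd] at *
    omega
  | fold a e iha ih =>
    obtain ⟨d, hd⟩ := iha
    obtain ⟨f, hf⟩ := ih
    have hd : ∀ N W, N + 2 ≤ W → a.cost N ≤ W ^ (d + f) :=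
      fun N W h => (hd N W h).trans (up h (by omega))
    have hc : ∀ N W, N + 2 ≤ W → e.cost N ≤ W ^ (d + f) :=
      fun N W h => (hf N W h).trans (up h (by omega))
    generalize d + f = c at hc hd
    refine ⟨c + 5, fun N W h => ?_⟩
    have h1 := hc N W h; have h0 := hd N W h
    have h2 := two h c; have h3 := two h (c + 1); have h4 := two h (c + 2); have h6 := one h c
    have h9 := two h (c + 3); have h10 := two h (c + 4)
    have h5 : (N + 1) * W ^ (c + 3) ≤ W * W ^ (c + 3) := Nat.mul_le_mul_right _ (by omega)
    simp only [Nat.add_assoc, Nat.reduceAdd] at *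
    have h7 : N * (e.cost N + 6) ≤ N * W ^ (c + 3) := Nat.mul_le_mul_left _ (by omega)
    simp only [cost]
    rw [← pow_succ', add_mul] at h5
    simp only [Nat.add_assoc, Nat.reduceAdd] at *
    omega
  | call f k as ihf ih =>
    obtain ⟨d, hd⟩ := ihf
    choose c hc using ih
    obtain ⟨b, hb'⟩ : ∃ b, b = d + ∑ i, c i := ⟨_, rfl⟩
    refine ⟨b + k + 2, fun N W h => ?_⟩
    have hb : ∀ i, (as i).cost N ≤ W ^ b := fun i => (hc i N W h).trans
      (up h ((Finset.single_le_sum (fun _ _ => Nat.zero_le _) (Finset.mem_univ i)).trans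
        (hb' ▸ Nat.le_add_left _ _)))
    have h1 : ∑ i : Fin k, (as i).cost N ≤ k * W ^ b := by
      simpa using Finset.sum_le_sum fun i (_ : i ∈ Finset.univ) => hb i
    have h2 := (hd N W h).trans (up h (Nat.le_add_right d (∑ i, c i)))
    rw [← hb'] at h2
    have hN : 2 ≤ W := by omega
    have h3 : (k + 1) * W ^ b ≤ W ^ (b + k) := by
      rw [pow_add, mul_comm]
      exact Nat.mul_le_mul_left _ ((Nat.lt_two_pow_self).trans_le
        (Nat.pow_le_pow_left hN _))
    have h4 := two h (b + k); have h5 := two h (b + k + 1); have h6 := one h (b + k)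
    simp only [cost]
    rw [add_mul] at h3
    simp only [Nat.add_assoc, Nat.reduceAdd] at *
    omega

/-- `s'` is a result state of the computation of `v` into register `D` started in `s`. -/
def Result (s : State) (D v : ℕ) (s' : State) : Prop :=
  s'.reg D = v ∧ (∀ i < D, s'.reg i = s.reg i) ∧ s'.mem = s.mem

/-- Induction on the number of arguments, with a variable first target `d`. Each argument reads only
registers below `D ≤ d` and writes only from its own target on, so the values already computed
survive. -/
theorem wp_args {γ μ : ℕ → ℕ} {fr ρ : List ℕ} {D : ℕ} {Q : State → Prop} {last : Prog} {T : ℕ} :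
    ∀ (k d : ℕ) (as : Fin k → Ex) (_ : D ≤ d) (c : Fin k → ℕ)
      (_ : ∀ i (d : ℕ) (s : State), D ≤ d → fr.map s.reg = ρ →
        (∀ g < numGlobals, s.reg g = γ g) → s.mem = μ →
        WP ((as i).compile fr d) s (c i) (Result s d ((as i).eval γ μ ρ)))
      (s : State) (_ : ∀ r ∈ fr, r < D) (_ : numGlobals ≤ D) (_ : fr.map s.reg = ρ)
      (_ : ∀ g < numGlobals, s.reg g = γ g) (_ : s.mem = μ)
      (_ : ∀ s' : State, (∀ i < d, s'.reg i = s.reg i) → s'.mem = μ →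
        (∀ i : Fin k, s'.reg (d + i) = (as i).eval γ μ ρ) → WP last s' T Q),
      WP ((List.ofFn fun i : Fin k => (as i).compile fr (d + i)).foldr Prog.seq last) s
        ((∑ i, c i) + T) Q := by
  intro k
  induction k with
  | zero =>
    intro d as _ c _ s _ _ _ _ hm H
    simpa using H s (fun _ _ => rfl) hm (fun i => i.elim0)
  | succ k ih =>
    intro d as hd c has s hfr hD hρ hγ hm H
    rw [List.ofFn_succ, List.foldr_cons, Fin.sum_univ_succ, add_assoc]
    refine WP.seq ((has 0 (d + (0 : Fin (k + 1))) s (by simp; omega) hρ hγ hm).mono le_rfl ?_)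
    rintro s1 ⟨h1, h2, h3⟩
    simp only [Fin.coe_ofNat_eq_mod, Nat.zero_mod, Nat.add_zero] at h1 h2
    have := ih (d + 1) (fun i => as i.succ) (by omega) (fun i => c i.succ)
      (fun i d s => has i.succ d s) s1 hfr hD
      (by
        rw [← hρ]
        exact List.map_congr_left fun r hr => h2 r (by have := hfr r hr; omega))
      (fun g hg => by rw [h2 g (by omega), hγ g hg]) (by rw [h3, hm])
      (fun s2 g1 g2 g3 => H s2 (fun i hi => by rw [g1 i (by omega), h2 i hi]) g2 (by
        intro i
        refine Fin.cases ?_ (fun i => ?_) i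
        · simp [g1 d (by omega), h1]
        · rw [← g3 i]; congr 1; simp; omega))
    simpa [add_assoc, add_comm 1] using this

/-- What makes the induction work is that registers below the target are never changed: local
variables, globals and finished intermediate results all lie below the target of the next
subexpression. -/
theorem wp_compile (e : Ex) : ∀ (γ μ : ℕ → ℕ) (fr ρ : List ℕ) (D : ℕ) (s : State),
    (∀ r ∈ fr, r < D) → numGlobals ≤ D → fr.map s.reg = ρ → (∀ g < numGlobals, s.reg g = γ g) →
    s.mem = μ → WP (e.compile fr D) s (e.cost (γ 2)) (Result s D (e.eval γ μ ρ)) := by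
  induction e with
  | var i =>
    rintro γ μ fr ρ D s hfr hD rfl hγ rfl
    rw [compile]
    split_ifs with h
    · refine WP.seq (T := 1) (T' := 1) (.const (.add ⟨?_, ?_, rfl⟩))
      · have := (hfr fr[i] (List.getElem_mem h)).ne
        simp [State.setReg, eval, h, this]
      · intro j hj
        simp [State.setReg, hj.ne]
    · refine WP.mono_time (.const ⟨?_, ?_, rfl⟩) (show 1 ≤ cost _ _ by simp [cost])
      · simp [State.setReg, eval, h]
      · intro j hj
        simp [State.setReg, hj.ne]
  | glob g =>
    rintro γ μ fr ρ D s hfr hD rfl hγ rfl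
    refine WP.seq (T := 1) (T' := 1) (.const (.add ⟨?_, ?_, rfl⟩))
    · have := g.2
      have : (g : ℕ) ≠ D := by have : 24 ≤ D := hD; omega
      simp [State.setReg, eval, this, hγ g g.2]
    · intro j hj
      simp [State.setReg, hj.ne]
  | const k =>
    rintro γ μ fr ρ D s hfr hD rfl hγ rfl
    refine WP.const ⟨by simp [State.setReg, eval], ?_, rfl⟩
    intro j hj
    simp [State.setReg, hj.ne]
  | add a b iha ihb =>
    rintro γ μ fr ρ D s hfr hD hρ hγ hm
    refine WP.seq ((iha γ μ fr ρ D s hfr hD hρ hγ hm).mono le_rfl ?_)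
    rintro s1 ⟨h1, h2, h3⟩
    refine WP.seq ((ihb γ μ fr ρ (D + 1) s1 (fun r hr => (hfr r hr).trans (Nat.lt_succ_self _))
      (by omega) ?_ (fun g hg => by rw [h2 g (by omega), hγ g hg]) (by rw [h3, hm])).mono le_rfl ?_)
    · rw [← hρ]
      exact List.map_congr_left fun r hr => h2 r (hfr r hr)
    rintro s2 ⟨g1, g2, g3⟩
    refine WP.add ⟨?_, ?_, by simp [State.setReg, g3, h3]⟩
    · simp [State.setReg, eval, g1, g2, h1]
    · intro j hj
      simp [State.setReg, hj.ne, g2 j (by omega), h2 j hj]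
  | sub a b iha ihb =>
    rintro γ μ fr ρ D s hfr hD hρ hγ hm
    refine WP.seq ((iha γ μ fr ρ D s hfr hD hρ hγ hm).mono le_rfl ?_)
    rintro s1 ⟨h1, h2, h3⟩
    refine WP.seq ((ihb γ μ fr ρ (D + 1) s1 (fun r hr => (hfr r hr).trans (Nat.lt_succ_self _))
      (by omega) ?_ (fun g hg => by rw [h2 g (by omega), hγ g hg]) (by rw [h3, hm])).mono le_rfl ?_)
    · rw [← hρ]
      exact List.map_congr_left fun r hr => h2 r (hfr r hr)
    rintro s2 ⟨g1, g2, g3⟩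
    refine WP.sub ⟨?_, ?_, by simp [State.setReg, g3, h3]⟩
    · simp [State.setReg, eval, g1, g2, h1]
    · intro j hj
      simp [State.setReg, hj.ne, g2 j (by omega), h2 j hj]
  | load a iha =>
    rintro γ μ fr ρ D s hfr hD hρ hγ hm
    refine WP.seq ((iha γ μ fr ρ D s hfr hD hρ hγ hm).mono le_rfl ?_)
    rintro s1 ⟨h1, h2, h3⟩
    refine WP.load ⟨?_, ?_, by simp [State.setReg, h3]⟩
    · simp [State.setReg, eval, h1, h3, hm]
    · intro j hj
      simp [State.setReg, hj.ne, h2 j hj]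
  | ite c a b ihc iha ihb =>
    rintro γ μ fr ρ D s hfr hD hρ hγ hm
    refine WP.seq ((ihc γ μ fr ρ D s hfr hD hρ hγ hm).mono le_rfl ?_)
    rintro s1 ⟨h1, h2, h3⟩
    have hρ1 : fr.map s1.reg = ρ := by
      rw [← hρ]
      exact List.map_congr_left fun r hr => h2 r (hfr r hr)
    have hγ1 : ∀ g < numGlobals, s1.reg g = γ g := fun g hg => by rw [h2 g (by omega), hγ g hg]
    refine WP.branch ?_
    rw [h1]
    by_cases hc : c.eval γ μ ρ ≠ 0
    · rw [if_pos hc]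
      refine (iha γ μ fr ρ D s1 hfr hD hρ1 hγ1 (by rw [h3, hm])).mono (Nat.le_add_right _ _) ?_
      rintro s2 ⟨g1, g2, g3⟩
      exact ⟨by simp [eval, hc, g1], fun i hi => by rw [g2 i hi, h2 i hi], by rw [g3, h3]⟩
    · rw [if_neg hc]
      refine (ihb γ μ fr ρ D s1 hfr hD hρ1 hγ1 (by rw [h3, hm])).mono (Nat.le_add_left _ _) ?_
      rintro s2 ⟨g1, g2, g3⟩
      rw [not_not] at hc
      exact ⟨by simp [eval, hc, g1], fun i hi => by rw [g2 i hi, h2 i hi], by rw [g3, h3]⟩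
  | sum e ih =>
    rintro γ μ fr ρ D s hfr hD hρ hγ hm
    refine WP.mono_time (WP.seq (T := 1) (.const (WP.seq (T := 1) (.const (WP.seq (T := 1) (.const
      (WP.seq (T := 1) (.add (WP.mono (WP.loop (M := γ 2) (T := e.cost (γ 2) + 4)
        (I := fun i s' => s'.reg D = ∑ j ∈ Finset.range i, e.eval γ μ (ρ ++ [j]) ∧
          s'.reg (D + 1) = i ∧ s'.reg (D + 2) = γ 2 - i ∧ (∀ r < D, s'.reg r = s.reg r) ∧
          s'.mem = s.mem) ?_ ?_ ?_) le_rfl ?_))))))))) ?_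
    · simp [State.setReg]
      refine ⟨?_, fun r hr => ?_⟩
      · have hD : 24 ≤ D := hD
        simp [Function.update_of_ne (show 2 ≠ D + 2 by omega),
          Function.update_of_ne (show 2 ≠ D by omega), Function.update_of_ne
          (show 2 ≠ D + 1 by omega), hγ 2 (by norm_num)]
      · simp [Function.update_of_ne (show r ≠ D + 2 by omega),
          Function.update_of_ne (show r ≠ D + 1 by omega), hr.ne]
    · rintro i hi s1 ⟨h1, h2, h3, h4, h5⟩
      refine ⟨by omega, WP.seq ((ih γ μ (fr ++ [D + 1]) (ρ ++ [i]) (D + 3) s1 ?_ (by omega) ?_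
        (fun g hg => by rw [h4 g (by omega), hγ g hg]) (by rw [h5, hm])).mono le_rfl ?_)⟩
      · intro r hr
        rcases List.mem_append.1 hr with hr | hr
        · have := hfr r hr; omega
        · simp at hr; omega
      · rw [List.map_append, List.map_singleton, h2, ← hρ]
        congr 1
        exact List.map_congr_left fun r hr => h4 r (hfr r hr)
      rintro s2 ⟨g1, g2, g3⟩
      refine WP.seq (T := 1) (T' := 3) (.add (WP.seq (T := 1) (T' := 2) (.const
        (WP.seq (T := 1) (T' := 1) (.add (.sub ?_))))))
      simp [State.setReg]
      refine ⟨?_, ?_, ?_, ?_, ?_⟩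
      · simp [g2 D (by omega), g1, h1, Finset.sum_range_succ]
      · simp [g2 (D + 1) (by omega), h2]
      · simp [g2 (D + 2) (by omega), h3]; omega
      · intro r hr
        simp [Function.update_of_ne (show r ≠ D + 2 by omega),
          Function.update_of_ne (show r ≠ D + 1 by omega),
          Function.update_of_ne (show r ≠ D + 3 by omega), hr.ne, g2 r (by omega), h4 r hr]
      · rw [g3, h5]
    · rintro s1 ⟨h1, h2, h3, h4, h5⟩
      omega
    · rintro s1 ⟨h1, h2, h3, h4, h5⟩
      exact ⟨h1, h4, h5⟩
    · simp only [cost]; ring_nf; omega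
  | fold e₀ e ih₀ ih =>
    rintro γ μ fr ρ D s hfr hD hρ hγ hm
    refine WP.seq ((ih₀ γ μ fr ρ D s hfr hD hρ hγ hm).mono le_rfl ?_)
    rintro s0 ⟨a1, a2, a3⟩
    refine WP.mono_time (WP.seq (T := 1) (.const (WP.seq (T := 1) (.const
      (WP.seq (T := 1) (.add (WP.mono (WP.loop (M := γ 2) (T := e.cost (γ 2) + 5)
        (I := fun i s' => s'.reg D = Nat.rec (e₀.eval γ μ ρ)
            (fun j acc => e.eval γ μ (ρ ++ [j, acc])) i ∧
          s'.reg (D + 1) = i ∧ s'.reg (D + 2) = γ 2 - i ∧ (∀ r < D, s'.reg r = s.reg r) ∧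
          s'.mem = s.mem) ?_ ?_ ?_) le_rfl ?_))))))) ?_
    · simp [State.setReg]
      refine ⟨?_, ?_, fun r hr => ?_, a3⟩
      · simp [a1]
      · have hD : 24 ≤ D := hD
        simp [Function.update_of_ne (show 2 ≠ D + 2 by omega), Function.update_of_ne
          (show 2 ≠ D + 1 by omega), a2 2 (by omega), hγ 2 (by norm_num)]
      · simp [Function.update_of_ne (show r ≠ D + 2 by omega),
          Function.update_of_ne (show r ≠ D + 1 by omega), a2 r hr]
    · rintro i hi s1 ⟨h1, h2, h3, h4, h5⟩
      refine ⟨by omega, WP.seq ((ih γ μ (fr ++ [D + 1, D]) (ρ ++ [i, s1.reg D]) (D + 3) s1 ?_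
        (by omega) ?_
        (fun g hg => by rw [h4 g (by omega), hγ g hg]) (by rw [h5, hm])).mono le_rfl ?_)⟩
      · intro r hr
        rcases List.mem_append.1 hr with hr | hr
        · have := hfr r hr; omega
        · simp at hr; omega
      · rw [List.map_append, List.map_cons, List.map_singleton, h2, ← hρ]
        congr 1
        exact List.map_congr_left fun r hr => h4 r (hfr r hr)
      rintro s2 ⟨g1, g2, g3⟩
      refine WP.seq (T := 1) (T' := 4) (.const (WP.seq (T := 1) (T' := 3) (.add
        (WP.seq (T := 1) (T' := 2) (.const (WP.seq (T := 1) (T' := 1) (.add (.sub ?_))))))))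
      simp [State.setReg]
      refine ⟨?_, ?_, ?_, ?_, ?_⟩
      · simp [g1, h1]
      · simp [g2 (D + 1) (by omega), h2]
      · simp [g2 (D + 2) (by omega), h3]; omega
      · intro r hr
        simp [Function.update_of_ne (show r ≠ D + 2 by omega),
          Function.update_of_ne (show r ≠ D + 1 by omega),
          Function.update_of_ne (show r ≠ D + 3 by omega), hr.ne, g2 r (by omega), h4 r hr]
      · rw [g3, h5]
    · rintro s1 ⟨h1, h2, h3, h4, h5⟩
      omega
    · rintro s1 ⟨h1, h2, h3, h4, h5⟩
      exact ⟨h1, h4, h5⟩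
    · ring_nf; omega
  | call f k as ihf ih =>
    rintro γ μ fr ρ D s hfr hD hρ hγ hm
    refine wp_args k D as le_rfl (fun i => (as i).cost (γ 2)) (fun i d s hd hρ hγ hm =>
      ih i γ μ fr ρ d s (fun r hr => (hfr r hr).trans_le hd) (by omega) hρ hγ hm)
      s hfr hD hρ hγ hm ?_
    intro s1 h1 h2 h3
    refine WP.mono_time (WP.seq ((ihf γ μ _ (List.ofFn fun i => (as i).eval γ μ ρ) (D + k + 1) s1 ?_
      (by omega) ?_
      (fun g hg => by rw [h1 g (by omega), hγ g hg]) h2).mono le_rfl ?_)) le_rfl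
    · intro r hr
      obtain ⟨i, rfl⟩ := (List.mem_ofFn' _ _).1 hr
      have := i.2
      dsimp only
      omega
    · rw [List.map_ofFn]
      congr 1
      funext i
      exact h3 i
    · rintro s2 ⟨g1, g2, g3⟩
      refine WP.seq (T := 1) (T' := 1) (.const (.add ⟨?_, ?_, by simp [State.setReg, g3, h2, hm]⟩))
      · simp [State.setReg, Function.update_of_ne (show D + k + 1 ≠ D by omega), g1, eval]
      · intro j hj
        simp [State.setReg, hj.ne, g2 j (by omega), h1 j hj]

end Ex

namespace Ex

/-! ### Logical operators -/

/-- An expression with a nonzero value represents a true proposition. -/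
def holds (γ μ : ℕ → ℕ) (e : Ex) (ρ : List ℕ) : Prop := e.eval γ μ ρ ≠ 0

def nt (a : Ex) : Ex := sub (const 1) a
def lt (a b : Ex) : Ex := sub b a
def le (a b : Ex) : Ex := nt (sub a b)
def eq (a b : Ex) : Ex := nt (add (sub a b) (sub b a))
def and (a b : Ex) : Ex := ite a b (const 0)
def or (a b : Ex) : Ex := ite a (const 1) b
def imp (a b : Ex) : Ex := ite a b (const 1)
def iff (a b : Ex) : Ex := ite a b (nt b)

/-- There is `j < b` with `e`, where `j` is local variable number `L`. -/
def ex (L : ℕ) (b e : Ex) : Ex := sum (ite (lt (var L) b) (ite e (const 1) (const 0)) (const 0))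
def all (L : ℕ) (b e : Ex) : Ex := nt (ex L b (nt e))
/-- The sum of `e` over all `j < b` with `c`. -/
def sumIf (L : ℕ) (b c e : Ex) : Ex := sum (ite (lt (var L) b) (ite c e (const 0)) (const 0))

def call1 (f a : Ex) : Ex := call f 1 ![a]
def call2 (f a b : Ex) : Ex := call f 2 ![a, b]
def call3 (f a b c : Ex) : Ex := call f 3 ![a, b, c]

section

variable {γ μ : ℕ → ℕ} {a b c e f : Ex} {ρ : List ℕ} {L : ℕ}

open Classical in
theorem eval_ite : eval γ μ (ite c a b) ρ =
    if c.holds γ μ ρ then a.eval γ μ ρ else b.eval γ μ ρ := by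
  simp only [eval, holds]; congr

theorem eval_call1 : eval γ μ (call1 f a) ρ = f.eval γ μ [a.eval γ μ ρ] := by
  simp [call1, eval]

theorem eval_call2 : eval γ μ (call2 f a b) ρ = f.eval γ μ [a.eval γ μ ρ, b.eval γ μ ρ] := by
  simp [call2, eval, List.ofFn_succ]

theorem eval_call3 : eval γ μ (call3 f a b c) ρ =
    f.eval γ μ [a.eval γ μ ρ, b.eval γ μ ρ, c.eval γ μ ρ] := by
  simp [call3, eval, List.ofFn_succ]

theorem holds_call1 : holds γ μ (call1 f a) ρ ↔ f.holds γ μ [a.eval γ μ ρ] := by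
  simp [holds, eval_call1]

theorem holds_call2 :
    holds γ μ (call2 f a b) ρ ↔ f.holds γ μ [a.eval γ μ ρ, b.eval γ μ ρ] := by
  simp [holds, eval_call2]

theorem holds_call3 : holds γ μ (call3 f a b c) ρ ↔
    f.holds γ μ [a.eval γ μ ρ, b.eval γ μ ρ, c.eval γ μ ρ] := by
  simp [holds, eval_call3]

theorem holds_nt : holds γ μ (nt a) ρ ↔ ¬ a.holds γ μ ρ := by
  simp only [holds, nt, eval]; omega

theorem holds_lt : holds γ μ (lt a b) ρ ↔ a.eval γ μ ρ < b.eval γ μ ρ := by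
  simp only [holds, lt, eval]; omega

theorem holds_le : holds γ μ (le a b) ρ ↔ a.eval γ μ ρ ≤ b.eval γ μ ρ := by
  simp only [holds, le, nt, eval]; omega

theorem holds_eq : holds γ μ (eq a b) ρ ↔ a.eval γ μ ρ = b.eval γ μ ρ := by
  simp only [holds, eq, nt, eval]; omega

theorem holds_and : holds γ μ (and a b) ρ ↔ a.holds γ μ ρ ∧ b.holds γ μ ρ := by
  by_cases h : eval γ μ a ρ = 0 <;> simp [holds, and, eval, h]

theorem holds_or : holds γ μ (or a b) ρ ↔ a.holds γ μ ρ ∨ b.holds γ μ ρ := by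
  by_cases h : eval γ μ a ρ = 0 <;> simp [holds, or, eval, h]

theorem holds_imp : holds γ μ (imp a b) ρ ↔ (a.holds γ μ ρ → b.holds γ μ ρ) := by
  by_cases h : eval γ μ a ρ = 0 <;> simp [holds, imp, eval, h]

theorem holds_iff : holds γ μ (iff a b) ρ ↔ (a.holds γ μ ρ ↔ b.holds γ μ ρ) := by
  by_cases h : eval γ μ a ρ = 0 <;> simp [holds, iff, nt, eval, h]
  omega

theorem eval_last (hL : ρ.length = L) (j : ℕ) : eval γ μ (var L) (ρ ++ [j]) = j := by
  subst hL; simp [eval]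

theorem holds_ex (hL : ρ.length = L) : holds γ μ (ex L b e) ρ ↔
    ∃ j < γ 2, j < b.eval γ μ (ρ ++ [j]) ∧ e.holds γ μ (ρ ++ [j]) := by
  rw [holds, ex, eval, Ne, Finset.sum_eq_zero_iff]
  simp only [Finset.mem_range, not_forall]
  refine exists_congr fun j => ?_
  simp only [exists_prop]
  refine and_congr_right fun _ => ?_
  rw [eval_ite, eval_ite, holds_lt, eval_last hL]
  split_ifs with h1 h2 <;> simp [eval, *]

theorem holds_all (hL : ρ.length = L) : holds γ μ (all L b e) ρ ↔
    ∀ j < γ 2, j < b.eval γ μ (ρ ++ [j]) → e.holds γ μ (ρ ++ [j]) := by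
  simp [all, holds_nt, holds_ex hL]

open Classical in
theorem eval_sumIf (hL : ρ.length = L) : eval γ μ (sumIf L b c e) ρ =
    ∑ j ∈ Finset.range (γ 2) with j < b.eval γ μ (ρ ++ [j]) ∧ c.holds γ μ (ρ ++ [j]),
      e.eval γ μ (ρ ++ [j]) := by
  rw [sumIf, eval, Finset.sum_filter]
  refine Finset.sum_congr rfl fun j _ => ?_
  rw [eval_ite, eval_ite, holds_lt, eval_last hL, ite_and]
  split_ifs <;> simp [eval]

end

/-- Rewrites bounded quantifiers with a bound below the range of the operators. -/
theorem exists_lt_and_lt {N n : ℕ} (h : n ≤ N) {p : ℕ → Prop} :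
    (∃ j < N, j < n ∧ p j) ↔ ∃ j < n, p j :=
  ⟨fun ⟨j, _, h1, h2⟩ => ⟨j, h1, h2⟩, fun ⟨j, h1, h2⟩ => ⟨j, h1.trans_le h, h1, h2⟩⟩

theorem forall_lt_lt {N n : ℕ} (h : n ≤ N) {p : ℕ → Prop} :
    (∀ j < N, j < n → p j) ↔ ∀ j < n, p j :=
  ⟨fun H j h1 => H j (h1.trans_le h) h1, fun H j _ h1 => H j h1⟩

theorem filter_range_lt {N n : ℕ} (h : n ≤ N) {p : ℕ → Prop} [DecidablePred p]
    [DecidablePred fun j => j < n ∧ p j] :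
    {j ∈ Finset.range N | j < n ∧ p j} = {j ∈ Finset.range n | p j} := by
  ext j; simp; omega

/-! ### Arithmetic -/

/-- The product of the local variables. -/
def mulF : Ex := sumIf 2 (var 1) (const 1) (var 0)

/-- Multiplication is repeated addition along the range of the bounded sum, which truncates the
second factor at `γ 2`. -/
theorem eval_mulF_min {γ μ : ℕ → ℕ} {a b : ℕ} : eval γ μ mulF [a, b] = a * min b (γ 2) := by
  rw [mulF, eval_sumIf (by rfl)]
  have (j : ℕ) : (const 1).holds γ μ ([a, b] ++ [j]) ↔ True := by simp [holds, eval]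
  simp only [this]
  simp only [eval, List.cons_append, List.nil_append, List.getD_cons_succ, List.getD_cons_zero,
    and_true, Finset.sum_const]
  rw [smul_eq_mul, mul_comm]
  congr 1
  rw [← Finset.card_range (min b (γ 2))]
  congr 1
  ext j; simp; omega

theorem eval_mulF {γ μ : ℕ → ℕ} {a b : ℕ} (hb : b ≤ γ 2) : eval γ μ mulF [a, b] = a * b := by
  rw [eval_mulF_min, min_eq_left hb]

/-- The quotient of the local variables. -/
def divF : Ex :=
  sum (ite (var 1) (le (call2 mulF (add (var 2) (const 1)) (var 1)) (var 0)) (const 0))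

/-- The quotient is the number of `j` with `(j + 1) * y ≤ x`. The product is truncated if `y > γ 2`,
but then the test still fails as it should when `x < γ 2`. This second case is needed for digits,
where the divisor `b ^ j` may exceed the range. -/
theorem eval_divF {γ μ : ℕ → ℕ} {x y : ℕ} (hx : x / y ≤ γ 2) (h : y ≤ γ 2 ∨ x < γ 2) :
    eval γ μ divF [x, y] = x / y := by
  have key (j : ℕ) : eval γ μ (ite (var 1)
      (le (call2 mulF (add (var 2) (const 1)) (var 1)) (var 0)) (const 0))
      ([x, y] ++ [j]) = if j < x / y then 1 else 0 := by
    simp only [le, nt, eval, eval_call2, List.cons_append, List.nil_append, List.getD_cons_succ,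
      List.getD_cons_zero, eval_mulF_min]
    rcases Nat.eq_zero_or_pos y with rfl | hy
    · simp
    rw [if_pos hy.ne']
    rcases le_or_gt y (γ 2) with hN | hN
    · rw [min_eq_left hN]
      have := Nat.le_div_iff_mul_le (x := j + 1) (y := x) hy
      split_ifs <;> omega
    · have hx' : x < γ 2 := h.resolve_left (by omega)
      rw [min_eq_right hN.le, Nat.div_eq_of_lt (by omega), add_mul]
      simp; omega
  rw [divF, eval]
  simp only [key]
  rw [Finset.sum_ite, Finset.sum_const_zero, add_zero, Finset.sum_const, smul_eq_mul, mul_one]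
  conv_rhs => rw [← Finset.card_range (x / y)]
  congr 1
  ext j; simp; omega

def modF : Ex := sub (var 0) (call2 mulF (call2 divF (var 0) (var 1)) (var 1))

theorem eval_modF {γ μ : ℕ → ℕ} {x y : ℕ} (hy : y ≤ γ 2) (hx : x / y ≤ γ 2) :
    eval γ μ modF [x, y] = x % y := by
  simp only [modF, eval, eval_call2, List.getD_cons_succ,
      List.getD_cons_zero, eval_mulF hy, eval_divF hx (.inl hy)]
  rw [Nat.mod_eq_sub_div_mul]

/-- The fold runs through its whole range and multiplies only while the index is below the exponent.
The base is the second factor, so only the base, not the accumulated power, has to be in range. -/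
def powF : Ex :=
  fold (const 1) (ite (lt (var 2) (var 1)) (call2 mulF (var 3) (var 0)) (var 3))

theorem eval_powF {γ μ : ℕ → ℕ} {b j : ℕ} (hb : b ≤ γ 2) (hj : j ≤ γ 2) :
    eval γ μ powF [b, j] = b ^ j := by
  rw [powF, eval]
  suffices H : ∀ M, Nat.rec (motive := fun _ => ℕ) (eval γ μ (const 1) [b, j])
      (fun i acc => eval γ μ (ite (lt (var 2) (var 1)) (call2 mulF (var 3) (var 0)) (var 3))
        ([b, j] ++ [i, acc])) M = b ^ min M j by rw [H, min_eq_right hj]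
  intro M
  induction M with
  | zero => simp [eval]
  | succ M ih =>
    simp only [ih]
    rw [eval_ite, holds_lt, eval_call2]
    simp only [eval, List.cons_append, List.nil_append, List.getD_cons_succ, List.getD_cons_zero,
      eval_mulF hb]
    split_ifs with h
    · rw [← pow_succ]; congr 1; omega
    · congr 1; omega

/-- The `j`-th digit of `x` in base `b`. -/
def _root_.MatchingMulticut.dig (b x j : ℕ) : ℕ := x / b ^ j % b

def digF : Ex := call2 modF (call2 divF (var 1) (call2 powF (var 0) (var 2))) (var 0)

theorem eval_digF {γ μ : ℕ → ℕ} {b x j : ℕ} (hb : b ≤ γ 2) (hj : j ≤ γ 2) (hx : x < γ 2) :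
    eval γ μ digF [b, x, j] = dig b x j := by
  have h1 : x / b ^ j ≤ γ 2 := (Nat.div_le_self _ _).trans hx.le
  simp only [digF, eval, eval_call2, eval_powF hb hj, List.getD_cons_succ, List.getD_cons_zero,
    eval_divF h1 (.inr hx), eval_modF hb ((Nat.div_le_self _ _).trans h1), dig]

end Ex

/-! ### Counting and unranking paths in a layered graph -/

section Select

variable (w : ℕ → ℕ) (N r : ℕ)

/-- The index of the block that contains `r`, where block `e` has length `w e`. -/
def sel : ℕ := ({e ∈ Finset.range N | ∑ i ∈ Finset.range (e + 1), w i ≤ r} : Finset ℕ).card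

variable {w N r}

theorem sum_range_mono {a b : ℕ} (h : a ≤ b) :
    ∑ i ∈ Finset.range a, w i ≤ ∑ i ∈ Finset.range b, w i :=
  Finset.sum_le_sum_of_subset (Finset.range_mono h)

/-- Partial sums are monotone, so the blocks that end at or before `r` are exactly those with index
below `e`. -/
theorem sel_eq {e : ℕ} (he : e < N) (h1 : ∑ i ∈ Finset.range e, w i ≤ r)
    (h2 : r < ∑ i ∈ Finset.range (e + 1), w i) : sel w N r = e := by
  rw [sel]
  conv_rhs => rw [← Finset.card_range e]
  congr 1
  ext j
  simp only [Finset.mem_filter, Finset.mem_range]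
  constructor
  · rintro ⟨_, h⟩
    by_contra hj
    have := sum_range_mono (w := w) (show e + 1 ≤ j + 1 by omega)
    omega
  · intro hj
    exact ⟨by omega, (sum_range_mono (by omega)).trans h1⟩

theorem sel_spec (h : r < ∑ i ∈ Finset.range N, w i) :
    sel w N r < N ∧ ∑ i ∈ Finset.range (sel w N r), w i ≤ r ∧
      r < ∑ i ∈ Finset.range (sel w N r), w i + w (sel w N r) := by
  have hex : ∃ e, r < ∑ i ∈ Finset.range (e + 1), w i :=
    ⟨N, h.trans_le (sum_range_mono (by omega))⟩
  obtain ⟨e, h1, h2⟩ : ∃ e, r < ∑ i ∈ Finset.range (e + 1), w i ∧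
      ∑ i ∈ Finset.range e, w i ≤ r := by
    classical
    refine ⟨Nat.find hex, Nat.find_spec hex, ?_⟩
    rcases h0 : Nat.find hex with _ | e
    · simp
    · exact not_lt.1 (Nat.find_min hex (by omega))
  have he : e < N := by
    by_contra he
    have := sum_range_mono (w := w) (show N ≤ e by omega)
    omega
  rw [sel_eq he h2 h1]
  exact ⟨he, h2, by rwa [← Finset.sum_range_succ]⟩

end Select

/-- A graph with layers `0, …, m`; every layer has the nodes `0, …, N - 1`. A path starts in node
`0` of layer `0`. -/
structure Layered where
  N : ℕ
  m : ℕ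
  R : ℕ → ℕ → ℕ → Prop
  fin : ℕ → Prop

namespace Layered

variable (Λ : Layered)

/-- `p` is a path up to layer `i`. -/
def Path (i : ℕ) (p : ℕ → ℕ) : Prop :=
  p 0 = 0 ∧ ∀ a < i, p (a + 1) < Λ.N ∧ Λ.R a (p a) (p (a + 1))

/-- `p` is a path through all layers to a final node. -/
def Accepted (p : ℕ → ℕ) : Prop := Λ.Path Λ.m p ∧ Λ.fin (p Λ.m)

open Classical in
/-- The number of ways to get from node `d` to a final node in `b` steps. -/
noncomputable def cnt : ℕ → ℕ → ℕ
  | 0, d => if Λ.fin d then 1 else 0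
  | b + 1, d => ∑ e ∈ Finset.range Λ.N, if Λ.R (Λ.m - (b + 1)) d e then cnt b e else 0

open Classical in
/-- The number of ways to continue from node `d` of layer `a` with node `e`. -/
noncomputable def wt (a d e : ℕ) : ℕ := if Λ.R a d e then Λ.cnt (Λ.m - (a + 1)) e else 0

/-- The node in layer `a` of path number `r`, and the number of the rest of the path. -/
noncomputable def unrank (r : ℕ) : ℕ → ℕ × ℕ
  | 0 => (0, r)
  | a + 1 =>
    let s := unrank r a
    let e := sel (Λ.wt a s.1) Λ.N s.2
    (e, s.2 - ∑ i ∈ Finset.range e, Λ.wt a s.1 i)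

noncomputable def path (r a : ℕ) : ℕ := (Λ.unrank r a).1

variable {Λ}

theorem cnt_eq_sum {a d : ℕ} (ha : a < Λ.m) :
    Λ.cnt (Λ.m - a) d = ∑ e ∈ Finset.range Λ.N, Λ.wt a d e := by
  obtain ⟨b, hb⟩ : ∃ b, Λ.m - a = b + 1 := ⟨Λ.m - a - 1, by omega⟩
  rw [hb, cnt]
  simp only [wt]
  rw [show Λ.m - (b + 1) = a by omega, show Λ.m - (a + 1) = b by omega]

/-- The remainder is always a valid number of a continuation from the current node. The last clause
expresses the previous remainder through the present one, which lets a path be ranked again. -/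
theorem unrank_spec {r : ℕ} (hr : r < Λ.cnt Λ.m 0) {a : ℕ} (ha : a ≤ Λ.m) :
    (Λ.unrank r a).2 < Λ.cnt (Λ.m - a) (Λ.path r a) ∧
      (0 < a → Λ.path r a < Λ.N ∧ Λ.R (a - 1) (Λ.path r (a - 1)) (Λ.path r a) ∧
        (Λ.unrank r (a - 1)).2 = ∑ i ∈ Finset.range (Λ.path r a), Λ.wt (a - 1) (Λ.path r (a - 1)) i
          + (Λ.unrank r a).2) := by
  induction a with
  | zero => exact ⟨hr, fun h => absurd h (lt_irrefl _)⟩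
  | succ a ih =>
    have h := (ih (by omega)).1
    rw [cnt_eq_sum (by omega)] at h
    obtain ⟨h1, h2, h3⟩ := sel_spec h
    have hp : Λ.path r (a + 1) = sel (Λ.wt a (Λ.path r a)) Λ.N (Λ.unrank r a).2 := rfl
    have hu : (Λ.unrank r (a + 1)).2 = (Λ.unrank r a).2 -
      ∑ i ∈ Finset.range (Λ.path r (a + 1)), Λ.wt a (Λ.path r a) i := rfl
    rw [← hp] at h1 h2 h3
    have h4 : (Λ.unrank r (a + 1)).2 < Λ.wt a (Λ.path r a) (Λ.path r (a + 1)) := by omega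
    rw [wt] at h4
    split_ifs at h4 with hR
    · exact ⟨h4, fun _ => ⟨h1, hR, by simp only [Nat.add_sub_cancel]; omega⟩⟩
    · omega

theorem accepted_path {r : ℕ} (hr : r < Λ.cnt Λ.m 0) : Λ.Accepted (Λ.path r) := by
  refine ⟨⟨rfl, fun a ha => ?_⟩, ?_⟩
  · obtain ⟨h1, h2, -⟩ := (unrank_spec hr (show a + 1 ≤ Λ.m by omega)).2 (by omega)
    exact ⟨h1, h2⟩
  · have := (unrank_spec hr le_rfl).1
    rw [Nat.sub_self, cnt] at this
    by_contra h
    simp [h] at this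

/-- The remainders are recovered backwards from the path: in the last layer the remainder is below
1, each step back adds the weights of the smaller siblings, and in layer 0 the remainder is the
number of the path. -/
theorem path_injective {r r' : ℕ} (hr : r < Λ.cnt Λ.m 0) (hr' : r' < Λ.cnt Λ.m 0)
    (h : ∀ a ≤ Λ.m, Λ.path r a = Λ.path r' a) : r = r' := by
  suffices H : ∀ b ≤ Λ.m, (Λ.unrank r (Λ.m - b)).2 = (Λ.unrank r' (Λ.m - b)).2 by
    simpa [unrank] using H Λ.m le_rfl
  intro b
  induction b with
  | zero =>
    intro _
    have h1 := (unrank_spec hr le_rfl).1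
    have h2 := (unrank_spec hr' le_rfl).1
    rw [Nat.sub_self, cnt] at h1 h2
    rw [Nat.sub_zero]
    split_ifs at h1 h2 <;> omega
  | succ b ih =>
    intro hb
    have h0 := ih (by omega)
    have h1 := ((unrank_spec hr (show Λ.m - b ≤ Λ.m by omega)).2 (by omega)).2.2
    have h2 := ((unrank_spec hr' (show Λ.m - b ≤ Λ.m by omega)).2 (by omega)).2.2
    rw [show Λ.m - b - 1 = Λ.m - (b + 1) by omega] at h1 h2
    rw [h1, h2, h _ (by omega), h _ (by omega), h0]

theorem exists_path_eq {p : ℕ → ℕ} (hp : Λ.Accepted p) :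
    ∃ r < Λ.cnt Λ.m 0, ∀ a ≤ Λ.m, Λ.path r a = p a := by
  -- The rank of the tail of `p` from layer `a` on: in every later step, the total weight of the
  -- siblings that precede the chosen node.
  set t : ℕ → ℕ := fun a => ∑ j ∈ Finset.Ico a Λ.m, ∑ i ∈ Finset.range (p (j + 1)), Λ.wt j (p j) i
  have ht : ∀ a < Λ.m, t a = ∑ i ∈ Finset.range (p (a + 1)), Λ.wt a (p a) i + t (a + 1) :=
    fun a ha => Finset.sum_eq_sum_Ico_succ_bot ha _
  have hlt : ∀ a ≤ Λ.m, t a < Λ.cnt (Λ.m - a) (p a) := by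
    intro a ha
    induction ha using Nat.decreasingInduction with
    | self => simp [t, cnt, hp.2]
    | of_succ a ha ih =>
      obtain ⟨h1, h2⟩ := hp.1.2 a ha
      rw [cnt_eq_sum ha]
      refine lt_of_lt_of_le ?_ (sum_range_mono (show p (a + 1) + 1 ≤ Λ.N from h1))
      rw [Finset.sum_range_succ, ht a ha]
      simpa [wt, h2] using ih
  refine ⟨t 0, by simpa [hp.1.1] using hlt 0 (Nat.zero_le _), ?_⟩
  suffices H : ∀ a ≤ Λ.m, Λ.unrank (t 0) a = (p a, t a) from fun a ha => by
    rw [path, H a ha]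
  intro a
  induction a with
  | zero => intro _; simp [unrank, hp.1.1]
  | succ a ih =>
    intro ha
    obtain ⟨h1, h2⟩ := hp.1.2 a ha
    have h3 := hlt (a + 1) ha
    have : sel (Λ.wt a (p a)) Λ.N (t a) = p (a + 1) := by
      refine sel_eq h1 ?_ ?_
      · rw [ht a ha]; omega
      · rw [ht a ha, Finset.sum_range_succ]
        simpa [wt, h2] using h3
    simp only [unrank, ih (by omega), this, Prod.mk.injEq, true_and]
    rw [ht a ha]; omega

end Layered

/-! ### Digits -/

theorem dig_lt {b : ℕ} (hb : 0 < b) (x j : ℕ) : dig b x j < b := Nat.mod_lt _ hb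

theorem dig_succ (b x j : ℕ) : dig b x (j + 1) = dig b (x / b) j := by
  rw [dig, dig, pow_succ', Nat.div_div_eq_div_mul]

theorem dig_ext {b : ℕ} : ∀ {k x y : ℕ}, x < b ^ k → y < b ^ k →
    (∀ j < k, dig b x j = dig b y j) → x = y := by
  intro k
  induction k with
  | zero => intro x y hx hy _; simp at hx hy; omega
  | succ k ih =>
    intro x y hx hy h
    rw [pow_succ'] at hx hy
    have h0 := h 0 (by omega)
    simp only [dig, pow_zero, Nat.div_one] at h0
    have := ih (Nat.div_lt_of_lt_mul hx) (Nat.div_lt_of_lt_mul hy) fun j hj => by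
      rw [← dig_succ, ← dig_succ, h _ (by omega)]
    rw [← Nat.div_add_mod x b, ← Nat.div_add_mod y b, h0, this]

theorem exists_dig_eq {b : ℕ} : ∀ (k : ℕ) (f : ℕ → ℕ), (∀ j < k, f j < b) →
    ∃ x < b ^ k, ∀ j < k, dig b x j = f j := by
  intro k
  induction k with
  | zero => intro f _; exact ⟨0, by simp, by simp⟩
  | succ k ih =>
    intro f hf
    obtain ⟨x, hx, h⟩ := ih (fun j => f (j + 1)) fun j hj => hf _ (by omega)
    have h0 := hf 0 (by omega)
    refine ⟨f 0 + b * x, ?_, ?_⟩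
    · rw [pow_succ']
      calc f 0 + b * x < b * (x + 1) := by rw [mul_add]; omega
        _ ≤ b * b ^ k := Nat.mul_le_mul_left _ hx
    · rintro (_ | j) hj
      · simp [dig, Nat.mod_eq_of_lt h0]
      · rw [dig_succ, Nat.add_mul_div_left _ _ (by omega), Nat.div_eq_of_lt h0, zero_add,
          h j (by omega)]

/-! ### Instances and codes of partial solutions -/

/-- A graph on `{0, …, n - 1}`, a set `U` of vertices, and a lower bound for the number of
parts. -/
structure Inst where
  n : ℕ
  l : ℕ
  adj : ℕ → ℕ → Prop
  U : ℕ → Prop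

namespace Inst

open Classical in
/-- The number of elements of `U` below `u`. -/
noncomputable def idx (I : Inst) (u : ℕ) : ℕ := ({v ∈ Finset.range u | I.U v} : Finset ℕ).card

/-- The cardinality of `U`. -/
noncomputable def k (I : Inst) : ℕ := I.idx I.n

/-- A bound for the components of a node. -/
noncomputable def B (I : Inst) : ℕ := I.k ^ I.k + 2 ^ I.k + I.n + I.n + 5

variable (I : Inst)

/-! A node `d` encodes a labeling of `U`, the set of those vertices of `U` that have a neighbor
with another label, the number of labels that were used outside `U` only, and two labels. -/

noncomputable def labels (d : ℕ) : ℕ := dig I.B d 0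
noncomputable def mask (d : ℕ) : ℕ := dig I.B d 1
noncomputable def free (d : ℕ) : ℕ := dig I.B d 2
noncomputable def fst (d : ℕ) : ℕ := dig I.B d 3
noncomputable def snd (d : ℕ) : ℕ := dig I.B d 4

/-- The label of the `j`-th element of `U`. -/
noncomputable def labU (d j : ℕ) : ℕ := dig I.k (I.labels d) j

def bit (d j : ℕ) : Prop := dig 2 (I.mask d) j = 1

/-- `v` is the least vertex of its component outside `U`. -/
def isRep (v : ℕ) : Prop := ¬ I.U v ∧ ∀ w < v, I.U w ∨ ¬ I.adj v w

open Classical in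
/-- The label of `w`, if it is in `U` or in the component of `v`, according to the node `d`. -/
noncomputable def lab (v d w : ℕ) : ℕ :=
  if I.U w then I.labU d (I.idx w) else if w = v then I.fst d else I.snd d

/-- `w` is in `U` or in the component of `v`. -/
def inR (v w : ℕ) : Prop := I.U w ∨ w = v ∨ I.adj v w

/-- Within `U` and the component of `v`, every vertex has at most one neighbor with another
label. -/
def mm (v : ℕ) (f : ℕ → ℕ) : Prop :=
  ∀ y < I.n, I.inR v y → ∀ a < I.n, I.inR v a → I.adj y a → f a ≠ f y →
    ∀ b < I.n, I.inR v b → I.adj y b → f b ≠ f y → a = b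

def cross (v : ℕ) (f : ℕ → ℕ) (u : ℕ) : Prop :=
  ∃ w < I.n, ¬ I.U w ∧ I.inR v w ∧ I.adj u w ∧ f w ≠ f u

def crossU (f : ℕ → ℕ) (u : ℕ) : Prop := ∃ w < I.n, I.U w ∧ I.adj u w ∧ f w ≠ f u

/-- The nodes that encode an admissible labeling of `U`. -/
def init (d : ℕ) : Prop :=
  (I.labels d < I.k ^ I.k ∧ I.mask d < 2 ^ I.k ∧ I.free d = 0 ∧ I.fst d = 0 ∧ I.snd d = 0) ∧
  -- A label is itself an index in its class and does not exceed any index there, so it is the least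
  -- one; a partition of `U` thus has only one code. In `I.mm I.n` the argument `I.n` is not a
  -- vertex, so that only `U` is inspected.
  (∀ j < I.k, I.labU d j ≤ j ∧ I.labU d (I.labU d j) = I.labU d j) ∧ I.mm I.n (I.lab I.n d) ∧
  ∀ u < I.n, I.U u → (I.bit d (I.idx u) ↔ I.crossU (I.lab I.n d) u)

/-- Labels below `k` name classes of `U`, the next `q` labels name the parts opened outside `U` so
far, and `k + q` opens a new part. Allowing only this one fresh label makes the numbering of new
parts unique. -/
def okLabel (d q c : ℕ) : Prop := (c < I.k → I.labU d c = c) ∧ c ≤ I.k + q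

open Classical in
noncomputable def upd (q c : ℕ) : ℕ := if c = I.k + q then q + 1 else q

/-- The node `d'` extends `d` by labels for the component of `i`. -/
def stepRep (i d d' : ℕ) : Prop :=
  I.mask d' < 2 ^ I.k ∧ I.okLabel d' (I.free d) (I.fst d') ∧
    I.okLabel d' (I.upd (I.free d) (I.fst d')) (I.snd d') ∧
    I.free d' = I.upd (I.upd (I.free d) (I.fst d')) (I.snd d') ∧
    -- In a component with one vertex the second label has no bearer; it is tied to the first one so
    -- that the code stays unique.
    ((∀ w < I.n, I.adj i w → I.U w) → I.snd d' = I.fst d') ∧ I.mm i (I.lab i d') ∧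
    -- `mm` excludes two bad neighbors of `u` within `U` and the present component; this excludes
    -- one there together with one met before.
    ∀ u < I.n, I.U u → (I.cross i (I.lab i d') u → ¬ I.bit d (I.idx u)) ∧
      (I.bit d' (I.idx u) ↔ I.bit d (I.idx u) ∨ I.cross i (I.lab i d') u)

/-- A vertex that does not represent a component passes the information on. Its label fields are set
to 0 because unused fields would spoil the uniqueness of paths. -/
def step (i d d' : ℕ) : Prop :=
  I.labels d' = I.labels d ∧ (I.isRep i → I.stepRep i d d') ∧
    (¬ I.isRep i → I.mask d' = I.mask d ∧ I.free d' = I.free d ∧ I.fst d' = 0 ∧ I.snd d' = 0)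

-- Layer 0 is a dummy start, layer 1 fixes the labeling of `U`, and layer `v + 2` is the state after
-- vertex `v`. In `fin` the fixed points of the labeling of `U` count its classes, so the sum is the
-- total number of parts.
open Classical in
noncomputable def layered : Layered where
  N := I.B ^ 5
  m := I.n + 1
  R a d d' := (a = 0 → I.init d') ∧ (¬ a = 0 → I.step (a - 1) d d')
  fin d := I.l ≤ I.free d + ({j ∈ Finset.range I.k | I.labU d j = j} : Finset ℕ).card

open Classical in
/-- The least vertex of the component of `w` outside `U`. -/
noncomputable def rep (w : ℕ) : ℕ :=
  ∑ v ∈ Finset.range I.n with I.isRep v ∧ (v = w ∨ I.adj w v), v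

open Classical in
/-- The labeling that is encoded by the path `p`. -/
noncomputable def labeling (p : ℕ → ℕ) (w : ℕ) : ℕ :=
  I.lab (I.rep w) (p (if I.U w then 1 else I.rep w + 2)) w

/-- The properties of the graph and of `U` that the algorithm depends on. -/
structure Good : Prop where
  symm : ∀ {a b}, I.adj a b → I.adj b a
  irrefl : ∀ {a}, ¬ I.adj a a
  lt : ∀ {a b}, I.adj a b → b < I.n
  ltU : ∀ {a}, I.U a → a < I.n
  cluster : ∀ {a b c}, ¬ I.U a → ¬ I.U b → ¬ I.U c → I.adj a b → I.adj b c → a ≠ c → I.adj a c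

/-- No vertex has two neighbors with labels other than its own. -/
def IsMM (f : ℕ → ℕ) : Prop :=
  ∀ {y a b}, I.adj y a → f a ≠ f y → I.adj y b → f b ≠ f y → a = b

/-- The vertices that were labeled before step `i`. -/
def proc (i w : ℕ) : Prop := w < I.n ∧ (I.U w ∨ I.rep w < i)

variable {I}

/-! ### Nodes as five-digit numbers, and the numbering of `U` -/

theorem exists_node (x m q c₁ c₂ : ℕ) (hx : x < I.B) (hm : m < I.B) (hq : q < I.B) (h1 : c₁ < I.B)
    (h2 : c₂ < I.B) : ∃ d < I.layered.N, I.labels d = x ∧ I.mask d = m ∧ I.free d = q ∧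
      I.fst d = c₁ ∧ I.snd d = c₂ := by
  obtain ⟨d, hd, h⟩ := exists_dig_eq (b := I.B) 5 (fun j => [x, m, q, c₁, c₂].getD j 0) (by
    intro j hj
    interval_cases j <;> simpa)
  exact ⟨d, hd, h 0 (by omega), h 1 (by omega), h 2 (by omega), h 3 (by omega), h 4 (by omega)⟩

theorem node_ext {d d' : ℕ} (hd : d < I.layered.N) (hd' : d' < I.layered.N)
    (h0 : I.labels d = I.labels d') (h1 : I.mask d = I.mask d') (h2 : I.free d = I.free d')
    (h3 : I.fst d = I.fst d') (h4 : I.snd d = I.snd d') : d = d' :=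
  dig_ext hd hd' fun j hj => by
    interval_cases j
    exacts [h0, h1, h2, h3, h4]

theorem idx_lt_of_lt {u v : ℕ} (hu : I.U u) (h : u < v) : I.idx u < I.idx v := by
  classical
  refine Finset.card_lt_card ⟨?_, fun hs => ?_⟩
  · intro w; simp only [Finset.mem_filter, Finset.mem_range]; rintro ⟨h1, h2⟩; exact ⟨by omega, h2⟩
  · have := hs (show u ∈ _ from by simp [h, hu])
    simp at this

theorem idx_injective {u v : ℕ} (hu : I.U u) (hv : I.U v) (h : I.idx u = I.idx v) : u = v := by
  rcases lt_trichotomy u v with h1 | h1 | h1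
  · have := idx_lt_of_lt hu h1; omega
  · exact h1
  · have := idx_lt_of_lt hv h1; omega

theorem exists_idx_eq {j m : ℕ} (hj : j < I.idx m) : ∃ u < m, I.U u ∧ I.idx u = j := by
  classical
  induction m with
  | zero => simp [idx] at hj
  | succ m ih =>
    rw [idx, Finset.range_add_one, Finset.filter_insert] at hj
    split_ifs at hj with h
    · rw [Finset.card_insert_of_notMem (by simp)] at hj
      rcases Nat.lt_succ_iff_lt_or_eq.1 hj with hj | hj
      · obtain ⟨u, h1, h2⟩ := ih hj
        exact ⟨u, by omega, h2⟩
      · exact ⟨m, by omega, h, hj.symm⟩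
    · obtain ⟨u, h1, h2⟩ := ih hj
      exact ⟨u, by omega, h2⟩

theorem idx_le (m : ℕ) : I.idx m ≤ m := by
  classical
  exact (Finset.card_filter_le _ _).trans (by simp)

/-- Only equality of labels matters. This is what allows the labels of a path to be exchanged for
those of any labeling with the same classes. -/
theorem mm_congr {v : ℕ} {f g : ℕ → ℕ}
    (h : ∀ a b, a < I.n → I.inR v a → b < I.n → I.inR v b → (f a = f b ↔ g a = g b)) :
    I.mm v f ↔ I.mm v g := by
  refine forall₅_congr fun y hy hvy a ha => forall_congr' fun hva => forall_congr' fun _ => ?_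
  rw [Ne, h a y ha hva hy hvy]
  refine forall_congr' fun _ => forall₄_congr fun b hb hvb _ => ?_
  rw [Ne, h b y hb hvb hy hvy]

theorem mm_of_isMM {g : ℕ → ℕ} (hg : I.IsMM g) (v : ℕ) : I.mm v g :=
  fun _ _ _ _ _ _ h1 h2 _ _ _ h3 h4 => hg h1 h2 h3 h4

theorem cross_congr {v u : ℕ} {f g : ℕ → ℕ} (hu : I.U u) (hun : u < I.n)
    (h : ∀ a b, a < I.n → I.inR v a → b < I.n → I.inR v b → (f a = f b ↔ g a = g b)) :
    I.cross v f u ↔ I.cross v g u := by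
  refine exists_congr fun w => and_congr_right fun hw => and_congr_right fun _ =>
    and_congr_right fun hvw => and_congr_right fun _ => ?_
  rw [Ne, h w u hw hvw hun (.inl hu)]

theorem crossU_congr {u : ℕ} {f g : ℕ → ℕ} (hu : I.U u)
    (h : ∀ a b, I.U a → I.U b → (f a = f b ↔ g a = g b)) :
    I.crossU f u ↔ I.crossU g u := by
  refine exists_congr fun w => and_congr_right fun hw => and_congr_right fun hwU =>
    and_congr_right fun _ => ?_
  rw [Ne, h w u hwU hu]

/-! ### Components outside `U` and their least vertices -/

namespace Good

variable (hI : I.Good)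
include hI

theorem idx_lt {u : ℕ} (hu : I.U u) : I.idx u < I.k := idx_lt_of_lt hu (hI.ltU hu)

/-- By `cluster`, the component of `w` outside `U` is its closed neighborhood there; the
representative is the minimum of that set. -/
theorem exists_isRep {w : ℕ} (hw : ¬ I.U w) (hwn : w < I.n) :
    ∃ v < I.n, I.isRep v ∧ (v = w ∨ I.adj w v) := by
  classical
  have hex : ∃ v, ¬ I.U v ∧ (v = w ∨ I.adj w v) := ⟨w, hw, .inl rfl⟩
  obtain ⟨h1, h2⟩ := Nat.find_spec hex
  refine ⟨Nat.find hex, ?_, ⟨h1, fun u hu => ?_⟩, h2⟩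
  · rcases h2 with h2 | h2
    · rwa [h2]
    · exact hI.lt h2
  · have := Nat.find_min hex hu
    by_contra! hc
    refine this ⟨hc.1, ?_⟩
    rcases h2 with h2 | h2
    · rw [h2] at hc; exact .inr hc.2
    · by_cases huw : u = w
      · exact .inl huw
      · exact .inr (hI.cluster hw h1 hc.1 h2 hc.2 (Ne.symm huw))

theorem isRep_unique {v v' w : ℕ} (hw : ¬ I.U w) (h : I.isRep v) (h' : I.isRep v')
    (hv : v = w ∨ I.adj w v) (hv' : v' = w ∨ I.adj w v') : v = v' := by
  by_contra hne
  have hadj : I.adj v v' := by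
    rcases hv with rfl | hv <;> rcases hv' with rfl | hv'
    · exact absurd rfl hne
    · exact hv'
    · exact hI.symm hv
    · exact hI.cluster h.1 hw h'.1 (hI.symm hv) hv' hne
  rcases lt_trichotomy v v' with hl | hl | hl
  · exact (h'.2 v hl).elim h.1 fun h => h (hI.symm hadj)
  · exact hne hl
  · exact (h.2 v' hl).elim h'.1 fun h => h hadj

/-- The sum that defines `rep` has exactly one term. -/
theorem rep_eq {v w : ℕ} (hw : ¬ I.U w) (hwn : w < I.n) (h : I.isRep v)
    (hv : v = w ∨ I.adj w v) : I.rep w = v := by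
  classical
  have hvn : v < I.n := hv.elim (fun h => h ▸ hwn) fun h => hI.lt h
  rw [rep, Finset.sum_eq_single v]
  · intro b hb hne
    obtain ⟨-, hb1, hb2⟩ := Finset.mem_filter.1 hb
    exact absurd (hI.isRep_unique hw hb1 h hb2 hv) hne
  · intro hn
    exact absurd (Finset.mem_filter.2 ⟨Finset.mem_range.2 hvn, h, hv⟩) hn

theorem rep_spec {w : ℕ} (hw : ¬ I.U w) (hwn : w < I.n) :
    I.rep w < I.n ∧ I.isRep (I.rep w) ∧ (I.rep w = w ∨ I.adj w (I.rep w)) := by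
  obtain ⟨v, hv, h1, h2⟩ := hI.exists_isRep hw hwn
  rw [hI.rep_eq hw hwn h1 h2]
  exact ⟨hv, h1, h2⟩

/-- Two neighbors outside `U` are in the same component. -/
theorem rep_eq_of_adj {a b : ℕ} (ha : ¬ I.U a) (hb : ¬ I.U b) (h : I.adj a b) :
    I.rep a = I.rep b := by
  have han := hI.lt (hI.symm h)
  obtain ⟨-, h1, h2⟩ := hI.rep_spec hb (hI.lt h)
  refine hI.rep_eq ha han h1 ?_
  rcases h2 with h2 | h2
  · rw [h2]; exact .inr h
  · by_cases hne : I.rep b = a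
    · exact .inl hne
    · exact .inr (hI.cluster ha hb h1.1 h h2 (Ne.symm hne))

theorem inR_iff {v w : ℕ} (hv : I.isRep v) (hw : ¬ I.U w) (hwn : w < I.n) :
    I.inR v w ↔ I.rep w = v := by
  constructor
  · rintro (h | h | h)
    · exact absurd h hw
    · exact hI.rep_eq hw hwn hv (.inl h.symm)
    · exact hI.rep_eq hw hwn hv (.inr (hI.symm h))
  · rintro rfl
    rcases (hI.rep_spec hw hwn).2.2 with h | h
    · exact .inr (.inl h.symm)
    · exact .inr (.inr (hI.symm h))

theorem proc_zero {w : ℕ} : I.proc 0 w ↔ I.U w :=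
  ⟨fun h => h.2.resolve_right (by omega), fun h => ⟨hI.ltU h, .inl h⟩⟩

theorem proc_n {w : ℕ} : I.proc I.n w ↔ w < I.n := by
  refine ⟨fun h => h.1, fun h => ⟨h, ?_⟩⟩
  by_cases hU : I.U w
  · exact .inl hU
  · exact .inr (hI.rep_spec hU h).1

theorem proc_succ_of_isRep {i w : ℕ} (hi : I.isRep i) :
    I.proc (i + 1) w ↔ I.proc i w ∨ (w < I.n ∧ ¬ I.U w ∧ I.inR i w) := by
  by_cases hwn : w < I.n
  · by_cases hU : I.U w
    · simp [proc, hwn, hU]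
    · simp only [proc, hwn, hU, hI.inR_iff hi hU hwn]
      simp; omega
  · simp [proc, hwn]

theorem proc_succ_of_not_isRep {i w : ℕ} (hi : ¬ I.isRep i) : I.proc (i + 1) w ↔ I.proc i w := by
  by_cases hwn : w < I.n
  · by_cases hU : I.U w
    · simp [proc, hwn, hU]
    · have : I.rep w ≠ i := fun h => hi (h ▸ (hI.rep_spec hU hwn).2.1)
      simp only [proc, hwn, hU]
      simp; omega
  · simp [proc, hwn]

theorem not_proc {i w : ℕ} (hi : I.isRep i) (hw : ¬ I.U w) (h : I.inR i w) : ¬ I.proc i w := by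
  rintro ⟨hwn, h1 | h1⟩
  · exact hw h1
  · rw [hI.inR_iff hi hw hwn] at h; omega

end Good

end Inst
-- Canonical labels
namespace Inst

variable {I : Inst}

/-- The labels in use: those of `U`, and `q` more. -/
def inUse (I : Inst) (d q c : ℕ) : Prop := (c < I.k ∧ I.labU d c = c) ∨ (I.k ≤ c ∧ c < I.k + q)

theorem inUse_upd {d q c : ℕ} (h : I.okLabel d q c) (c' : ℕ) :
    I.inUse d (I.upd q c) c' ↔ I.inUse d q c' ∨ c' = c := by
  unfold upd inUse
  split_ifs with hc
  · omega
  · have h1 := h.2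
    constructor
    · exact .inl
    · rintro (h2 | rfl)
      · exact h2
      · by_cases hk : c' < I.k
        · exact .inl ⟨hk, h.1 hk⟩
        · right; omega

theorem not_inUse_add (d q : ℕ) : ¬ I.inUse d q (I.k + q) := by unfold inUse; omega

theorem eq_of_not_inUse {d q c : ℕ} (h : I.okLabel d q c) (h' : ¬ I.inUse d q c) :
    c = I.k + q := by
  have h1 := h.2
  by_contra hc
  refine h' ?_
  by_cases hk : c < I.k
  · exact .inl ⟨hk, h.1 hk⟩
  · right; omega

theorem okLabel_of_inUse {d q c : ℕ} (h : I.inUse d q c) : I.okLabel d q c := by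
  rcases h with ⟨h, h'⟩ | h
  · exact ⟨fun _ => h', by omega⟩
  · exact ⟨fun h => by omega, by omega⟩

/-- An admissible label for a new vertex that is in the same part as those `a ∈ S` with
`g a = y`. -/
theorem exists_okLabel {S : ℕ → Prop} {f g : ℕ → ℕ} {d q : ℕ}
    (hS : ∀ c, (∃ a, S a ∧ f a = c) ↔ I.inUse d q c)
    (hfg : ∀ a b, S a → S b → (f a = f b ↔ g a = g b)) (y : ℕ) :
    ∃ c, I.okLabel d q c ∧ ∀ a, S a → (f a = c ↔ g a = y) := by
  by_cases h : ∃ a, S a ∧ g a = y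
  · obtain ⟨a, ha, rfl⟩ := h
    exact ⟨f a, okLabel_of_inUse ((hS _).1 ⟨a, ha, rfl⟩), fun b hb => hfg b a hb ha⟩
  -- No earlier vertex belongs to the part, so the fresh label is the right one.
  · refine ⟨I.k + q, ⟨fun h => by omega, le_rfl⟩, fun a ha => ⟨fun hc => ?_, fun hc => ?_⟩⟩
    · exact absurd ((hS _).1 ⟨a, ha, hc⟩) (not_inUse_add _ _)
    · exact absurd ⟨a, ha, hc⟩ h

/-- A label in use is determined by any vertex that bears it, and there is only one admissible label
that is not in use. -/
theorem okLabel_unique {S : ℕ → Prop} {f : ℕ → ℕ} {d q c c' : ℕ}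
    (hS : ∀ c, (∃ a, S a ∧ f a = c) ↔ I.inUse d q c) (hc : I.okLabel d q c)
    (hc' : I.okLabel d q c') (h : ∀ a, S a → (f a = c ↔ f a = c')) : c = c' := by
  by_cases h1 : I.inUse d q c
  · obtain ⟨a, ha, rfl⟩ := (hS _).2 h1
    exact (h a ha).1 rfl
  · by_cases h2 : I.inUse d q c'
    · obtain ⟨a, ha, rfl⟩ := (hS _).2 h2
      exact ((h a ha).2 rfl).symm
    · rw [eq_of_not_inUse hc h1, eq_of_not_inUse hc' h2]

theorem okLabel_congr {d d' q c : ℕ} (h : I.labels d = I.labels d') :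
    I.okLabel d q c ↔ I.okLabel d' q c := by
  simp only [okLabel, labU, h]

/-! ### The invariant of a path -/

theorem path_init {p : ℕ → ℕ} {i : ℕ} (hp : I.layered.Path (i + 1) p) : I.init (p 1) :=
  (hp.2 0 (by omega)).2.1 rfl

theorem path_step {p : ℕ → ℕ} {i j : ℕ} (hp : I.layered.Path (i + 1) p) (hj : j < i) :
    I.step j (p (j + 1)) (p (j + 2)) :=
  (hp.2 (j + 1) (by omega)).2.2 (by omega)

theorem path_mono {p : ℕ → ℕ} {i j : ℕ} (hp : I.layered.Path i p) (hj : j ≤ i) :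
    I.layered.Path j p := ⟨hp.1, fun a ha => hp.2 a (by omega)⟩

theorem path_labels {p : ℕ → ℕ} {i j : ℕ} (hp : I.layered.Path (i + 1) p) (hj : j ≤ i) :
    I.labels (p (j + 1)) = I.labels (p 1) := by
  induction j with
  | zero => rfl
  | succ j ih => rw [(path_step hp (show j < i by omega)).1, ih (by omega)]

theorem labeling_of_mem {p : ℕ → ℕ} {w : ℕ} (hw : I.U w) :
    I.labeling p w = I.labU (p 1) (I.idx w) := by
  simp [labeling, lab, hw]

/-- The state of affairs before step `i`. -/
structure Inv (I : Inst) (p : ℕ → ℕ) (i : ℕ) : Prop where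
  bit : ∀ u, I.U u → (I.bit (p (i + 1)) (I.idx u) ↔
    ∃ w, I.proc i w ∧ I.adj u w ∧ I.labeling p w ≠ I.labeling p u)
  used : ∀ c, (∃ w, I.proc i w ∧ I.labeling p w = c) ↔ I.inUse (p 1) (I.free (p (i + 1))) c
  uniq : ∀ u a b, I.U u → I.proc i a → I.proc i b → I.adj u a → I.adj u b →
    I.labeling p a ≠ I.labeling p u → I.labeling p b ≠ I.labeling p u → a = b

namespace Good

variable (hI : I.Good)
include hI

/-- The code of the labeling of `U` is constant along a path, and the labels of a component are read
in the layer of its representative; hence the local view in layer `v + 2` agrees with the global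
labeling. -/
theorem lab_eq_labeling {p : ℕ → ℕ} {i v w : ℕ} (hp : I.layered.Path (i + 1) p) (hv : v < i)
    (hvr : I.isRep v) (hw : w < I.n) (hvw : I.inR v w) :
    I.lab v (p (v + 2)) w = I.labeling p w := by
  by_cases hU : I.U w
  · rw [labeling_of_mem hU, lab, if_pos hU, labU, labU, path_labels hp (show v + 1 ≤ i by omega)]
  · rw [hI.inR_iff hvr hU hw] at hvw
    rw [labeling, if_neg hU, hvw]

/-- The hypothesis `h3` covers the component with a single vertex, where no vertex would bear `c₂`
on its own. -/
theorem comp_labels {i c₁ c₂ : ℕ} {f : ℕ → ℕ} (hi : I.isRep i) (hin : i < I.n) (h1 : f i = c₁)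
    (h2 : ∀ w < I.n, ¬ I.U w → I.inR i w → w ≠ i → f w = c₂)
    (h3 : (∀ w < I.n, I.adj i w → I.U w) → c₂ = c₁) (c : ℕ) :
    (∃ w, (w < I.n ∧ ¬ I.U w ∧ I.inR i w) ∧ f w = c) ↔ c = c₁ ∨ c = c₂ := by
  have hh : c₁ = c ↔ ∃ w, (w < I.n ∧ ¬ I.U w ∧ I.inR i w) ∧ w = i ∧ f w = c := by
    constructor
    · rintro rfl; exact ⟨i, ⟨hin, hi.1, .inr (.inl rfl)⟩, rfl, h1⟩
    · rintro ⟨w, -, rfl, h⟩; rw [← h1, h]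
  constructor
  · rintro ⟨w, ⟨h4, h5, h6⟩, rfl⟩
    by_cases hw : w = i
    · rw [hw]; exact .inl h1
    · exact .inr (h2 w h4 h5 h6 hw)
  · rintro (rfl | rfl)
    · obtain ⟨w, h, -, h'⟩ := hh.1 rfl
      exact ⟨w, h, h'⟩
    · by_cases h : ∀ w < I.n, I.adj i w → I.U w
      · obtain ⟨w, h, -, h'⟩ := hh.1 (h3 h).symm
        exact ⟨w, h, h'⟩
      · push Not at h
        obtain ⟨w, hw, ha, hU⟩ := h
        have hR : I.inR i w := .inr (.inr ha)
        exact ⟨w, ⟨hw, hU, hR⟩, h2 w hw hU hR fun h => hI.irrefl (h ▸ ha)⟩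

theorem inv_zero {p : ℕ → ℕ} (hp : I.layered.Path 1 p) : I.Inv p 0 := by
  obtain ⟨⟨-, -, h0, -, -⟩, h1, h2, h3⟩ := path_init hp
  have hL : ∀ u, I.U u → I.lab I.n (p 1) u = I.labeling p u := fun u hu => by
    rw [labeling_of_mem hu, lab, if_pos hu]
  refine ⟨fun u hu => ?_, fun c => ?_, fun u a b hu ha hb hua hub hna hnb => ?_⟩
  · rw [h3 u (hI.ltU hu) hu]
    simp only [hI.proc_zero]
    refine exists_congr fun w => ⟨fun ⟨_, h5, h6, h7⟩ => ⟨h5, h6, ?_⟩, fun ⟨h5, h6, h7⟩ =>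
      ⟨hI.ltU h5, h5, h6, ?_⟩⟩
    · rwa [← hL w h5, ← hL u hu]
    · rwa [hL w h5, hL u hu]
  · simp only [hI.proc_zero]
    rw [inUse, zero_add, h0]
    constructor
    · rintro ⟨w, hw, rfl⟩
      have := h1 _ (hI.idx_lt hw)
      rw [labeling_of_mem hw]
      exact .inl ⟨this.1.trans_lt (hI.idx_lt hw), this.2⟩
    · rintro (⟨h4, h5⟩ | h4)
      · obtain ⟨u, -, hu, hj⟩ := exists_idx_eq h4
        exact ⟨u, hu, by rw [labeling_of_mem hu, hj, h5]⟩
      · omega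
  · rw [hI.proc_zero] at ha hb
    rw [← hL u hu, ← hL a ha] at hna
    rw [← hL u hu, ← hL b hb] at hnb
    exact h2 u (hI.ltU hu) (.inl hu) a (hI.ltU ha) (.inl ha) hua hna b (hI.ltU hb) (.inl hb) hub hnb

theorem inv_succ {p : ℕ → ℕ} {i : ℕ} (hin : i < I.n) (hp : I.layered.Path (i + 2) p)
    (ih : I.Inv p i) : I.Inv p (i + 1) := by
  have hs := path_step hp (show i < i + 1 by omega)
  by_cases hi : I.isRep i
  · obtain ⟨-, h1, h2, h3, h4, h5, h6⟩ := hs.2.1 hi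
    have hlab : I.labels (p (i + 2)) = I.labels (p 1) :=
      path_labels hp (show i + 1 ≤ i + 1 from le_rfl)
    rw [okLabel_congr hlab] at h1 h2
    have hL : ∀ w < I.n, I.inR i w → I.lab i (p (i + 2)) w = I.labeling p w := fun w hw hiw =>
      hI.lab_eq_labeling hp (show i < i + 1 by omega) hi hw hiw
    have hcr : ∀ u, I.U u → (I.cross i (I.lab i (p (i + 2))) u ↔
        ∃ w, (w < I.n ∧ ¬ I.U w ∧ I.inR i w) ∧ I.adj u w ∧ I.labeling p w ≠ I.labeling p u) := by
      intro u hu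
      rw [cross_congr (g := I.labeling p) hu (hI.ltU hu) fun a b ha hia hb hib => by
        rw [hL a ha hia, hL b hb hib]]
      simp only [cross, and_assoc]
    refine ⟨fun u hu => ?_, fun c => ?_, fun u a b hu ha hb hua hub hna hnb => ?_⟩
    · rw [(h6 u (hI.ltU hu) hu).2, ih.bit u hu, hcr u hu]
      simp only [hI.proc_succ_of_isRep hi, or_and_right, exists_or]
    · rw [show I.free (p (i + 1 + 1)) = _ from h3, inUse_upd h2, inUse_upd h1, ← ih.used]
      simp only [hI.proc_succ_of_isRep hi, or_and_right, exists_or, or_assoc]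
      refine or_congr_right (hI.comp_labels hi hin ?_ ?_ h4 c)
      · rw [← hL i hin (.inr (.inl rfl)), lab, if_neg hi.1, if_pos rfl]
      · intro w hw hU hiw hne
        rw [← hL w hw hiw, lab, if_neg hU, if_neg hne]
    · rw [mm_congr (g := I.labeling p) fun a b ha hia hb hib => by
        rw [hL a ha hia, hL b hb hib]] at h5
      -- A bad neighbor of `u` before step `i` has marked `u`, and a marked vertex may not acquire a
      -- bad neighbor in the component of `i`.
      have key : ∀ a b, I.proc i a → (b < I.n ∧ ¬ I.U b ∧ I.inR i b) → I.adj u a → I.adj u b →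
          I.labeling p a ≠ I.labeling p u → I.labeling p b ≠ I.labeling p u → False :=
        fun a b ha hb hua hub hna hnb =>
          (h6 u (hI.ltU hu) hu).1 ((hcr u hu).2 ⟨b, hb, hub, hnb⟩)
            ((ih.bit u hu).2 ⟨a, ha, hua, hna⟩)
      rw [hI.proc_succ_of_isRep hi] at ha hb
      rcases ha with ha | ha <;> rcases hb with hb | hb
      · exact ih.uniq u a b hu ha hb hua hub hna hnb
      · exact (key a b ha hb hua hub hna hnb).elim
      · exact (key b a hb ha hub hua hnb hna).elim
      · exact h5 u (hI.ltU hu) (.inl hu) a ha.1 ha.2.2 hua hna b hb.1 hb.2.2 hub hnb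
  · obtain ⟨h1, h2, -, -⟩ := hs.2.2 hi
    have hb : ∀ j, I.bit (p (i + 2)) j ↔ I.bit (p (i + 1)) j := fun j => by rw [Inst.bit, h1]; rfl
    refine ⟨fun u hu => ?_, fun c => ?_, fun u a b => ?_⟩
    · simp only [hI.proc_succ_of_not_isRep hi, hb]
      exact ih.bit u hu
    · simp only [hI.proc_succ_of_not_isRep hi, h2]
      exact ih.used c
    · simp only [hI.proc_succ_of_not_isRep hi]
      exact ih.uniq u a b

theorem inv {p : ℕ → ℕ} {i : ℕ} (hin : i ≤ I.n) (hp : I.layered.Path (i + 1) p) : I.Inv p i := by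
  induction i with
  | zero => exact hI.inv_zero hp
  | succ i ih => exact hI.inv_succ hin hp (ih (by omega) (path_mono hp (by omega)))

/-- The labeling that a path encodes is a matching multicut. -/
theorem isMM_labeling {p : ℕ → ℕ} (hp : I.layered.Path (I.n + 1) p) :
    I.IsMM (I.labeling p) := by
  intro y a b hya hna hyb hnb
  have ha := hI.lt hya
  have hb := hI.lt hyb
  have hy := hI.lt (hI.symm hya)
  by_cases hU : I.U y
  · exact (hI.inv le_rfl hp).uniq y a b hU (hI.proc_n.2 ha) (hI.proc_n.2 hb) hya hyb hna hnb
  · obtain ⟨h1, h2, h3⟩ := hI.rep_spec hU hy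
    -- All neighbors of a vertex outside `U` lie in `U` or in its own component, so the local
    -- condition at its representative suffices.
    have hR : ∀ w < I.n, w = y ∨ I.adj y w → I.inR (I.rep y) w := by
      intro w hw h
      by_cases hwU : I.U w
      · exact .inl hwU
      · rw [hI.inR_iff h2 hwU hw]
        rcases h with rfl | h
        · rfl
        · exact (hI.rep_eq_of_adj hU hwU h).symm
    have hL : ∀ w < I.n, I.inR (I.rep y) w → I.lab (I.rep y) (p (I.rep y + 2)) w = I.labeling p w :=
      fun w hw hiw => hI.lab_eq_labeling hp h1 h2 hw hiw
    have := ((path_step hp h1).2.1 h2).2.2.2.2.2.1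
    rw [mm_congr (g := I.labeling p) fun a b ha hia hb hib => by
        rw [hL a ha hia, hL b hb hib]] at this
    exact this y hy (hR y hy (.inl rfl)) a ha (hR a ha (.inr hya)) hya hna b hb
      (hR b hb (.inr hyb)) hyb hnb

open Classical in
/-- The number of labels that a path uses. -/
theorem card_labels {p : ℕ → ℕ} (hp : I.layered.Path (I.n + 1) p) :
    ((Finset.range I.n).image (I.labeling p)).card = I.free (p (I.n + 1)) +
      ({j ∈ Finset.range I.k | I.labU (p (I.n + 1)) j = j} : Finset ℕ).card := by
  have : (Finset.range I.n).image (I.labeling p) =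
      ({j ∈ Finset.range I.k | I.labU (p (I.n + 1)) j = j} : Finset ℕ) ∪
        Finset.Ico I.k (I.k + I.free (p (I.n + 1))) := by
    ext c
    have := (hI.inv le_rfl hp).used c
    simp only [hI.proc_n, inUse] at this
    simp only [Finset.mem_image, Finset.mem_range, Finset.mem_union, Finset.mem_filter,
      Finset.mem_Ico, this, labU, path_labels hp le_rfl]
  rw [this, Finset.card_union_of_disjoint, Nat.card_Ico]
  · omega
  · rw [Finset.disjoint_left]
    intro c
    simp only [Finset.mem_filter, Finset.mem_range, Finset.mem_Ico]
    omega

end Good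
end Inst
-- From matching multicuts to paths: existence and uniqueness
namespace Inst

variable {I : Inst}

theorem labeling_congr {p p' : ℕ → ℕ} {i w : ℕ} (h : ∀ a ≤ i + 1, p a = p' a) (hw : I.proc i w) :
    I.labeling p w = I.labeling p' w := by
  unfold labeling
  split_ifs with hU
  · rw [h 1 (by omega)]
  · have := hw.2.resolve_left hU
    rw [h _ (by omega)]

theorem pow_lt_B : I.k ^ I.k < I.B ∧ 2 ^ I.k < I.B ∧ I.n + I.n + 5 ≤ I.B := by
  have : 0 < 2 ^ I.k := by positivity
  have : 0 ≤ I.k ^ I.k := Nat.zero_le _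
  generalize h1 : I.k ^ I.k = a at *
  generalize h2 : 2 ^ I.k = b at *
  unfold B
  rw [h1, h2]
  omega

theorem k_le : I.k ≤ I.n := idx_le _

theorem path_update {p : ℕ → ℕ} {i d : ℕ} (hp : I.layered.Path (i + 1) p)
    (hd : d < I.layered.N) (hs : I.step i (p (i + 1)) d) :
    I.layered.Path (i + 2) (Function.update p (i + 2) d) := by
  refine ⟨by simp [hp.1], fun a ha => ?_⟩
  rw [Function.update_of_ne (show a ≠ i + 2 by omega)]
  by_cases h : a = i + 1
  · subst h
    rw [Function.update_self]
    exact ⟨hd, fun h => by omega, fun _ => by simpa using hs⟩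
  · rw [Function.update_of_ne (show a + 1 ≠ i + 2 by omega)]
    exact hp.2 a (by omega)

open Classical in
theorem exists_mask (P : ℕ → Prop) : ∃ x < 2 ^ I.k, ∀ j < I.k, dig 2 x j = 1 ↔ P j := by
  obtain ⟨x, hx, h⟩ := exists_dig_eq (b := 2) I.k (fun j => if P j then 1 else 0)
    (fun j _ => by split_ifs <;> omega)
  refine ⟨x, hx, fun j hj => ?_⟩
  rw [h j hj]
  split_ifs <;> simpa

theorem mask_ext {x y : ℕ} (hx : x < 2 ^ I.k) (hy : y < 2 ^ I.k)
    (h : ∀ j < I.k, dig 2 x j = 1 ↔ dig 2 y j = 1) : x = y :=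
  dig_ext hx hy fun j hj => by
    have h1 := dig_lt (show 0 < 2 by omega) x j
    have h2 := dig_lt (show 0 < 2 by omega) y j
    have := h j hj
    omega

theorem path_one_eq {p p' : ℕ → ℕ} (hp : I.layered.Path 1 p) (hp' : I.layered.Path 1 p')
    (h : ∀ a b, I.U a → I.U b → (I.labeling p a = I.labeling p b ↔
      I.labeling p' a = I.labeling p' b)) : p 1 = p' 1 := by
  obtain ⟨⟨a1, a2, a3, a4, a5⟩, b, -, c⟩ := path_init hp
  obtain ⟨⟨a1', a2', a3', a4', a5'⟩, b', -, c'⟩ := path_init hp'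
  have hker : ∀ j < I.k, ∀ l < I.k, (I.labU (p 1) j = I.labU (p 1) l ↔
      I.labU (p' 1) j = I.labU (p' 1) l) := by
    intro j hj l hl
    obtain ⟨u, -, hu, rfl⟩ := exists_idx_eq hj
    obtain ⟨v, -, hv, rfl⟩ := exists_idx_eq hl
    have := h u v hu hv
    rwa [labeling_of_mem hu, labeling_of_mem hv, labeling_of_mem hu, labeling_of_mem hv] at this
  have hx : I.labels (p 1) = I.labels (p' 1) := dig_ext a1 a1' fun j hj => by
    change I.labU (p 1) j = I.labU (p' 1) j
    have h1 := b j hj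
    have h1' := b' j hj
    -- The label of `j` is an index in the class of `j`. Comparing `j` with this index in the other
    -- code shows that each of the two labels is at most the other.
    have h2 := (hker j hj _ (h1.1.trans_lt hj)).1 h1.2.symm
    have h3 := (hker j hj _ (h1'.1.trans_lt hj)).2 h1'.2.symm
    have h4 := b' _ (h1.1.trans_lt hj)
    have h5 := b _ (h1'.1.trans_lt hj)
    omega
  refine node_ext (hp.2 0 (by omega)).1 (hp'.2 0 (by omega)).1 hx
    (mask_ext a2 a2' fun j hj => ?_) (a3.trans a3'.symm) (a4.trans a4'.symm) (a5.trans a5'.symm)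
  obtain ⟨u, hun, hu, rfl⟩ := exists_idx_eq hj
  refine (c u hun hu).trans (Iff.trans ?_ (c' u hun hu).symm)
  refine crossU_congr hu fun a b ha hb => ?_
  have := h a b ha hb
  rw [labeling_of_mem ha, labeling_of_mem hb, labeling_of_mem ha, labeling_of_mem hb] at this
  simpa only [lab, ha, hb, if_true]

namespace Good

variable (hI : I.Good)
include hI

/-- Every label counted by `free` is borne by a vertex. This keeps the counter bounded by `n`
although a single step could raise it by 2. -/
theorem free_le {p : ℕ → ℕ} {i : ℕ} (hin : i ≤ I.n) (hp : I.layered.Path (i + 1) p) :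
    I.free (p (i + 1)) ≤ I.n := by
  classical
  have h := (hI.inv hin hp).used
  have hs : Finset.Ico I.k (I.k + I.free (p (i + 1))) ⊆
      (Finset.range I.n).image (I.labeling p) := by
    intro c hc
    rw [Finset.mem_Ico] at hc
    obtain ⟨w, hw, rfl⟩ := (h c).2 (.inr hc)
    exact Finset.mem_image_of_mem _ (Finset.mem_range.2 hw.1)
  have := (Finset.card_le_card hs).trans Finset.card_image_le
  simpa using this

/-- The other vertices of the component of `i` are in the same part. -/
theorem eq_of_comp {g : ℕ → ℕ} (hg : I.IsMM g) {i a b : ℕ} (hi : ¬ I.U i) (ha : ¬ I.U a)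
    (hb : ¬ I.U b) (hia : I.adj i a) (hib : I.adj i b) : g a = g b := by
  by_contra hne
  have hab : a ≠ b := fun h => hne (h ▸ rfl)
  have hadj : I.adj a b := hI.cluster ha hi hb (hI.symm hia) hib hab
  -- Otherwise `a` would have the two neighbors `i` and `b` outside its part.
  have h1 : g i = g a := by
    by_contra h
    have := hg (hI.symm hia) h hadj (Ne.symm hne)
    exact hI.irrefl (this ▸ hib)
  have h2 : g i = g b := by
    by_contra h
    have := hg (hI.symm hib) h (hI.symm hadj) hne
    exact hI.irrefl (this ▸ hia)
  exact hne (h1.symm.trans h2)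

theorem exists_path_zero {g : ℕ → ℕ} (hg : I.IsMM g) :
    ∃ p, I.layered.Path 1 p ∧
      ∀ a b, I.U a → I.U b → (I.labeling p a = I.labeling p b ↔ g a = g b) := by
  have hv : ∀ j, ∃ u, j < I.k → I.U u ∧ I.idx u = j := fun j => by
    by_cases hj : j < I.k
    · obtain ⟨u, -, h⟩ := exists_idx_eq hj
      exact ⟨u, fun _ => h⟩
    · exact ⟨0, fun h => absurd h hj⟩
  choose v hv using hv
  have hvi : ∀ u, I.U u → v (I.idx u) = u := fun u hu => by
    obtain ⟨h1, h2⟩ := hv _ (hI.idx_lt hu)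
    exact idx_injective h1 hu h2
  -- The canonical name of a class of `U`: the least index in it.
  set f : ℕ → ℕ := fun j => sInf {l | g (v l) = g (v j)}
  have hf1 : ∀ j, f j ≤ j := fun j => Nat.sInf_le rfl
  have hf2 : ∀ j, g (v (f j)) = g (v j) := fun j =>
    Nat.sInf_mem (s := {l | g (v l) = g (v j)}) ⟨j, rfl⟩
  have hf3 : ∀ j j', f j = f j' ↔ g (v j) = g (v j') := fun j j' =>
    ⟨fun h => by rw [← hf2 j, ← hf2 j', h], fun h => by simp only [f, h]⟩
  obtain ⟨x, hx, hxf⟩ := exists_dig_eq (b := I.k) I.k f fun j hj => (hf1 j).trans_lt hj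
  obtain ⟨m, hm, hmb⟩ := exists_mask (I := I) fun j => I.crossU g (v j)
  obtain ⟨hB1, hB2, hB3⟩ := pow_lt_B (I := I)
  obtain ⟨d, hd, hdx, hdm, hdq, hd1, hd2⟩ := exists_node (I := I) x m 0 0 0
    (by omega) (by omega) (by omega) (by omega)
    (by omega)
  have hlU : ∀ j < I.k, I.labU d j = f j := fun j hj => by rw [labU, hdx, hxf j hj]
  have hlab : ∀ a b, I.U a → I.U b → (I.labU d (I.idx a) = I.labU d (I.idx b) ↔ g a = g b) := by
    intro a b ha hb
    rw [hlU _ (hI.idx_lt ha), hlU _ (hI.idx_lt hb), hf3, hvi a ha, hvi b hb]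
  have hlab' : ∀ a b, I.U a → I.U b → (I.lab I.n d a = I.lab I.n d b ↔ g a = g b) := by
    intro a b ha hb
    rw [lab, if_pos ha, lab, if_pos hb, hlab a b ha hb]
  have hR : ∀ a < I.n, I.inR I.n a → I.U a := by
    rintro a ha (h | h | h)
    · exact h
    · omega
    · exact absurd (hI.lt (hI.symm h)) (lt_irrefl _)
  refine ⟨fun a => if a = 1 then d else 0, ⟨rfl, fun a ha => ?_⟩, fun a b ha hb => ?_⟩
  · obtain rfl : a = 0 := by omega
    refine ⟨hd, fun _ => ⟨⟨by simpa [hdx], by simpa [hdm], hdq, hd1, hd2⟩, fun j hj => ?_, ?_,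
      fun u hun hu => ?_⟩, fun h => absurd rfl h⟩
    · simp only [zero_add, if_true]
      have := hf1 j
      rw [hlU j hj, hlU _ (by omega), hf3, hf2]
      exact ⟨this, rfl⟩
    · simp only [zero_add, if_true]
      rw [mm_congr fun a b ha hia hb hib => hlab' a b (hR a ha hia) (hR b hb hib)]
      exact mm_of_isMM hg _
    · simp only [zero_add, if_true]
      rw [bit, hdm, hmb _ (hI.idx_lt hu), hvi u hu, crossU_congr hu hlab']
  · rw [labeling_of_mem ha, labeling_of_mem hb, ← hlab a b ha hb]
    simp

/-- Both labels come from `exists_okLabel`: the first relative to the vertices labeled so far, the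
second relative to these and `i`. Since the remaining vertices of the component share a part of `g`,
the second label serves all of them. -/
theorem exists_stepRep {g : ℕ → ℕ} (hg : I.IsMM g) {i : ℕ} (hin : i < I.n) (hi : I.isRep i)
    {p : ℕ → ℕ} (hp : I.layered.Path (i + 1) p)
    (hpg : ∀ a b, I.proc i a → I.proc i b → (I.labeling p a = I.labeling p b ↔ g a = g b)) :
    ∃ d < I.layered.N, I.step i (p (i + 1)) d ∧
      (∀ a b, a < I.n → I.U a ∨ I.inR i a → I.proc i b →
        (I.lab i d a = I.labeling p b ↔ g a = g b)) ∧
      ∀ a b, a < I.n → I.inR i a → b < I.n → I.inR i b →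
        (I.lab i d a = I.lab i d b ↔ g a = g b) := by
  classical
  have inv := hI.inv hin.le hp
  set e := p (i + 1) with he
  have hxe : I.labels e = I.labels (p 1) := path_labels hp le_rfl
  obtain ⟨c₁, hc₁, h₁⟩ := exists_okLabel inv.used hpg (g i)
  -- `w₀` stands for the vertices of the component other than `i`; if there are none, it is `i`
  -- itself, which forces the two labels to coincide.
  obtain ⟨w₀, hw₀⟩ : ∃ w₀, (∀ w, I.adj i w → ¬ I.U w → g w = g w₀) ∧
      ((∀ w < I.n, I.adj i w → I.U w) → w₀ = i) := by
    by_cases h : ∀ w < I.n, I.adj i w → I.U w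
    · exact ⟨i, fun w hw hU => absurd (h w (hI.lt hw) hw) hU, fun _ => rfl⟩
    · have h' := h
      push Not at h'
      obtain ⟨w, hw, ha, hU⟩ := h'
      exact ⟨w, fun w' ha' hU' => hI.eq_of_comp hg hi.1 hU' hU ha' ha, fun h' => absurd h' h⟩
  set f : ℕ → ℕ := fun w => if w = i then c₁ else I.labeling p w
  have hni : ¬ I.proc i i := hI.not_proc hi hi.1 (.inr (.inl rfl))
  have hf : ∀ a, I.proc i a → f a = I.labeling p a := fun a ha =>
    if_neg fun h : a = i => hni (h ▸ ha)
  have hfi : f i = c₁ := if_pos rfl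
  obtain ⟨c₂, hc₂, h₂⟩ := exists_okLabel (S := fun w => I.proc i w ∨ w = i) (f := f) (g := g)
    (d := p 1) (q := I.upd (I.free e) c₁)
    (fun c => by
      rw [inUse_upd hc₁, ← inv.used]
      simp only [or_and_right, exists_or, exists_eq_left, hfi, eq_comm (a := c)]
      refine or_congr_left (exists_congr fun a => and_congr_right fun ha => by rw [hf a ha]))
    (by
      rintro a b (ha | rfl) (hb | rfl)
      · rw [hf a ha, hf b hb]; exact hpg a b ha hb
      · rw [hf a ha, hfi]; exact h₁ a ha
      · rw [hf b hb, hfi, eq_comm, h₁ b hb, eq_comm]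
      · simp) (g w₀)
  obtain ⟨m, hm, hmb⟩ := exists_mask (I := I) fun j => I.bit e j ∨
    ∃ u, I.U u ∧ I.idx u = j ∧ I.cross i g u
  have hk := k_le (I := I)
  have hq : I.free e ≤ I.n := hI.free_le hin.le hp
  -- The counter stays at most `n + 2` and the labels at most `2 n + 1`; the summand `2 n + 5` of
  -- `B` leaves room for both.
  have hu1 : I.upd (I.free e) c₁ ≤ I.n + 1 := by unfold upd; split_ifs <;> omega
  have hu2 : I.upd (I.upd (I.free e) c₁) c₂ ≤ I.n + 2 := by
    rw [upd]; split_ifs <;> omega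
  have hb1 := hc₁.2
  rw [← he] at hb1
  have hb2 := hc₂.2
  obtain ⟨hB1, hB2, hB3⟩ := pow_lt_B (I := I)
  obtain ⟨d, hd, hdx, hdm, hdq, hd1, hd2⟩ := exists_node (I := I) (I.labels e) m
    (I.upd (I.upd (I.free e) c₁) c₂) c₁ c₂
    (by have := (path_init hp).1.1; rw [hxe]; omega)
    (by omega) (by omega) (by omega) (by omega)
  have hlabU : ∀ a, I.U a → I.lab i d a = I.labeling p a := fun a ha => by
    rw [lab, if_pos ha, labeling_of_mem ha, labU, labU, hdx, hxe]
  have hlabi : I.lab i d i = c₁ := by rw [lab, if_neg hi.1, if_pos rfl, hd1]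
  have hlabw : ∀ a, ¬ I.U a → a ≠ i → I.lab i d a = c₂ := fun a ha hne => by
    rw [lab, if_neg ha, if_neg hne, hd2]
  have hcl : ∀ a < I.n, I.inR i a → I.proc i a ∧ I.U a ∨ a = i ∨
      (¬ I.U a ∧ a ≠ i ∧ g a = g w₀) := by
    intro a ha hia
    by_cases hU : I.U a
    · exact .inl ⟨⟨ha, .inl hU⟩, hU⟩
    · rcases hia with h | h | h
      · exact absurd h hU
      · exact .inr (.inl h)
      · exact .inr (.inr ⟨hU, fun h' => hI.irrefl (h' ▸ h), hw₀.1 a h hU⟩)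
  have hA : ∀ a b, a < I.n → I.U a ∨ I.inR i a → I.proc i b →
        (I.lab i d a = I.labeling p b ↔ g a = g b) := by
    intro a b ha hia hb
    rcases hcl a ha (hia.elim .inl id) with h | rfl | h
    · rw [hlabU a h.2, hpg a b h.1 hb]
    · rw [hlabi, eq_comm, h₁ b hb, eq_comm]
    · rw [hlabw a h.1 h.2.1, eq_comm, ← hf b hb, h₂ b (.inl hb), h.2.2, eq_comm]
  have hB : ∀ a b, a < I.n → I.inR i a → b < I.n → I.inR i b →
        (I.lab i d a = I.lab i d b ↔ g a = g b) := by
    intro a b ha hia hb hib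
    rcases hcl a ha hia with h | rfl | h
    · rw [hlabU a h.2, eq_comm, hA b a hb (.inr hib) h.1, eq_comm]
    · rcases hcl b hb hib with h' | rfl | h'
      · rw [hlabU b h'.2, hA _ b ha (.inr hia) h'.1]
      · simp
      · rw [hlabi, hlabw b h'.1 h'.2.1, h'.2.2, ← h₂ _ (.inr rfl), hfi]
    · rcases hcl b hb hib with h' | rfl | h'
      · rw [hlabU b h'.2, hA _ b ha (.inr hia) h'.1]
      · rw [hlabi, hlabw a h.1 h.2.1, h.2.2, eq_comm, ← hfi, h₂ _ (.inr rfl), eq_comm]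
      · rw [hlabw a h.1 h.2.1, hlabw b h'.1 h'.2.1, h.2.2, h'.2.2]
        simp
  have hcr : ∀ u, I.U u → (I.cross i (I.lab i d) u ↔ I.cross i g u) := fun u hu =>
    cross_congr hu (hI.ltU hu) hB
  refine ⟨d, hd, ⟨hdx, fun _ => ⟨by rw [hdm]; exact hm, ?_, ?_, by rw [hdq, hd1, hd2],
    fun h => ?_, (mm_congr hB).2 (mm_of_isMM hg i), fun u hun hu => ⟨fun h => ?_, ?_⟩⟩,
    fun h => absurd hi h⟩, hA, hB⟩
  · rw [hd1]; exact (okLabel_congr (hdx.trans hxe)).2 hc₁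
  · rw [hd1, hd2]; exact (okLabel_congr (hdx.trans hxe)).2 hc₂
  · have h3 := hw₀.2 h
    have := (h₂ i (.inr rfl)).2 (by rw [h3])
    rw [hd1, hd2, ← this, hfi]
  · rw [inv.bit u hu]
    rintro ⟨w, hw, huw, hne⟩
    obtain ⟨w', hw', hU', hR', ha', hne'⟩ := (hcr u hu).1 h
    rw [Ne, hpg w u hw ⟨hun, .inl hu⟩] at hne
    -- Both bad neighbors of `u` coincide because `g` is a matching multicut, but one was labeled
    -- before and the other was not.
    have := hg huw hne ha' hne'
    exact hI.not_proc hi hU' hR' (this ▸ hw)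
  · rw [bit, hdm, hmb _ (hI.idx_lt hu), hcr u hu]
    refine or_congr_right ⟨?_, fun h => ⟨u, hu, rfl, h⟩⟩
    rintro ⟨u', hu', hj, h⟩
    rwa [← idx_injective hu' hu hj]

/-- Every matching multicut is encoded by a path. -/
theorem exists_path {g : ℕ → ℕ} (hg : I.IsMM g) {i : ℕ} (hin : i ≤ I.n) :
    ∃ p, I.layered.Path (i + 1) p ∧
      ∀ a b, I.proc i a → I.proc i b → (I.labeling p a = I.labeling p b ↔ g a = g b) := by
  induction i with
  | zero =>
    obtain ⟨p, hp, h⟩ := hI.exists_path_zero hg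
    exact ⟨p, hp, fun a b ha hb => h a b (hI.proc_zero.1 ha) (hI.proc_zero.1 hb)⟩
  | succ i ih =>
    obtain ⟨p, hp, hpg⟩ := ih (by omega)
    have old : ∀ d w, I.proc i w →
        I.labeling (Function.update p (i + 2) d) w = I.labeling p w := fun d w hw =>
      labeling_congr (fun a ha => Function.update_of_ne (by omega) _ _) hw
    by_cases hi : I.isRep i
    · obtain ⟨d, hd, hs, hA, hB⟩ := hI.exists_stepRep hg hin hi hp hpg
      have hp' := path_update hp hd hs
      refine ⟨_, hp', fun a b ha hb => ?_⟩
      have new : ∀ w, w < I.n → I.inR i w →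
          I.labeling (Function.update p (i + 2) d) w = I.lab i d w := fun w hw hiw => by
        rw [← hI.lab_eq_labeling (i := i + 1) hp' (by omega) hi hw hiw, Function.update_self]
      rw [hI.proc_succ_of_isRep hi] at ha hb
      rcases ha with ha | ⟨ha, -, hia⟩ <;> rcases hb with hb | ⟨hb, -, hib⟩
      · rw [old d a ha, old d b hb, hpg a b ha hb]
      · rw [old d a ha, new b hb hib, eq_comm, hA b a hb (.inr hib) ha, eq_comm]
      · rw [old d b hb, new a ha hia, hA a b ha (.inr hia) hb]
      · rw [new a ha hia, new b hb hib, hB a b ha hia hb hib]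
    · obtain ⟨hB1, hB2, hB3⟩ := pow_lt_B (I := I)
      obtain ⟨d, hd, hdx, hdm, hdq, hd1, hd2⟩ := exists_node (I := I) (I.labels (p (i + 1)))
        (I.mask (p (i + 1))) (I.free (p (i + 1))) 0 0 (dig_lt (by omega) _ _)
        (dig_lt (by omega) _ _) (dig_lt (by omega) _ _)
        (by omega) (by omega)
      refine ⟨_, path_update hp hd ⟨hdx, fun h => absurd h hi, fun _ => ⟨hdm, hdq, hd1, hd2⟩⟩,
        fun a b ha hb => ?_⟩
      rw [hI.proc_succ_of_not_isRep hi] at ha hb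
      rw [old d a ha, old d b hb, hpg a b ha hb]

/-- A path is determined by the partition that it encodes. -/
theorem path_unique {p p' : ℕ → ℕ} {i : ℕ} (hin : i ≤ I.n) (hp : I.layered.Path (i + 1) p)
    (hp' : I.layered.Path (i + 1) p')
    (h : ∀ a b, a < I.n → b < I.n → (I.labeling p a = I.labeling p b ↔
      I.labeling p' a = I.labeling p' b)) : ∀ a ≤ i + 1, p a = p' a := by
  induction i with
  | zero =>
    intro a ha
    obtain rfl | rfl : a = 0 ∨ a = 1 := by omega
    · rw [hp.1, hp'.1]
    · exact path_one_eq hp hp' fun a b ha hb => h a b (hI.ltU ha) (hI.ltU hb)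
  | succ i ih =>
    have ih := ih (by omega) (path_mono hp (by omega)) (path_mono hp' (by omega))
    intro a ha
    rcases Nat.lt_or_ge a (i + 2) with hlt | hge
    · exact ih a (by omega)
    obtain rfl : a = i + 2 := by omega
    have hs := path_step hp (show i < i + 1 by omega)
    have hs' := path_step hp' (show i < i + 1 by omega)
    have he := ih (i + 1) le_rfl
    have h01 := ih 1 (by omega)
    have hN := (hp.2 (i + 1) (by omega)).1
    have hN' := (hp'.2 (i + 1) (by omega)).1
    by_cases hi : I.isRep i
    · obtain ⟨m1, o1, o2, q1, e1, -, b1⟩ := hs.2.1 hi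
      obtain ⟨m1', o1', o2', q1', e1', -, b1'⟩ := hs'.2.1 hi
      have inv := hI.inv (by omega) (path_mono hp (show i + 1 ≤ i + 2 by omega))
      have hold : ∀ a, I.proc i a → I.labeling p a = I.labeling p' a := fun a ha =>
        labeling_congr ih ha
      have hx : I.labels (p (i + 2)) = I.labels (p 1) :=
        path_labels hp (show i + 1 ≤ i + 1 from le_rfl)
      have hx' : I.labels (p' (i + 2)) = I.labels (p 1) := by
        rw [h01]; exact path_labels hp' (show i + 1 ≤ i + 1 from le_rfl)
      rw [okLabel_congr hx] at o1 o2
      rw [okLabel_congr hx', ← he] at o1' o2'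
      have hLi : ∀ w < I.n, I.inR i w → I.lab i (p (i + 2)) w = I.labeling p w := fun w hw hiw =>
        hI.lab_eq_labeling hp (show i < i + 1 by omega) hi hw hiw
      have hLi' : ∀ w < I.n, I.inR i w → I.lab i (p' (i + 2)) w = I.labeling p' w :=
        fun w hw hiw => hI.lab_eq_labeling hp' (show i < i + 1 by omega) hi hw hiw
      have hRi : I.inR i i := .inr (.inl rfl)
      have l1 : I.labeling p i = I.fst (p (i + 2)) := by
        rw [← hLi i hin hRi, lab, if_neg hi.1, if_pos rfl]
      have l1' : I.labeling p' i = I.fst (p' (i + 2)) := by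
        rw [← hLi' i hin hRi, lab, if_neg hi.1, if_pos rfl]
      -- Both labels are admissible in the same state and are borne by the same earlier vertices, as
      -- the two partitions agree; `okLabel_unique` applies.
      have hc1 : I.fst (p (i + 2)) = I.fst (p' (i + 2)) := by
        refine okLabel_unique inv.used o1 o1' fun a ha => ?_
        rw [← l1, h a i ha.1 hin, l1', hold a ha]
      rw [← hc1] at o2'
      have hc2 : I.snd (p (i + 2)) = I.snd (p' (i + 2)) := by
        by_cases hcomp : ∀ w < I.n, I.adj i w → I.U w
        · rw [e1 hcomp, e1' hcomp, hc1]
        · push Not at hcomp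
          obtain ⟨w, hw, haw, hU⟩ := hcomp
          have hwi : w ≠ i := fun h => hI.irrefl (h ▸ haw)
          have l2 : I.labeling p w = I.snd (p (i + 2)) := by
            rw [← hLi w hw (.inr (.inr haw)), lab, if_neg hU, if_neg hwi]
          have l2' : I.labeling p' w = I.snd (p' (i + 2)) := by
            rw [← hLi' w hw (.inr (.inr haw)), lab, if_neg hU, if_neg hwi]
          refine okLabel_unique (S := fun a => I.proc i a ∨ a = i) (f := I.labeling p)
            (fun c => ?_) o2 o2' ?_
          · rw [inUse_upd o1, ← inv.used]
            simp only [or_and_right, exists_or, exists_eq_left, l1, eq_comm (a := c)]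
          · rintro a (ha | rfl)
            · rw [← l2, h a w ha.1 hw, l2', hold a ha]
            · rw [← l2, h a w hin hw, l2', l1', l1, hc1]
      refine node_ext hN hN' (hx.trans hx'.symm) (mask_ext m1 m1' fun j hj => ?_) ?_ hc1 hc2
      · obtain ⟨u, hun, hu, rfl⟩ := exists_idx_eq hj
        refine (b1 u hun hu).2.trans (Iff.trans ?_ (b1' u hun hu).2.symm)
        rw [he]
        refine or_congr_right (cross_congr hu hun fun a b ha hia hb hib => ?_)
        rw [hLi a ha hia, hLi b hb hib, hLi' a ha hia, hLi' b hb hib, h a b ha hb]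
      · exact q1.trans (by rw [he, hc1, hc2]; exact q1'.symm)
    · obtain ⟨a1, a2, a3, a4⟩ := hs.2.2 hi
      obtain ⟨a1', a2', a3', a4'⟩ := hs'.2.2 hi
      exact node_ext hN hN' (hs.1.trans (he ▸ hs'.1.symm)) (a1.trans (he ▸ a1'.symm))
        (a2.trans (he ▸ a2'.symm)) (a3.trans a3'.symm) (a4.trans a4'.symm)

end Good
end Inst

/-! ### A small set of vertices that meets all induced paths on three vertices -/

section Greedy

variable (adj : ℕ → ℕ → Prop) (n : ℕ)

/-- The vertices `dig n p 0, dig n p 1, dig n p 2` induce a path. -/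
def IsP3 (p : ℕ) : Prop :=
  adj (dig n p 0) (dig n p 1) ∧ adj (dig n p 1) (dig n p 2) ∧ dig n p 0 ≠ dig n p 2 ∧
    ¬ adj (dig n p 0) (dig n p 2)

/-- The triples of vertices that a greedy choice of disjoint induced paths selects. -/
def Selected (p : ℕ) : Prop :=
  IsP3 adj n p ∧ ∀ p' (_ : p' < p), Selected p' → ∀ i < 3, ∀ j < 3, dig n p i ≠ dig n p' j
termination_by p

def Hit (v : ℕ) : Prop := ∃ p < n ^ 3, Selected adj n p ∧ ∃ i < 3, dig n p i = v

variable {adj n}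

/-- An induced path that is not selected was rejected because it meets a selected one. -/
theorem not_hit_of_isP3 {p : ℕ} (hp : p < n ^ 3) (h : IsP3 adj n p) :
    ∃ i < 3, Hit adj n (dig n p i) := by
  by_cases hs : Selected adj n p
  · exact ⟨0, by omega, p, hp, hs, 0, by omega, rfl⟩
  · rw [Selected] at hs
    push Not at hs
    obtain ⟨p', hp', hs', i, hi, j, hj, he⟩ := hs h
    exact ⟨i, hi, p', hp'.trans hp, hs', j, hj, he.symm⟩

-- The selected triples are pairwise disjoint and each contains an element of `D`, so there are at
-- most `D.card` of them, with at most three vertices each.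
open Classical in
theorem card_hit_le (D : Finset ℕ) (hD : ∀ p < n ^ 3, IsP3 adj n p → ∃ i < 3, dig n p i ∈ D)
    (m : ℕ) : ({v ∈ Finset.range m | Hit adj n v} : Finset ℕ).card ≤ 3 * D.card := by
  set S : Finset ℕ := {p ∈ Finset.range (n ^ 3) | Selected adj n p}
  have hS : ∀ p ∈ S, p < n ^ 3 ∧ Selected adj n p := fun p hp => by
    simpa [S] using hp
  have h1 : ({v ∈ Finset.range m | Hit adj n v} : Finset ℕ) ⊆
      S.biUnion fun p => (Finset.range 3).image (dig n p) := by
    intro v hv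
    obtain ⟨-, p, hp, hs, i, hi, he⟩ := Finset.mem_filter.1 hv
    refine Finset.mem_biUnion.2 ⟨p, by simp [S, hp, hs], ?_⟩
    exact Finset.mem_image.2 ⟨i, Finset.mem_range.2 hi, he⟩
  have h2 : S.card ≤ D.card := by
    have : ∀ p, ∃ i, p ∈ S → i < 3 ∧ dig n p i ∈ D := fun p => by
      by_cases hp : p ∈ S
      · have hs := (hS p hp).2
        rw [Selected] at hs
        obtain ⟨i, hi, h⟩ := hD p (hS p hp).1 hs.1
        exact ⟨i, fun _ => ⟨hi, h⟩⟩
      · exact ⟨0, fun h => absurd h hp⟩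
    choose f hf using this
    refine Finset.card_le_card_of_injOn (fun p => dig n p (f p)) (fun p hp => (hf p hp).2) ?_
    intro p hp p' hp' he
    dsimp only at he
    by_contra hne
    rcases lt_or_gt_of_ne hne with h | h
    · have hs := (hS p' hp').2
      rw [Selected] at hs
      exact hs.2 p h (hS p hp).2 _ (hf p' hp').1 _ (hf p hp).1 he.symm
    · have hs := (hS p hp).2
      rw [Selected] at hs
      exact hs.2 p' h (hS p' hp').2 _ (hf p hp).1 _ (hf p' hp').1 he
  refine (Finset.card_le_card h1).trans (Finset.card_biUnion_le.trans ?_)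
  calc ∑ p ∈ S, ((Finset.range 3).image (dig n p)).card ≤ ∑ p ∈ S, 3 :=
        Finset.sum_le_sum fun p _ => Finset.card_image_le.trans (by simp)
    _ ≤ 3 * D.card := by simp; omega

end Greedy

/-! ### The instance of a graph -/

variable {n : ℕ} (G : SimpleGraph (Fin n)) (l : ℕ)

def adjNat (i j : ℕ) : Prop := ∃ (hi : i < n) (hj : j < n), G.Adj ⟨i, hi⟩ ⟨j, hj⟩

def Inst.ofGraph : Inst := ⟨n, l, adjNat G, Hit (adjNat G) n⟩

variable {G}

theorem adjNat_coe {i j : Fin n} : adjNat G i j ↔ G.Adj i j := by simp [adjNat]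

theorem Inst.good_ofGraph : (Inst.ofGraph G l).Good where
  symm := fun ⟨hi, hj, h⟩ => ⟨hj, hi, h.symm⟩
  irrefl := fun ⟨_, _, h⟩ => G.irrefl h
  lt := fun ⟨_, hj, _⟩ => hj
  ltU := by
    rintro v ⟨p, hp, -, i, -, rfl⟩
    refine dig_lt (Nat.pos_of_ne_zero fun h => ?_) _ _
    change p < n ^ 3 at hp
    simp [show n = 0 from h] at hp
  cluster := by
    rintro a b c ha hb hc hab hbc hac
    by_contra h
    have ha' : a < n := hab.1
    have hb' : b < n := hbc.1
    have hc' : c < n := hbc.2.1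
    obtain ⟨p, hp, hd⟩ := exists_dig_eq (b := n) 3 (fun j => [a, b, c].getD j 0) (by
      intro j hj
      interval_cases j <;> simpa)
    have h0 : dig n p 0 = a := hd 0 (by omega)
    have h1 : dig n p 1 = b := hd 1 (by omega)
    have h2 : dig n p 2 = c := hd 2 (by omega)
    obtain ⟨i, hi, hh⟩ := not_hit_of_isP3 (adj := adjNat G) hp
      ⟨by rwa [h0, h1], by rwa [h1, h2], by rwa [h0, h2], by rwa [h0, h2]⟩
    interval_cases i
    · exact ha (h0 ▸ hh)
    · exact hb (h1 ▸ hh)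
    · exact hc (h2 ▸ hh)

/-- An optimal deletion set meets every induced path on three vertices: otherwise the ends of such a
path would be nonadjacent vertices of one component of a cluster graph. -/
theorem Inst.k_ofGraph_le : (Inst.ofGraph G l).k ≤ 3 * distToCluster G := by
  classical
  obtain ⟨D, hD, hcl⟩ : distToCluster G ∈
      {k | ∃ U : Finset (Fin n), U.card = k ∧ IsClusterGraph (G.induce {v | v ∉ U})} := by
    -- The infimum is attained since deleting all vertices is allowed.
    refine Nat.sInf_mem ⟨_, Finset.univ, rfl, fun c => ?_⟩
    intro x
    exact absurd (Finset.mem_univ x.1) x.2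
  have h := card_hit_le (adj := adjNat G) (n := n) (D.image Fin.val) (by
    rintro p hp ⟨⟨h0, h1, hab⟩, ⟨_, h2, hbc⟩, hac, hna⟩
    by_contra! hno
    have hm : ∀ i (hi : i < 3) (hin : dig n p i < n), (⟨dig n p i, hin⟩ : Fin n) ∉ D := by
      intro i hi hin hmem
      exact hno i hi (Finset.mem_image_of_mem Fin.val hmem)
    let a : {v | v ∉ D} := ⟨⟨_, h0⟩, hm 0 (by omega) h0⟩
    let b : {v | v ∉ D} := ⟨⟨_, h1⟩, hm 1 (by omega) h1⟩
    let c : {v | v ∉ D} := ⟨⟨_, h2⟩, hm 2 (by omega) h2⟩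
    have hab' : (G.induce {v | v ∉ D}).Adj a b := hab
    have hbc' : (G.induce {v | v ∉ D}).Adj b c := hbc
    have hreach : (G.induce {v | v ∉ D}).Reachable c a :=
      (hab'.reachable.trans hbc'.reachable).symm
    have := hcl ((G.induce {v | v ∉ D}).connectedComponentMk a) (x := a) rfl (y := c)
      (SimpleGraph.ConnectedComponent.sound hreach) (fun h => hac (by
        simpa [a, c] using h))
    exact hna ⟨h0, h2, this⟩) n
  rw [Finset.card_image_of_injective _ Fin.val_injective, hD] at h
  exact h

/-! ### Labelings and partitions -/

open Classical in
/-- The partition into the sets of vertices with the same label. -/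
noncomputable def partOf (n : ℕ) (f : ℕ → ℕ) : Finpartition (Finset.univ : Finset (Fin n)) :=
  Finpartition.ofSetoid (Setoid.comap (fun v : Fin n => f v) ⊥)

theorem part_partOf_eq_iff (f : ℕ → ℕ) (a b : Fin n) :
    (partOf n f).part a = (partOf n f).part b ↔ f a = f b := by
  classical
  rw [← Finpartition.mem_part_iff_part_eq_part _ (Finset.mem_univ _) (Finset.mem_univ _), partOf,
    Finpartition.mem_part_ofSetoid_iff_rel, Setoid.comap_rel]
  exact eq_comm

theorem parts_eq_image (P : Finpartition (Finset.univ : Finset (Fin n))) :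
    P.parts = Finset.univ.image P.part := by
  ext A
  constructor
  · intro hA
    obtain ⟨a, ha⟩ := P.nonempty_of_mem_parts hA
    exact Finset.mem_image.2 ⟨a, Finset.mem_univ _, P.part_eq_of_mem hA ha⟩
  · rintro hA
    obtain ⟨a, -, rfl⟩ := Finset.mem_image.1 hA
    exact P.part_mem.2 (Finset.mem_univ _)

theorem finpartition_ext {P Q : Finpartition (Finset.univ : Finset (Fin n))}
    (h : ∀ a b, P.part a = P.part b ↔ Q.part a = Q.part b) : P = Q := by
  have : P.part = Q.part := by
    funext a
    ext b
    rw [P.mem_part_iff_part_eq_part (Finset.mem_univ _) (Finset.mem_univ _), h,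
      ← Q.mem_part_iff_part_eq_part (Finset.mem_univ _) (Finset.mem_univ _)]
  apply Finpartition.ext
  rw [parts_eq_image, parts_eq_image, this]

theorem exists_label (P : Finpartition (Finset.univ : Finset (Fin n))) :
    ∃ g : ℕ → ℕ, ∀ a b : Fin n, P.part a = P.part b ↔ g a = g b := by
  refine ⟨fun v => if h : v < n then Fintype.equivFin _ (P.part ⟨v, h⟩) else 0, fun a b => ?_⟩
  simp [Fin.val_inj]

theorem isMatchingMulticut_iff {P : Finpartition (Finset.univ : Finset (Fin n))} {f : ℕ → ℕ}
    (h : ∀ a b : Fin n, P.part a = P.part b ↔ f a = f b) :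
    IsMatchingMulticut G P ↔ (Inst.ofGraph G l).IsMM f := by
  have key : ∀ v w : Fin n, w ∉ P.part v ↔ f w ≠ f v := fun v w => by
    rw [P.mem_part_iff_part_eq_part (Finset.mem_univ _) (Finset.mem_univ _), h]
  constructor
  · rintro H y a b ⟨hy, ha, hya⟩ hna ⟨_, hb, hyb⟩ hnb
    have := H (P.part ⟨y, hy⟩) (P.part_mem.2 (Finset.mem_univ _)) _
      (P.mem_part (Finset.mem_univ _))
    rw [Set.encard_le_one_iff] at this
    exact Fin.val_eq_of_eq (this ⟨a, ha⟩ ⟨b, hb⟩ ⟨hya, (key _ _).2 hna⟩ ⟨hyb, (key _ _).2 hnb⟩)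
  · intro H A hA v hv
    obtain rfl := P.part_eq_of_mem hA hv
    rw [Set.encard_le_one_iff]
    rintro a b ⟨hva, hna⟩ ⟨hvb, hnb⟩
    exact Fin.ext (H (adjNat_coe.2 hva) ((key _ _).1 hna) (adjNat_coe.2 hvb) ((key _ _).1 hnb))

/-- The map `f` factors through `g` and hence takes no more values. Applied in both directions, it
identifies the number of parts with the number of labels. -/
theorem card_image_le_of_factors {α β δ : Type*} [DecidableEq β] [DecidableEq δ] {s : Finset α}
    {f : α → β} {g : α → δ} (h : ∀ a b, g a = g b → f a = f b) :
    (s.image f).card ≤ (s.image g).card := by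
  rcases s.eq_empty_or_nonempty with rfl | ⟨x, -⟩
  · simp
  have : s.image f = (s.image g).image (Function.extend g f fun _ => f x) := by
    rw [Finset.image_image]
    refine Finset.image_congr fun a _ => ?_
    exact (Function.FactorsThrough.extend_apply (fun a b hab => h a b hab) _ a).symm
  rw [this]
  exact Finset.card_image_le

theorem card_parts_eq {P : Finpartition (Finset.univ : Finset (Fin n))} {f : ℕ → ℕ}
    (h : ∀ a b : Fin n, P.part a = P.part b ↔ f a = f b) :
    P.parts.card = ((Finset.range n).image f).card := by
  have : (Finset.range n).image f =
      (Finset.univ : Finset (Fin n)).image (fun v : Fin n => f v) := by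
    ext c
    simp only [Finset.mem_image, Finset.mem_range, Finset.mem_univ, true_and]
    exact ⟨fun ⟨a, ha, hc⟩ => ⟨⟨a, ha⟩, hc⟩, fun ⟨a, hc⟩ => ⟨a, a.2, hc⟩⟩
  rw [this, parts_eq_image]
  exact le_antisymm (card_image_le_of_factors fun a b => (h a b).2)
    (card_image_le_of_factors fun a b => (h a b).1)

/-! ### Paths and solutions -/

variable (G)

/-- The partition that path number `r` encodes. -/
noncomputable def solution (r : ℕ) : Finpartition (Finset.univ : Finset (Fin n)) :=
  partOf n ((Inst.ofGraph G l).labeling ((Inst.ofGraph G l).layered.path r))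

/-- The number of solutions. -/
noncomputable def numSolutions : ℕ :=
  (Inst.ofGraph G l).layered.cnt (Inst.ofGraph G l).layered.m 0

variable {G l}

theorem isSolution_solution {r : ℕ} (hr : r < numSolutions G l) :
    IsSolution G l (solution G l r) := by
  classical
  have hI := Inst.good_ofGraph (G := G) l
  have hp := Layered.accepted_path hr
  refine ⟨(isMatchingMulticut_iff l (part_partOf_eq_iff _)).2 (hI.isMM_labeling hp.1), ?_⟩
  rw [solution, card_parts_eq (part_partOf_eq_iff _)]
  exact le_of_le_of_eq hp.2 (hI.card_labels hp.1).symm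

theorem solution_injective {r r' : ℕ} (hr : r < numSolutions G l) (hr' : r' < numSolutions G l)
    (h : solution G l r = solution G l r') : r = r' := by
  refine Layered.path_injective hr hr' ?_
  refine (Inst.good_ofGraph l).path_unique le_rfl (Layered.accepted_path hr).1
    (Layered.accepted_path hr').1 fun a b ha hb => ?_
  rw [← part_partOf_eq_iff (n := n) _ ⟨a, ha⟩ ⟨b, hb⟩,
    ← part_partOf_eq_iff (n := n) _ ⟨a, ha⟩ ⟨b, hb⟩]
  change (solution G l r).part _ = (solution G l r).part _ ↔
    (solution G l r').part _ = (solution G l r').part _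
  rw [h]

theorem exists_solution_eq {P : Finpartition (Finset.univ : Finset (Fin n))}
    (hP : IsSolution G l P) : ∃ r < numSolutions G l, solution G l r = P := by
  classical
  have hI := Inst.good_ofGraph (G := G) l
  obtain ⟨g, hg⟩ := exists_label P
  obtain ⟨p, hp, hpg⟩ := hI.exists_path ((isMatchingMulticut_iff l hg).1 hP.1) le_rfl
  have hk : ∀ a b : Fin n, P.part a = P.part b ↔
      (Inst.ofGraph G l).labeling p a = (Inst.ofGraph G l).labeling p b := fun a b => by
    rw [hg, hpg a b (hI.proc_n.2 a.2) (hI.proc_n.2 b.2)]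
  have hfin : (Inst.ofGraph G l).layered.fin (p (n + 1)) := by
    have h := hP.2
    rw [card_parts_eq hk] at h
    exact le_of_le_of_eq h (hI.card_labels hp)
  obtain ⟨r, hr, he⟩ := Layered.exists_path_eq (Λ := (Inst.ofGraph G l).layered) ⟨hp, hfin⟩
  refine ⟨r, hr, finpartition_ext fun a b => ?_⟩
  rw [hk, solution, part_partOf_eq_iff,
    Inst.labeling_congr (i := n) he (hI.proc_n.2 a.2),
    Inst.labeling_congr (i := n) he (hI.proc_n.2 b.2)]

namespace Ex

/-! ### Rules for proving that an expression represents a proposition -/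

section

variable {γ μ : ℕ → ℕ} {a b c e : Ex} {ρ : List ℕ} {L x y m : ℕ} {P Q : Prop} {p : ℕ → Prop}

theorem eval_var (i : ℕ) : eval γ μ (var i) ρ = ρ.getD i 0 := rfl
theorem eval_glob (g : Fin 24) : eval γ μ (glob g) ρ = γ g := rfl
theorem eval_const (k : ℕ) : eval γ μ (const k) ρ = k := rfl
theorem eval_add : eval γ μ (add a b) ρ = a.eval γ μ ρ + b.eval γ μ ρ := rfl
theorem eval_sub : eval γ μ (sub a b) ρ = a.eval γ μ ρ - b.eval γ μ ρ := rfl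
theorem eval_load : eval γ μ (load a) ρ = μ (a.eval γ μ ρ) := rfl
theorem holds_load : holds γ μ (load a) ρ ↔ μ (a.eval γ μ ρ) ≠ 0 := Iff.rfl

theorem nt_iff (h : a.holds γ μ ρ ↔ P) : (nt a).holds γ μ ρ ↔ ¬ P := holds_nt.trans (not_congr h)

/-- The second operand is analyzed under the assumption of the first; this is how the tests in an
expression supply the bounds that later subexpressions require. -/
theorem and_iff (h : a.holds γ μ ρ ↔ P) (h' : P → (b.holds γ μ ρ ↔ Q)) :
    (and a b).holds γ μ ρ ↔ P ∧ Q := by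
  rw [holds_and, h]; exact and_congr_right h'

theorem or_iff (h : a.holds γ μ ρ ↔ P) (h' : b.holds γ μ ρ ↔ Q) :
    (or a b).holds γ μ ρ ↔ P ∨ Q := by
  rw [holds_or, h, h']

theorem imp_iff (h : a.holds γ μ ρ ↔ P) (h' : P → (b.holds γ μ ρ ↔ Q)) :
    (imp a b).holds γ μ ρ ↔ (P → Q) := by
  rw [holds_imp, h]; exact imp_congr_right h'

theorem iff_iff (h : a.holds γ μ ρ ↔ P) (h' : b.holds γ μ ρ ↔ Q) :
    (iff a b).holds γ μ ρ ↔ (P ↔ Q) := by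
  rw [holds_iff, h, h']

theorem eq_iff (h : a.eval γ μ ρ = x) (h' : b.eval γ μ ρ = y) :
    (eq a b).holds γ μ ρ ↔ x = y := by rw [holds_eq, h, h']

theorem lt_iff (h : a.eval γ μ ρ = x) (h' : b.eval γ μ ρ = y) :
    (lt a b).holds γ μ ρ ↔ x < y := by rw [holds_lt, h, h']

theorem le_iff (h : a.eval γ μ ρ = x) (h' : b.eval γ μ ρ = y) :
    (le a b).holds γ μ ρ ↔ x ≤ y := by rw [holds_le, h, h']

/-- Bounded operators see only indices below `γ 2`, so the bound `m` of the quantifier must not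
exceed the range. -/
theorem all_iff (hL : ρ.length = L) (hb : ∀ j, b.eval γ μ (ρ ++ [j]) = m) (hm : m ≤ γ 2)
    (h : ∀ j < m, (e.holds γ μ (ρ ++ [j]) ↔ p j)) :
    (all L b e).holds γ μ ρ ↔ ∀ j < m, p j := by
  rw [holds_all hL]
  simp only [hb]
  rw [forall_lt_lt hm]
  exact forall₂_congr h

theorem ex_iff (hL : ρ.length = L) (hb : ∀ j, b.eval γ μ (ρ ++ [j]) = m) (hm : m ≤ γ 2)
    (h : ∀ j < m, (e.holds γ μ (ρ ++ [j]) ↔ p j)) :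
    (ex L b e).holds γ μ ρ ↔ ∃ j < m, p j := by
  rw [holds_ex hL]
  simp only [hb]
  rw [exists_lt_and_lt hm]
  exact exists_congr fun j => and_congr_right (h j)

theorem sumIf_eq [DecidablePred p] (hL : ρ.length = L) (hb : ∀ j, b.eval γ μ (ρ ++ [j]) = m)
    (hm : m ≤ γ 2) (h : ∀ j < m, (c.holds γ μ (ρ ++ [j]) ↔ p j)) {f : ℕ → ℕ}
    (hf : ∀ j < m, p j → e.eval γ μ (ρ ++ [j]) = f j) :
    eval γ μ (sumIf L b c e) ρ = ∑ j ∈ Finset.range m with p j, f j := by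
  classical
  rw [eval_sumIf hL]
  simp only [hb]
  rw [filter_range_lt hm]
  have : ({j ∈ Finset.range m | c.holds γ μ (ρ ++ [j])} : Finset ℕ) =
      {j ∈ Finset.range m | p j} := Finset.filter_congr fun j hj => h j (Finset.mem_range.1 hj)
  rw [this]
  refine Finset.sum_congr rfl fun j hj => ?_
  obtain ⟨h1, h2⟩ := Finset.mem_filter.1 hj
  exact hf j (Finset.mem_range.1 h1) h2

end

attribute [simp] eval_var eval_glob eval_const eval_add eval_sub eval_load eval_call1 eval_call2
  eval_call3 holds_call1 holds_call2 holds_call3 holds_load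

/-! ### The graph and the set `U` -/

def adjF : Ex :=
  and (lt (var 0) (glob 0)) (and (lt (var 1) (glob 0))
    (load (add (call2 mulF (var 0) (glob 0)) (var 1))))

def vertexF (p : Ex) (j : Ex) : Ex := call3 digF (glob 0) p j

def isP3F : Ex :=
  and (call2 adjF (vertexF (var 0) (const 0)) (vertexF (var 0) (const 1)))
    (and (call2 adjF (vertexF (var 0) (const 1)) (vertexF (var 0) (const 2)))
      (and (nt (eq (vertexF (var 0) (const 0)) (vertexF (var 0) (const 2))))
        (nt (call2 adjF (vertexF (var 0) (const 0)) (vertexF (var 0) (const 2))))))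

/-- Whether triple number `glob 9` is selected, given the table of the earlier ones. -/
def selectedF : Ex :=
  and (call1 isP3F (glob 9)) (all 0 (glob 9) (imp (load (add (glob 3) (var 0)))
    (all 1 (const 3) (all 2 (const 3)
      (nt (eq (vertexF (glob 9) (var 1)) (vertexF (var 0) (var 2))))))))

def inUF : Ex :=
  ex 1 (glob 4) (and (load (add (glob 3) (var 1)))
    (ex 2 (const 3) (eq (vertexF (var 1) (var 2)) (var 0))))

def idxF : Ex := sumIf 1 (var 0) (call1 inUF (var 1)) (const 1)

def isRepF : Ex :=
  and (nt (call1 inUF (var 0)))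
    (all 1 (var 0) (or (call1 inUF (var 1)) (nt (call2 adjF (var 0) (var 1)))))

def repF : Ex :=
  sumIf 1 (glob 0) (and (call1 isRepF (var 1))
    (or (eq (var 1) (var 0)) (call2 adjF (var 0) (var 1))))
    (var 1)

def inRF : Ex :=
  or (call1 inUF (var 1)) (or (eq (var 1) (var 0)) (call2 adjF (var 0) (var 1)))

/-- The graph is in the memory. -/
structure GraphEnv (I : Inst) (γ μ : ℕ → ℕ) : Prop where
  good : I.Good
  hU : I.U = Hit I.adj I.n
  n : γ 0 = I.n
  base : γ 3 = I.n ^ 2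
  cube : γ 4 = I.n ^ 3
  cube_lt : I.n ^ 3 < γ 2
  n_lt : I.n < γ 2
  three : 3 ≤ γ 2
  adj : ∀ i < I.n, ∀ j < I.n, μ (i * I.n + j) ≠ 0 ↔ I.adj i j

/-- The graph and the table of selected triples are in the memory. -/
structure SelEnv (I : Inst) (γ μ : ℕ → ℕ) : Prop extends GraphEnv I γ μ where
  sel : ∀ p < I.n ^ 3, μ (I.n ^ 2 + p) ≠ 0 ↔ Selected I.adj I.n p

section

variable {I : Inst} {γ μ : ℕ → ℕ}

theorem GraphEnv.holds_adjF (E : GraphEnv I γ μ) (i j : ℕ) :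
    holds γ μ adjF [i, j] ↔ I.adj i j := by
  have hn := E.n_lt
  have : holds γ μ adjF [i, j] ↔ i < I.n ∧ j < I.n ∧ I.adj i j :=
    and_iff (lt_iff rfl E.n) fun hi => and_iff (lt_iff rfl E.n) fun hj => by
      simp [E.n, eval_mulF hn.le, ← E.adj i hi j hj]
  rw [this]
  exact ⟨fun h => h.2.2, fun h => ⟨E.good.lt (E.good.symm h), E.good.lt h, h⟩⟩

theorem GraphEnv.eval_vertexF (E : GraphEnv I γ μ) {p j : Ex} {ρ : List ℕ} {x i : ℕ}
    (hp : p.eval γ μ ρ = x) (hj : j.eval γ μ ρ = i) (hx : x < γ 2) (hi : i ≤ γ 2) :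
    eval γ μ (vertexF p j) ρ = dig I.n x i := by
  have hn := E.n_lt
  simp only [vertexF, eval_call3, eval_glob, hp, hj]
  rw [show γ ((0 : Fin 24) : ℕ) = I.n from E.n, eval_digF hn.le hi hx]

theorem GraphEnv.holds_isP3F (E : GraphEnv I γ μ) {p : ℕ} (hp : p < γ 2) :
    holds γ μ isP3F [p] ↔ IsP3 I.adj I.n p := by
  have h3 := E.three
  have hv : ∀ j < 3, eval γ μ (vertexF (var 0) (const j)) [p] = dig I.n p j := fun j hj =>
    E.eval_vertexF rfl rfl hp (by omega)
  have h0 := hv 0 (by omega)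
  have h1 := hv 1 (by omega)
  have h2 := hv 2 (by omega)
  refine and_iff ?_ fun _ => and_iff ?_ fun _ => and_iff (nt_iff (eq_iff h0 h2)) fun _ => nt_iff ?_
  all_goals simp only [holds_call2, h0, h1, h2, E.holds_adjF]

theorem GraphEnv.holds_selectedF (E : GraphEnv I γ μ) {p : ℕ} (hp : p < I.n ^ 3) (h9 : γ 9 = p)
    (hsel : ∀ p' < p, μ (I.n ^ 2 + p') ≠ 0 ↔ Selected I.adj I.n p') :
    holds γ μ selectedF [] ↔ Selected I.adj I.n p := by
  have h3 := E.three
  have hN := E.cube_lt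
  rw [Selected]
  refine and_iff ?_ fun _ => all_iff rfl (fun _ => h9) (by omega) fun p' hp' => imp_iff ?_ fun _ =>
    all_iff rfl (fun _ => rfl) h3 fun i hi => all_iff rfl (fun _ => rfl) h3 fun j hj =>
      nt_iff (eq_iff ?_ ?_)
  · rw [holds_call1, eval_glob, show γ ((9 : Fin 24) : ℕ) = p from h9,
      E.holds_isP3F (by omega)]
  · rw [← hsel p' hp']
    simp [E.base]
  · exact E.eval_vertexF h9 rfl (by omega) (by omega)
  · exact E.eval_vertexF rfl rfl (by omega) (by omega)

variable (E : SelEnv I γ μ)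
include E

theorem SelEnv.holds_inUF (v : ℕ) : holds γ μ inUF [v] ↔ I.U v := by
  have h3 := E.three
  have hN := E.cube_lt
  rw [E.hU]
  refine ex_iff rfl (fun _ => E.cube) hN.le fun p hp => and_iff ?_ fun _ =>
    ex_iff rfl (fun _ => rfl) h3 fun i hi => eq_iff ?_ rfl
  · rw [← E.sel p hp]
    simp [E.base]
  · exact E.eval_vertexF rfl rfl (by omega) (by omega)

theorem SelEnv.eval_idxF {u : ℕ} (hu : u ≤ I.n) : eval γ μ idxF [u] = I.idx u := by
  classical
  have hn := E.n_lt
  rw [Inst.idx, Finset.card_eq_sum_ones]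
  exact sumIf_eq rfl (fun _ => rfl) (by omega) (fun j _ => by simp [E.holds_inUF])
    fun _ _ _ => rfl

theorem SelEnv.holds_isRepF {v : ℕ} (hv : v ≤ I.n) : holds γ μ isRepF [v] ↔ I.isRep v := by
  have hn := E.n_lt
  refine and_iff (nt_iff (by simp [E.holds_inUF])) fun _ => all_iff rfl (fun _ => rfl)
    (by omega) fun w hw => or_iff ?_ (nt_iff ?_)
  · simp [E.holds_inUF]
  · simp [E.holds_adjF]

theorem SelEnv.eval_repF (w : ℕ) : eval γ μ repF [w] = I.rep w := by
  classical
  have hn := E.n_lt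
  rw [Inst.rep, repF]
  refine sumIf_eq (ρ := [w]) (b := glob 0) (m := I.n) (f := fun v => v) rfl
    (fun _ => E.n) hn.le (fun v hv => and_iff ?_ fun _ => or_iff
    (eq_iff rfl rfl) ?_) fun _ _ _ => rfl
  · simp [E.holds_isRepF hv.le]
  · simp [E.holds_adjF]

theorem SelEnv.holds_inRF (v w : ℕ) : holds γ μ inRF [v, w] ↔ I.inR v w := by
  refine or_iff ?_ (or_iff (eq_iff rfl rfl) ?_)
  · simp [E.holds_inUF]
  · simp [E.holds_adjF]

end

end Ex
namespace Ex

/-! ### Nodes -/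

def fieldF (c : ℕ) : Ex := call3 digF (glob 6) (var 0) (const c)

def labUF : Ex := call3 digF (glob 5) (call1 (fieldF 0) (var 0)) (var 1)

def bitF : Ex := eq (call3 digF (const 2) (call1 (fieldF 1) (var 0)) (var 1)) (const 1)

def labF : Ex :=
  ite (call1 inUF (var 2)) (call2 labUF (var 1) (call1 idxF (var 2)))
    (ite (eq (var 2) (var 0)) (call1 (fieldF 3) (var 1)) (call1 (fieldF 4) (var 1)))

def neF (v d a b : Ex) : Ex := nt (eq (call3 labF v d a) (call3 labF v d b))

def mmF : Ex :=
  all 2 (glob 0) (imp (call2 inRF (var 0) (var 2))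
    (all 3 (glob 0) (imp (call2 inRF (var 0) (var 3)) (imp (call2 adjF (var 2) (var 3))
      (imp (neF (var 0) (var 1) (var 3) (var 2))
        (all 4 (glob 0) (imp (call2 inRF (var 0) (var 4)) (imp (call2 adjF (var 2) (var 4))
          (imp (neF (var 0) (var 1) (var 4) (var 2)) (eq (var 3) (var 4)))))))))))

def crossF : Ex :=
  ex 3 (glob 0) (and (nt (call1 inUF (var 3))) (and (call2 inRF (var 0) (var 3))
    (and (call2 adjF (var 2) (var 3)) (neF (var 0) (var 1) (var 3) (var 2)))))

def crossUF : Ex :=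
  ex 3 (glob 0) (and (call1 inUF (var 3)) (and (call2 adjF (var 2) (var 3))
    (neF (var 0) (var 1) (var 3) (var 2))))

def initF : Ex :=
  and (and (lt (call1 (fieldF 0) (var 0)) (call2 powF (glob 5) (glob 5)))
    (and (lt (call1 (fieldF 1) (var 0)) (call2 powF (const 2) (glob 5)))
      (and (eq (call1 (fieldF 2) (var 0)) (const 0)) (and (eq (call1 (fieldF 3) (var 0)) (const 0))
        (eq (call1 (fieldF 4) (var 0)) (const 0))))))
  (and (all 1 (glob 5) (and (le (call2 labUF (var 0) (var 1)) (var 1))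
      (eq (call2 labUF (var 0) (call2 labUF (var 0) (var 1))) (call2 labUF (var 0) (var 1)))))
    (and (call2 mmF (glob 0) (var 0))
      (all 1 (glob 0) (imp (call1 inUF (var 1)) (iff (call2 bitF (var 0) (call1 idxF (var 1)))
        (call3 crossUF (glob 0) (var 0) (var 1)))))))

def okLabelF : Ex :=
  and (imp (lt (var 2) (glob 5)) (eq (call2 labUF (var 0) (var 2)) (var 2)))
    (le (var 2) (add (glob 5) (var 1)))

def updF : Ex := ite (eq (var 1) (add (glob 5) (var 0))) (add (var 0) (const 1)) (var 0)

def stepRepF : Ex :=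
  and (lt (call1 (fieldF 1) (var 2)) (call2 powF (const 2) (glob 5)))
    (and (call3 okLabelF (var 2) (call1 (fieldF 2) (var 1)) (call1 (fieldF 3) (var 2)))
      (and (call3 okLabelF (var 2)
          (call2 updF (call1 (fieldF 2) (var 1)) (call1 (fieldF 3) (var 2)))
          (call1 (fieldF 4) (var 2)))
        (and (eq (call1 (fieldF 2) (var 2))
            (call2 updF (call2 updF (call1 (fieldF 2) (var 1)) (call1 (fieldF 3) (var 2)))
              (call1 (fieldF 4) (var 2))))
          (and (imp (all 3 (glob 0) (imp (call2 adjF (var 0) (var 3)) (call1 inUF (var 3))))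
              (eq (call1 (fieldF 4) (var 2)) (call1 (fieldF 3) (var 2))))
            (and (call2 mmF (var 0) (var 2))
              (all 3 (glob 0) (imp (call1 inUF (var 3))
                (and (imp (call3 crossF (var 0) (var 2) (var 3))
                    (nt (call2 bitF (var 1) (call1 idxF (var 3)))))
                  (iff (call2 bitF (var 2) (call1 idxF (var 3)))
                    (or (call2 bitF (var 1) (call1 idxF (var 3)))
                      (call3 crossF (var 0) (var 2) (var 3))))))))))))

def stepF : Ex :=
  and (eq (call1 (fieldF 0) (var 2)) (call1 (fieldF 0) (var 1)))
    (and (imp (call1 isRepF (var 0)) (call3 stepRepF (var 0) (var 1) (var 2)))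
      (imp (nt (call1 isRepF (var 0)))
        (and (eq (call1 (fieldF 1) (var 2)) (call1 (fieldF 1) (var 1)))
          (and (eq (call1 (fieldF 2) (var 2)) (call1 (fieldF 2) (var 1)))
            (and (eq (call1 (fieldF 3) (var 2)) (const 0))
              (eq (call1 (fieldF 4) (var 2)) (const 0)))))))

def relF : Ex :=
  and (imp (eq (var 0) (const 0)) (call1 initF (var 2)))
    (imp (nt (eq (var 0) (const 0))) (call3 stepF (sub (var 0) (const 1)) (var 1) (var 2)))

def finF : Ex :=
  le (glob 1) (add (call1 (fieldF 2) (var 0))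
    (sumIf 1 (glob 5) (eq (call2 labUF (var 0) (var 1)) (var 1)) (const 1)))

/-- The graph, the table of selected triples and the parameters are in the memory. -/
structure NodeEnv (I : Inst) (γ μ : ℕ → ℕ) : Prop extends SelEnv I γ μ where
  l : γ 1 = I.l
  k : γ 5 = I.k
  B : γ 6 = I.B
  N : γ 2 = I.B ^ 5

namespace NodeEnv

variable {I : Inst} {γ μ : ℕ → ℕ} (E : NodeEnv I γ μ)
include E

theorem B_le : I.B ≤ γ 2 := by
  rw [E.N]; exact Nat.le_self_pow (by omega) _

theorem k_le : I.k ≤ γ 2 := Inst.k_le.trans E.n_lt.le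

theorem field_lt (d c : ℕ) : dig I.B d c < γ 2 :=
  (dig_lt (by have := Inst.pow_lt_B (I := I); omega) _ _).trans_le E.B_le

theorem eval_fieldF {d : ℕ} (hd : d < γ 2) {c : ℕ} (hc : c < 5) :
    eval γ μ (fieldF c) [d] = dig I.B d c := by
  have := Inst.pow_lt_B (I := I)
  have := E.B_le
  simp only [fieldF, eval_call3, eval_glob, eval_var, eval_const]
  rw [show γ ((6 : Fin 24) : ℕ) = I.B from E.B]
  exact eval_digF E.B_le (by omega) hd

theorem eval_field0 {d : ℕ} (hd : d < γ 2) : eval γ μ (fieldF 0) [d] = I.labels d :=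
  E.eval_fieldF hd (by omega)

theorem eval_field1 {d : ℕ} (hd : d < γ 2) : eval γ μ (fieldF 1) [d] = I.mask d :=
  E.eval_fieldF hd (by omega)

theorem eval_field2 {d : ℕ} (hd : d < γ 2) : eval γ μ (fieldF 2) [d] = I.free d :=
  E.eval_fieldF hd (by omega)

theorem eval_field3 {d : ℕ} (hd : d < γ 2) : eval γ μ (fieldF 3) [d] = I.fst d :=
  E.eval_fieldF hd (by omega)

theorem eval_field4 {d : ℕ} (hd : d < γ 2) : eval γ μ (fieldF 4) [d] = I.snd d :=
  E.eval_fieldF hd (by omega)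

theorem eval_labUF {d j : ℕ} (hd : d < γ 2) (hj : j < γ 2) :
    eval γ μ labUF [d, j] = I.labU d j := by
  simp only [labUF, eval_call3, eval_glob, eval_var, eval_call1, List.getD_cons_zero,
    List.getD_cons_succ]
  rw [E.eval_field0 hd, show γ ((5 : Fin 24) : ℕ) = I.k from E.k]
  exact eval_digF E.k_le hj.le (E.field_lt _ _)

theorem holds_bitF {d j : ℕ} (hd : d < γ 2) (hj : j < γ 2) :
    holds γ μ bitF [d, j] ↔ I.bit d j := by
  refine eq_iff ?_ rfl
  simp only [eval_call3, eval_const, eval_var, eval_call1, List.getD_cons_zero,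
    List.getD_cons_succ]
  rw [E.eval_field1 hd]
  exact eval_digF (by have := E.three; omega) hj.le (E.field_lt _ _)

theorem idx_lt {u : ℕ} (hu : u ≤ I.n) : I.idx u < γ 2 :=
  (Inst.idx_le u).trans_lt (hu.trans_lt E.n_lt)

theorem eval_labF {v d w : ℕ} (hd : d < γ 2) (hw : w ≤ I.n) :
    eval γ μ labF [v, d, w] = I.lab v d w := by
  classical
  rw [labF, eval_ite, eval_ite, Inst.lab]
  have h1 : holds γ μ (call1 inUF (var 2)) [v, d, w] ↔ I.U w := by simp [E.holds_inUF]
  have h2 : holds γ μ (eq (var 2) (var 0)) [v, d, w] ↔ w = v := eq_iff rfl rfl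
  rw [if_congr h1 rfl (if_congr h2 rfl rfl)]
  simp [E.eval_idxF hw, E.eval_labUF hd (E.idx_lt hw), E.eval_field3 hd, E.eval_field4 hd]

theorem holds_neF {v d a b : Ex} {ρ : List ℕ} {v' d' a' b' : ℕ} (h1 : v.eval γ μ ρ = v')
    (h2 : d.eval γ μ ρ = d') (h3 : a.eval γ μ ρ = a') (h4 : b.eval γ μ ρ = b') (hd : d' < γ 2)
    (ha : a' ≤ I.n) (hb : b' ≤ I.n) :
    holds γ μ (neF v d a b) ρ ↔ I.lab v' d' a' ≠ I.lab v' d' b' := by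
  refine nt_iff (eq_iff ?_ ?_)
  · rw [eval_call3, h1, h2, h3, E.eval_labF hd ha]
  · rw [eval_call3, h1, h2, h4, E.eval_labF hd hb]

theorem holds_mmF {v d : ℕ} (hd : d < γ 2) :
    holds γ μ mmF [v, d] ↔ I.mm v (I.lab v d) := by
  have hn := E.n_lt.le
  refine all_iff rfl (fun _ => E.n) hn fun y hy => imp_iff ?_ fun _ =>
    all_iff rfl (fun _ => E.n) hn fun a ha => imp_iff ?_ fun _ => imp_iff ?_ fun _ =>
      imp_iff (E.holds_neF rfl rfl rfl rfl hd ha.le hy.le) fun _ =>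
        all_iff rfl (fun _ => E.n) hn fun b hb => imp_iff ?_ fun _ => imp_iff ?_ fun _ =>
          imp_iff (E.holds_neF rfl rfl rfl rfl hd hb.le hy.le) fun _ => eq_iff rfl rfl
  all_goals simp [E.holds_inRF, E.holds_adjF]

theorem holds_crossF {v d u : ℕ} (hd : d < γ 2) (hu : u ≤ I.n) :
    holds γ μ crossF [v, d, u] ↔ I.cross v (I.lab v d) u := by
  have hn := E.n_lt.le
  refine ex_iff rfl (fun _ => E.n) hn fun w hw => and_iff (nt_iff ?_) fun _ => and_iff ?_ fun _ =>
    and_iff ?_ fun _ => E.holds_neF rfl rfl rfl rfl hd hw.le hu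
  all_goals simp [E.holds_inRF, E.holds_adjF, E.holds_inUF]

theorem holds_crossUF {v d u : ℕ} (hd : d < γ 2) (hu : u ≤ I.n) :
    holds γ μ crossUF [v, d, u] ↔ I.crossU (I.lab v d) u := by
  have hn := E.n_lt.le
  refine ex_iff rfl (fun _ => E.n) hn fun w hw => and_iff ?_ fun _ =>
    and_iff ?_ fun _ => E.holds_neF rfl rfl rfl rfl hd hw.le hu
  all_goals simp [E.holds_adjF, E.holds_inUF]

theorem eval_powF2 {ρ : List ℕ} : eval γ μ (call2 powF (const 2) (glob 5)) ρ = 2 ^ I.k := by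
  have := E.three
  rw [eval_call2, eval_const, eval_glob, show γ ((5 : Fin 24) : ℕ) = I.k from E.k,
    eval_powF (by omega) E.k_le]

theorem holds_initF {d : ℕ} (hd : d < γ 2) : holds γ μ initF [d] ↔ I.init d := by
  have hn := E.n_lt.le
  have hk := E.k_le
  refine and_iff (and_iff (lt_iff ?_ ?_) fun _ => and_iff (lt_iff ?_ E.eval_powF2) fun _ =>
    and_iff (eq_iff ?_ rfl) fun _ => and_iff (eq_iff ?_ rfl) fun _ => eq_iff ?_ rfl) fun _ =>
    and_iff (all_iff rfl (fun _ => E.k) hk fun j hj => and_iff (le_iff ?_ rfl) fun _ =>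
      eq_iff ?_ ?_) fun _ => and_iff ?_ fun _ => all_iff rfl (fun _ => E.n) hn fun u hu =>
        imp_iff ?_ fun hU => iff_iff ?_ ?_
  · simp [E.eval_field0 hd]
  · rw [eval_call2, eval_glob, show γ ((5 : Fin 24) : ℕ) = I.k from E.k, eval_powF hk hk]
  · simp [E.eval_field1 hd]
  · simp [E.eval_field2 hd]
  · simp [E.eval_field3 hd]
  · simp [E.eval_field4 hd]
  · simp [E.eval_labUF hd (hj.trans_le hk)]
  · have h1 := E.eval_labUF hd (hj.trans_le hk)
    have h2 : I.labU d j < γ 2 :=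
      (dig_lt ((Nat.zero_le _).trans_lt hj) _ _).trans_le hk
    simp [h1, E.eval_labUF hd h2]
  · simp [E.eval_labUF hd (hj.trans_le hk)]
  · simp only [holds_call2, eval_glob, eval_var, List.getD_cons_zero]
    rw [show γ ((0 : Fin 24) : ℕ) = I.n from E.n]
    exact E.holds_mmF hd
  · simp [E.holds_inUF]
  · simp [E.eval_idxF hu.le, E.holds_bitF hd (E.idx_lt hu.le)]
  · simp only [holds_call3, eval_glob, eval_var]
    rw [show γ ((0 : Fin 24) : ℕ) = I.n from E.n]
    exact E.holds_crossUF hd hu.le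

theorem holds_okLabelF {d q c : ℕ} (hd : d < γ 2) :
    holds γ μ okLabelF [d, q, c] ↔ I.okLabel d q c := by
  refine and_iff (imp_iff (lt_iff rfl E.k) fun hc => eq_iff ?_ rfl) fun _ => le_iff rfl ?_
  · simp [E.eval_labUF hd (hc.trans_le E.k_le)]
  · simp [E.k]

theorem eval_updF {q c : ℕ} : eval γ μ updF [q, c] = I.upd q c := by
  rw [updF, eval_ite, Inst.upd]
  have : holds γ μ (eq (var 1) (add (glob 5) (var 0))) [q, c] ↔ c = I.k + q :=
    eq_iff rfl (by simp [E.k])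
  simp [this]

theorem holds_stepRepF {i d d' : ℕ} (hd : d < γ 2) (hd' : d' < γ 2) :
    holds γ μ stepRepF [i, d, d'] ↔ I.stepRep i d d' := by
  have hn := E.n_lt.le
  refine and_iff (lt_iff ?_ E.eval_powF2) fun _ => and_iff ?_ fun _ => and_iff ?_ fun _ =>
    and_iff (eq_iff ?_ ?_) fun _ => and_iff (imp_iff (all_iff rfl (fun _ => E.n) hn
      fun w hw => imp_iff ?_ fun _ => ?_) fun _ => eq_iff ?_ ?_) fun _ => and_iff ?_ fun _ =>
      all_iff rfl (fun _ => E.n) hn fun u hu => imp_iff ?_ fun hU => and_iff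
        (imp_iff ?_ fun _ => nt_iff ?_) fun _ => iff_iff ?_ (or_iff ?_ ?_)
  · simp [E.eval_field1 hd']
  · simp [E.eval_field2 hd, E.eval_field3 hd', E.holds_okLabelF hd']
  · simp [E.eval_field2 hd, E.eval_field3 hd', E.eval_field4 hd', E.eval_updF, E.holds_okLabelF hd']
  · simp [E.eval_field2 hd']
  · simp [E.eval_field2 hd, E.eval_field3 hd', E.eval_field4 hd', E.eval_updF]
  · simp [E.holds_adjF]
  · simp [E.holds_inUF]
  · simp [E.eval_field4 hd']
  · simp [E.eval_field3 hd']
  · simp [E.holds_mmF hd']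
  · simp [E.holds_inUF]
  · simp [E.holds_crossF hd' hu.le]
  · simp [E.eval_idxF hu.le, E.holds_bitF hd (E.idx_lt hu.le)]
  · simp [E.eval_idxF hu.le, E.holds_bitF hd' (E.idx_lt hu.le)]
  · simp [E.eval_idxF hu.le, E.holds_bitF hd (E.idx_lt hu.le)]
  · simp [E.holds_crossF hd' hu.le]

theorem holds_stepF {i d d' : ℕ} (hi : i ≤ I.n) (hd : d < γ 2) (hd' : d' < γ 2) :
    holds γ μ stepF [i, d, d'] ↔ I.step i d d' := by
  refine and_iff (eq_iff ?_ ?_) fun _ => and_iff (imp_iff ?_ fun _ => ?_) fun _ =>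
    imp_iff (nt_iff ?_) fun _ => and_iff (eq_iff ?_ ?_) fun _ => and_iff (eq_iff ?_ ?_) fun _ =>
      and_iff (eq_iff ?_ rfl) fun _ => eq_iff ?_ rfl
  · simp [E.eval_field0 hd']
  · simp [E.eval_field0 hd]
  · simp [E.holds_isRepF hi]
  · simp [E.holds_stepRepF hd hd']
  · simp [E.holds_isRepF hi]
  · simp [E.eval_field1 hd']
  · simp [E.eval_field1 hd]
  · simp [E.eval_field2 hd']
  · simp [E.eval_field2 hd]
  · simp [E.eval_field3 hd']
  · simp [E.eval_field4 hd']

theorem holds_relF {a d d' : ℕ} (ha : a ≤ I.n + 1) (hd : d < γ 2) (hd' : d' < γ 2) :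
    holds γ μ relF [a, d, d'] ↔ I.layered.R a d d' := by
  refine and_iff (imp_iff (eq_iff rfl rfl) fun _ => ?_) fun _ => imp_iff (nt_iff (eq_iff rfl rfl))
    fun _ => ?_
  · simp [E.holds_initF hd']
  · simp [E.holds_stepF (show a - 1 ≤ I.n by omega) hd hd']

theorem holds_finF {d : ℕ} (hd : d < γ 2) : holds γ μ finF [d] ↔ I.layered.fin d := by
  have hk := E.k_le
  refine le_iff E.l ?_
  rw [eval_add, Finset.card_eq_sum_ones]
  congr 1
  · simp [E.eval_field2 hd]
  · exact sumIf_eq (ρ := [d]) (b := glob 5) (m := I.k) (f := fun _ => 1) rfl (fun _ => E.k) hk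
      (fun j hj => eq_iff (by simp [E.eval_labUF hd (hj.trans_le hk)]) rfl) fun _ _ _ => rfl

end NodeEnv

end Ex

theorem Inst.layered_m (I : Inst) : I.layered.m = I.n + 1 := rfl

namespace Ex

/-! ### Paths -/

/-- Row `b` of the table belongs to `b` remaining steps, that is, to layer `n + 1 - b`. If `glob 9`
is `b * N + d` and `var 1` is `d`, subtracting `d` and `N` gives the start of row `b - 1`. -/
def rowF : Ex :=
  sumIf 2 (glob 2) (call3 relF (sub (add (glob 0) (const 1)) (var 0)) (var 1) (var 2))
    (load (add (glob 7) (add (sub (sub (glob 9) (var 1)) (glob 2)) (var 2))))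

/-- Entry `glob 9` of the table of the numbers of paths, given the earlier entries. -/
def cntF : Ex :=
  ite (lt (glob 9) (glob 2)) (ite (call1 finF (glob 9)) (const 1) (const 0))
    (call2 rowF (call2 divF (glob 9) (glob 2)) (call2 modF (glob 9) (glob 2)))

/-- The weight of a step from layer `a` is found in row `n - a`, as `n - a` steps remain after it.
-/
def preF : Ex :=
  sumIf 3 (var 2) (call3 relF (var 0) (var 1) (var 3))
    (load (add (glob 7) (add (call2 mulF (glob 2) (sub (glob 0) (var 0))) (var 3))))

def selF : Ex :=
  sumIf 3 (glob 2) (le (call3 preF (var 0) (var 1) (add (var 3) (const 1))) (var 2)) (const 1)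

def labelF : Ex :=
  call3 labF (call1 repF (var 0))
    (load (add (glob 8) (ite (call1 inUF (var 0)) (const 1)
      (add (call1 repF (var 0)) (const 2))))) (var 0)

namespace NodeEnv

variable {I : Inst} {γ μ : ℕ → ℕ} (E : NodeEnv I γ μ)
include E

theorem N_eq : γ 2 = I.layered.N := E.N

theorem eval_cntF {b d : ℕ} (hb : b ≤ I.n + 1) (hd : d < γ 2) (h9 : γ 9 = b * γ 2 + d)
    (htab : ∀ j, b = j + 1 → ∀ e < γ 2, μ (γ 7 + (j * γ 2 + e)) = I.layered.cnt j e) :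
    eval γ μ cntF [] = I.layered.cnt b d := by
  classical
  have h3 := E.three
  have hn := E.n_lt
  have hlt : holds γ μ (lt (glob 9) (glob 2)) [] ↔ γ 9 < γ 2 := lt_iff rfl rfl
  rw [cntF, eval_ite, if_congr hlt rfl rfl]
  rcases b with _ | b
  · rw [if_pos (by omega), eval_ite, Layered.cnt]
    refine if_congr ?_ rfl rfl
    rw [holds_call1, eval_glob, show γ ((9 : Fin 24) : ℕ) = d by simpa using h9]
    exact E.holds_finF hd
  · have hdiv : γ 9 / γ 2 = b + 1 := by
      rw [h9, mul_comm, Nat.mul_add_div (by omega), Nat.div_eq_of_lt hd, add_zero]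
    have hmod : γ 9 % γ 2 = d := by
      rw [h9, mul_comm, Nat.mul_add_mod, Nat.mod_eq_of_lt hd]
    rw [if_neg (by rw [h9, Nat.succ_mul]; omega), eval_call2, eval_call2, eval_call2]
    simp only [eval_glob]
    rw [show ((9 : Fin 24) : ℕ) = 9 from rfl, show ((2 : Fin 24) : ℕ) = 2 from rfl,
      eval_divF (by omega) (Or.inl le_rfl), eval_modF le_rfl (by omega), hdiv, hmod,
      Layered.cnt, ← Finset.sum_filter, ← E.N_eq]
    refine sumIf_eq (ρ := [b + 1, d]) (b := glob 2) (m := γ 2) rfl (fun _ => rfl) le_rfl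
      (fun e he => ?_) fun e he _ => ?_
    · simp only [holds_call3]
      have := E.holds_relF (a := I.n + 1 - (b + 1)) (by omega) hd he
      simpa [E.n, I.layered_m] using this
    · rw [← htab b rfl e he, eval_load]
      congr 1
      simp only [eval_add, eval_glob, eval_sub, eval_var]
      simp [h9, Nat.succ_mul]

/-- The numbers of paths are in the memory. -/
def HasTable (I : Inst) (γ μ : ℕ → ℕ) : Prop :=
  ∀ b ≤ I.n + 1, ∀ e < γ 2, μ (γ 7 + (b * γ 2 + e)) = I.layered.cnt b e

variable (T : HasTable I γ μ)
include T

theorem eval_preF {a d e : ℕ} (ha : a ≤ I.n) (hd : d < γ 2) (he : e ≤ γ 2) :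
    eval γ μ preF [a, d, e] = ∑ i ∈ Finset.range e, I.layered.wt a d i := by
  classical
  simp only [Layered.wt]
  rw [← Finset.sum_filter]
  refine sumIf_eq (ρ := [a, d, e]) (b := var 2) (m := e) rfl (fun _ => rfl) he
      (fun e' he' => ?_) fun e' he' _ => ?_
  · have := E.holds_relF (a := a) (by omega) hd (he'.trans_le he)
    simpa [E.n] using this
  · have hn := E.n_lt
    rw [show I.layered.m - (a + 1) = I.n - a by rw [I.layered_m]; omega,
      ← T _ (by omega) e' (he'.trans_le he)]
    simp only [eval_load, eval_add, eval_glob, eval_call2, eval_sub, eval_var]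
    rw [show γ ((0 : Fin 24) : ℕ) = I.n from E.n]
    simp only [List.cons_append, List.nil_append, List.getD_cons_zero]
    rw [eval_mulF (by omega), mul_comm]
    rfl

theorem eval_selF {a d r : ℕ} (ha : a ≤ I.n) (hd : d < γ 2) :
    eval γ μ selF [a, d, r] = sel (I.layered.wt a d) (γ 2) r := by
  rw [sel, Finset.card_eq_sum_ones]
  refine sumIf_eq (ρ := [a, d, r]) (b := glob 2) (m := γ 2) (f := fun _ => 1) rfl (fun _ => rfl)
    le_rfl (fun e he => le_iff ?_ rfl) fun _ _ _ => rfl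
  simp only [eval_call3, eval_var, eval_add, eval_const]
  simpa using E.eval_preF T ha hd (show e + 1 ≤ γ 2 from he)

end NodeEnv

theorem NodeEnv.eval_labelF {I : Inst} {γ μ : ℕ → ℕ} (E : NodeEnv I γ μ) {p : ℕ → ℕ} {v : ℕ}
    (hv : v < I.n) (hp : ∀ a ≤ I.n + 1, 0 < a → p a < γ 2)
    (hmem : ∀ a ≤ I.n + 1, μ (γ 8 + a) = p a) :
    eval γ μ labelF [v] = I.labeling p v := by
  classical
  rw [labelF, eval_call3, eval_call1, eval_var, List.getD_cons_zero, E.eval_repF, Inst.labeling,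
    eval_load, eval_add, eval_ite, eval_add, eval_call1, eval_var, List.getD_cons_zero,
    E.eval_repF, holds_call1, eval_var, List.getD_cons_zero, E.holds_inUF]
  simp only [eval_const, eval_glob]
  set a := if I.U v then 1 else I.rep v + 2 with ha
  have h1 : a ≤ I.n + 1 ∧ 0 < a := by
    rw [ha]
    split_ifs with h
    · omega
    · have := (E.good.rep_spec h hv).1
      omega
  rw [show γ ((8 : Fin 24) : ℕ) + a = γ 8 + a from rfl, hmem a h1.1]
  exact E.eval_labF (hp a h1.1 h1.2) hv.le

end Ex

/-! ### Runs that write one word -/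

/-- Started in `s`, the program `p` halts after at most `T` steps in a state that satisfies `Q`,
without completing an output word, and what it writes is `ws`. -/
def Writes (p : Prog) (s : State) (T : ℕ) (ws : List ℕ) (Q : State → Prop) : Prop :=
  ∃ tr s', Exec p s tr s' ∧ Event.emitted ∉ tr ∧ wordOf tr = ws ∧ tr.length ≤ T ∧ Q s'

theorem wordOf_append (t t' : List Event) : wordOf (t ++ t') = wordOf t ++ wordOf t' :=
  List.filterMap_append ..

theorem wordOf_tick (t : List Event) : wordOf (.tick :: t) = wordOf t := rfl

section

variable {p q : Prog} {s : State} {T T' : ℕ} {Q Q' : State → Prop} {ws ws' : List ℕ}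

theorem WP.writes (h : WP p s T Q) : Writes p s T [] Q := by
  obtain ⟨tr, s', h1, h2, h3, h4⟩ := h
  refine ⟨tr, s', h1, fun h => (by simpa using h2 _ h), ?_, h3, h4⟩
  rw [wordOf, List.filterMap_eq_nil_iff]
  intro e he
  rw [h2 e he]

theorem Writes.mono (h : Writes p s T ws Q) (hT : T ≤ T') (hQ : ∀ s', Q s' → Q' s') :
    Writes p s T' ws Q' := by
  obtain ⟨tr, s', h1, h2, h3, h4, h5⟩ := h
  exact ⟨tr, s', h1, h2, h3, h4.trans hT, hQ _ h5⟩

theorem Writes.seq (h : Writes p s T ws fun s' => Writes q s' T' ws' Q) :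
    Writes (p ;; q) s (T + T') (ws ++ ws') Q := by
  obtain ⟨tr, s', h1, h2, rfl, h4, tr', s'', g1, g2, rfl, g4, g5⟩ := h
  refine ⟨tr ++ tr', s'', .seq h1 g1, by simp [h2, g2], wordOf_append _ _, by simp; omega, g5⟩

theorem Writes.loop {r M : ℕ} {I : ℕ → State → Prop} {out : ℕ → List ℕ} (h0 : I 0 s)
    (hstep : ∀ i < M, ∀ s, I i s → s.reg r ≠ 0 ∧ Writes p s T (out i) (I (i + 1)))
    (hend : ∀ s, I M s → s.reg r = 0) :
    Writes (.loop r p) s (M * (T + 1) + 1) ((List.range M).flatMap out) (I M) := by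
  suffices H : ∀ k i s, i + k = M → I i s →
      Writes (.loop r p) s (k * (T + 1) + 1) ((List.range' i k).flatMap out) (I M) by
    rw [List.range_eq_range']
    exact H M 0 s (by omega) h0
  intro k
  induction k with
  | zero =>
    intro i s hi hI
    obtain rfl : i = M := by omega
    exact ⟨_, _, .loop_done (hend s hI), by simp, by simp [wordOf], by simp, hI⟩
  | succ k ih =>
    intro i s hi hI
    obtain ⟨hr, tr, s', h1, h2, h3, h4, h5⟩ := hstep i (by omega) s hI
    obtain ⟨tr', s'', g1, g2, g3, g4, g5⟩ := ih (i + 1) s' (by omega) h5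
    refine ⟨_, s'', .loop_again hr h1 g1, by simp [h2, g2], ?_, ?_, g5⟩
    · rw [wordOf_tick, wordOf_append, h3, g3, List.range'_succ, List.flatMap_cons]
    · simp only [List.length_cons, List.length_append]
      rw [Nat.succ_mul]
      omega

end

/-! ### Polynomial time -/

/-- For all parameters `x`, started in a state that satisfies `P x`, the program `p` writes `out x`
and ends in a state that satisfies `Q x`, in time polynomial in `w x`. -/
def Hoare {X : Type*} (w : X → ℕ) (P : X → State → Prop) (p : Prog) (out : X → List ℕ)
    (Q : X → State → Prop) : Prop :=
  ∃ c, ∀ x s, P x s → Writes p s (w x ^ c) (out x) (Q x)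

/-- Globals occupy the registers below 24, so code compiled from register 24 on leaves all of them
intact until the final copy. -/
def assign (g : ℕ) (e : Ex) : Prog := e.compile [] 24 ;; .const g 0 ;; .add g g 24

def assignMem (a e : Ex) : Prog := a.compile [] 24 ;; e.compile [] 25 ;; .store 24 25

/-- Runs `body` for the values `0, …, m - 1` of register `j`, where `m` is the value of `m`. -/
def forLoop (j r : ℕ) (m : Ex) (body : Prog) : Prog :=
  assign r m ;; assign j (.const 0) ;;
    .loop r (body ;; .const 24 1 ;; .add j j 24 ;; .sub r r 24)

namespace Hoare

variable {X : Type*} {w : X → ℕ} {P Q R : X → State → Prop} {p q : Prog} {out : X → List ℕ}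

theorem post (h : Hoare w P p out Q) (hQ : ∀ x s, Q x s → R x s) :
    Hoare w P p out R := h.imp fun _ h x s hs => (h x s hs).mono le_rfl (hQ x)

theorem seq (hw : ∀ x, 2 ≤ w x) (h1 : Hoare w P p (fun _ => []) Q) (h2 : Hoare w Q q out R) :
    Hoare w P (p ;; q) out R := by
  obtain ⟨c, h1⟩ := h1
  obtain ⟨d, h2⟩ := h2
  refine ⟨c + d + 1, fun x s hs => ?_⟩
  refine (Writes.seq ((h1 x s hs).mono le_rfl (h2 x))).mono ?_ fun _ h => h
  have := hw x
  have e1 := Nat.pow_le_pow_right (show 0 < w x by omega) (show c ≤ c + d by omega)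
  have e2 := Nat.pow_le_pow_right (show 0 < w x by omega) (show d ≤ c + d by omega)
  have := Nat.mul_le_mul_left (w x ^ (c + d)) (hw x)
  rw [pow_succ]
  omega

theorem assign {g : ℕ} {e : Ex} (hw : ∀ x, 2 ≤ w x) (hg : g < 24)
    (h : ∀ x s, P x s → s.reg 2 + 2 ≤ w x ∧
      ∀ s' : State, s'.reg g = e.eval s.reg s.mem [] → (∀ i < 24, i ≠ g → s'.reg i = s.reg i) →
        s'.mem = s.mem → Q x s') :
    Hoare w P (assign g e) (fun _ => []) Q := by
  obtain ⟨c, hc⟩ := e.cost_le_pow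
  refine ⟨c + 2, fun x s hs => (WP.mono_time (WP.seq (T := e.cost (s.reg 2)) (T' := 1 + 1)
    ((e.wp_compile s.reg s.mem [] [] 24 s (by simp) le_rfl rfl (fun _ _ => rfl) rfl).mono le_rfl
      ?_)) ?_).writes⟩
  · rintro s1 ⟨h1, h2, h3⟩
    refine WP.seq (WP.const (WP.add ((h x s hs).2 _ ?_ (fun i hi hne => ?_) h3)))
    · simp [State.setReg, hg.ne', h1]
    · simp [State.setReg, hne, h2 i hi]
  · have h1 := hc _ _ (h x s hs).1
    have h2 := hw x
    have h3 := Nat.one_le_pow c (w x) (by omega)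
    have h4 := Nat.mul_le_mul_left (w x ^ c) (Nat.pow_le_pow_left h2 2)
    rw [pow_add]
    omega

theorem assignMem {a e : Ex} (hw : ∀ x, 2 ≤ w x) (h : ∀ x s, P x s → s.reg 2 + 2 ≤ w x ∧
      ∀ s' : State, (∀ i < 24, s'.reg i = s.reg i) →
        s'.mem = Function.update s.mem (a.eval s.reg s.mem []) (e.eval s.reg s.mem []) → Q x s') :
    Hoare w P (assignMem a e) (fun _ => []) Q := by
  obtain ⟨c, hc⟩ := a.cost_le_pow
  obtain ⟨d, hd⟩ := e.cost_le_pow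
  refine ⟨c + d + 2, fun x s hs => (WP.mono_time (WP.seq (T := a.cost (s.reg 2))
    (T' := e.cost (s.reg 2) + 1)
    ((a.wp_compile s.reg s.mem [] [] 24 s (by simp) le_rfl rfl (fun _ _ => rfl) rfl).mono le_rfl
      ?_)) ?_).writes⟩
  · rintro s1 ⟨h1, h2, h3⟩
    refine WP.seq ((e.wp_compile s.reg s.mem [] [] 25 s1 (by simp) (by norm_num) rfl h2 h3).mono
      le_rfl ?_)
    rintro s2 ⟨g1, g2, g3⟩
    refine WP.store ((h x s hs).2 _ (fun i hi => ?_) ?_)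
    · simp [State.setMem, g2 i (by omega), h2 i hi]
    · simp [State.setMem, g1, g2 24, h1, g3, h3]
  · have h1 := hc _ _ (h x s hs).1
    have h4 := hd _ _ (h x s hs).1
    have h2 := hw x
    have e1 := Nat.pow_le_pow_right (show 0 < w x by omega) (show c ≤ c + d by omega)
    have e2 := Nat.pow_le_pow_right (show 0 < w x by omega) (show d ≤ c + d by omega)
    have h3 := Nat.one_le_pow (c + d) (w x) (by omega)
    have h6 := Nat.mul_le_mul_left (w x ^ (c + d)) (Nat.pow_le_pow_left h2 2)
    rw [pow_add _ (c + d)]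
    omega

theorem write {r : ℕ} {v : X → ℕ}
    (h : ∀ x s, P x s → s.reg r = v x ∧ Q x s) :
    Hoare w P (.write r) (fun x => [v x]) Q := by
  refine ⟨0, fun x s hs => ⟨_, _, .write s r, by simp, ?_, by simp, (h x s hs).2⟩⟩
  simp [wordOf, (h x s hs).1]

/-- By `hI` the invariant ignores `j`, `r` and the registers from 24 on, which change between
rounds. The body is parametrized by `X × ℕ` so that one exponent bounds its time in all rounds. -/
theorem forLoop {j r : ℕ} {m : X → ℕ} {M : Ex} {body : Prog} {I : X → ℕ → State → Prop}
    {out : X → ℕ → List ℕ} {e : ℕ} (hw : ∀ x, 2 ≤ w x) (hj : j < 24) (hr : r < 24) (hjr : j ≠ r)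
    (h2j : 2 ≠ r)
    (hI : ∀ x i s (s' : State), I x i s → (∀ g < 24, g ≠ j → g ≠ r → s'.reg g = s.reg g) →
      s'.mem = s.mem → I x i s')
    (h0 : ∀ x s, P x s → s.reg 2 + 2 ≤ w x ∧ M.eval s.reg s.mem [] = m x ∧ I x 0 s)
    (hm : ∀ x, m x ≤ w x ^ e)
    (hbody : Hoare (fun y : X × ℕ => w y.1)
      (fun y s => y.2 < m y.1 ∧ s.reg j = y.2 ∧ s.reg r = m y.1 - y.2 ∧ I y.1 y.2 s) body
      (fun y => out y.1 y.2)
      (fun y s => s.reg j = y.2 ∧ s.reg r = m y.1 - y.2 ∧ I y.1 (y.2 + 1) s)) :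
    Hoare w P (forLoop j r M body) (fun x => (List.range (m x)).flatMap (out x))
      (fun x => I x (m x)) := by
  refine seq (Q := fun x s => s.reg 2 + 2 ≤ w x ∧ s.reg r = m x ∧ I x 0 s) hw
    (assign hw hr fun x s hs => ?_) (seq (Q := fun x s => s.reg j = 0 ∧ s.reg r = m x ∧ I x 0 s) hw
    (assign hw hj fun x s hs => ⟨hs.1, fun s' h1 h2 h3 => ⟨h1, ?_, ?_⟩⟩) ?_)
  · obtain ⟨h1, h2, h3⟩ := h0 x s hs
    refine ⟨h1, fun s' g1 g2 g3 => ⟨?_, g1.trans h2, hI x 0 s s' h3 (fun g hg _ => g2 g hg) g3⟩⟩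
    rw [g2 2 (by norm_num) h2j]
    exact h1
  · rw [h2 r hr hjr.symm, hs.2.1]
  · exact hI x 0 s s' hs.2.2 (fun g hg hgj _ => h2 g hg hgj) h3
  obtain ⟨c, hc⟩ := hbody
  refine ⟨e + c + 4, fun x s hs => ?_⟩
  refine (Writes.loop (T := w x ^ c + 3) (M := m x)
    (I := fun i s => s.reg j = i ∧ s.reg r = m x - i ∧ I x i s)
    (out := out x) (by simpa using hs) (fun i hi s hs => ⟨by omega, ?_⟩) ?_).mono ?_ ?_
  · rw [← List.append_nil (out x i)]
    refine Writes.seq ((hc (x, i) s ⟨hi, hs⟩).mono le_rfl ?_)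
    rintro s1 ⟨g1, g2, g3⟩
    refine WP.writes (WP.seq (T := 1) (T' := 1 + 1) (.const (WP.seq (.add (.sub ?_)))))
    refine ⟨?_, ?_, hI _ _ _ _ g3 (fun g hg hgj hgr => ?_) rfl⟩
    · simp [State.setReg, hjr, hj.ne, g1]
    · simp [State.setReg, hjr.symm, hr.ne, g2, (show 24 ≠ j by omega)]
      omega
    · simp [State.setReg, hgj, hgr, hg.ne]
  · intro s hs
    omega
  · have h1 := hm x
    have h2 := hw x
    have h3 := Nat.one_le_pow c (w x) (by omega)
    have h4 := Nat.one_le_pow e (w x) (by omega)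
    have h5 : 2 ^ 4 ≤ w x ^ 4 := Nat.pow_le_pow_left h2 4
    have h6 : 1 ≤ w x ^ e * w x ^ c := Nat.one_le_iff_ne_zero.2 (by positivity)
    calc m x * (w x ^ c + 3 + 1) + 1 ≤ w x ^ e * (w x ^ c * 5) + 1 := by
          gcongr; omega
      _ ≤ w x ^ e * w x ^ c * 2 ^ 4 := by nlinarith
      _ ≤ w x ^ e * w x ^ c * w x ^ 4 := Nat.mul_le_mul_left _ h5
      _ = w x ^ (e + c + 4) := by ring
  · exact fun s hs => hs.2.2

theorem forLoop_silent {j r : ℕ} {m : X → ℕ} {M : Ex} {body : Prog} {I : X → ℕ → State → Prop}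
    (e : ℕ) (hw : ∀ x, 2 ≤ w x) (hj : j < 24) (hr : r < 24) (hjr : j ≠ r) (h2j : 2 ≠ r)
    (hI : ∀ x i s (s' : State), I x i s → (∀ g < 24, g ≠ j → g ≠ r → s'.reg g = s.reg g) →
      s'.mem = s.mem → I x i s')
    (h0 : ∀ x s, P x s → s.reg 2 + 2 ≤ w x ∧ M.eval s.reg s.mem [] = m x ∧ I x 0 s)
    (hm : ∀ x, m x ≤ w x ^ e)
    (hbody : Hoare (fun y : X × ℕ => w y.1)
      (fun y s => y.2 < m y.1 ∧ s.reg j = y.2 ∧ s.reg r = m y.1 - y.2 ∧ I y.1 y.2 s) body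
      (fun _ => [])
      (fun y s => s.reg j = y.2 ∧ s.reg r = m y.1 - y.2 ∧ I y.1 (y.2 + 1) s))
    (hQ : ∀ x s, I x (m x) s → Q x s) :
    Hoare w P (MatchingMulticut.forLoop j r M body) (fun _ => []) Q := by
  have := (forLoop (out := fun _ _ => []) hw hj hr hjr h2j hI h0 hm hbody).post hQ
  have h : ∀ k, (List.range k).flatMap (fun _ => ([] : List ℕ)) = [] :=
    fun k => List.flatMap_eq_nil_iff.2 fun _ _ => rfl
  simpa only [h] using this

end Hoare

/-! ### The preprocessing -/

structure Input where
  n : ℕ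
  G : SimpleGraph (Fin n)
  l : ℕ

namespace Input

noncomputable def inst (x : Input) : Inst := Inst.ofGraph x.G x.l

/-- The running times are polynomial in this number. -/
noncomputable def size (x : Input) : ℕ := x.inst.B ^ 5 + 2

theorem two_le_size (x : Input) : 2 ≤ x.size := Nat.le_add_left ..

theorem n_inst (x : Input) : x.inst.n = x.n := rfl

theorem size_bounds (x : Input) : x.n ^ 3 + x.n + 3 + x.inst.B + 2 ≤ x.size := by
  have h := (Inst.pow_lt_B (I := x.inst)).2.2
  rw [n_inst] at h
  have h1 : x.n ^ 3 ≤ x.inst.B ^ 3 := Nat.pow_le_pow_left (by omega) 3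
  have h2 : 5 ^ 2 ≤ x.inst.B ^ 2 := Nat.pow_le_pow_left (by omega) 2
  have h3 : x.inst.B ≤ x.inst.B ^ 3 := Nat.le_self_pow (by omega) _
  have h4 := Nat.mul_le_mul_left (x.inst.B ^ 3) h2
  rw [← pow_add, show 3 + 2 = 5 from rfl] at h4
  rw [size]
  omega

end Input

namespace Ex

/-- Register 2 may grow, since only lower bounds on the range are involved. The preprocessing relies
on this when it raises the range in stages. -/
theorem GraphEnv.congr {I : Inst} {γ γ' μ μ' : ℕ → ℕ} (E : GraphEnv I γ μ) (h0 : γ' 0 = γ 0)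
    (h2 : γ 2 ≤ γ' 2) (h3 : γ' 3 = γ 3) (h4 : γ' 4 = γ 4) (hμ : ∀ a < I.n ^ 2, μ' a = μ a) :
    GraphEnv I γ' μ' where
  good := E.good
  hU := E.hU
  n := h0.trans E.n
  base := h3.trans E.base
  cube := h4.trans E.cube
  cube_lt := E.cube_lt.trans_le h2
  n_lt := E.n_lt.trans_le h2
  three := E.three.trans h2
  adj i hi j hj := by
    rw [hμ, E.adj i hi j hj]
    nlinarith

theorem SelEnv.congr {I : Inst} {γ γ' μ μ' : ℕ → ℕ} (E : SelEnv I γ μ) (h0 : γ' 0 = γ 0)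
    (h2 : γ 2 ≤ γ' 2) (h3 : γ' 3 = γ 3) (h4 : γ' 4 = γ 4)
    (hμ : ∀ a < I.n ^ 2 + I.n ^ 3, μ' a = μ a) : SelEnv I γ' μ' where
  toGraphEnv := E.toGraphEnv.congr h0 h2 h3 h4 fun a ha => hμ a (by omega)
  sel p hp := by rw [hμ _ (by omega), E.sel p hp]

theorem NodeEnv.congr {I : Inst} {γ γ' μ μ' : ℕ → ℕ} (E : NodeEnv I γ μ)
    (h : ∀ i < 7, γ' i = γ i) (hμ : ∀ a < I.n ^ 2 + I.n ^ 3, μ' a = μ a) : NodeEnv I γ' μ' where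
  toSelEnv := E.toSelEnv.congr (h 0 (by omega)) (h 2 (by omega)).ge (h 3 (by omega))
    (h 4 (by omega)) hμ
  l := (h 1 (by omega)).trans E.l
  k := (h 5 (by omega)).trans E.k
  B := (h 6 (by omega)).trans E.B
  N := (h 2 (by omega)).trans E.N

/-- The tables of the algorithm are in the memory, entries of the last one only before `j`. -/
structure TableEnv (I : Inst) (j : ℕ) (γ μ : ℕ → ℕ) : Prop extends NodeEnv I γ μ where
  tb : γ 7 = I.n ^ 2 + I.n ^ 3
  pb : γ 8 = γ 7 + (I.n + 2) * γ 2
  table : ∀ b ≤ I.n + 1, ∀ e < γ 2, b * γ 2 + e < j → μ (γ 7 + (b * γ 2 + e)) = I.layered.cnt b e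

theorem TableEnv.congr {I : Inst} {j : ℕ} {γ γ' μ μ' : ℕ → ℕ} (E : TableEnv I j γ μ)
    (h : ∀ i < 9, γ' i = γ i) (hμ : ∀ a < γ 7 + j, μ' a = μ a) : TableEnv I j γ' μ' where
  toNodeEnv := E.toNodeEnv.congr (fun i hi => h i (by omega)) fun a ha => hμ a (by rw [E.tb]; omega)
  tb := by rw [h 7 (by omega), E.tb]
  pb := by rw [h 8 (by omega), h 7 (by omega), h 2 (by omega), E.pb]
  table b hb e he hbe := by
    rw [h 2 (by omega)] at he hbe ⊢
    rw [h 7 (by omega), hμ _ (by omega), E.table b hb e he hbe]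

end Ex

open Ex

/-- Tabulates the triples that are selected greedily. -/
def prepareSel : Prog :=
  -- The range has to grow before larger values can be handled: `n` suffices for the products by
  -- `n`, and `n ^ 3 + n + 3` for running through triples.
  assign 2 (glob 0) ;; assign 3 (call2 mulF (glob 0) (glob 0)) ;;
  assign 4 (call2 mulF (glob 3) (glob 0)) ;; assign 2 (add (glob 4) (add (glob 0) (const 3))) ;;
  forLoop 9 10 (glob 4) (assignMem (add (glob 3) (glob 9)) selectedF)

/-- Computes the parameters of the layered graph. -/
def prepareNode : Prog :=
  assign 5 (call1 idxF (glob 0)) ;;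
  assign 6 (add (add (add (add (call2 powF (glob 5) (glob 5)) (call2 powF (const 2) (glob 5)))
    (glob 0)) (glob 0)) (const 5)) ;;
  -- The intermediate range contains `B`, as is required for computing `B ^ 5`.
  assign 2 (add (glob 6) (glob 2)) ;; assign 2 (call2 powF (glob 6) (const 5)) ;;
  assign 7 (add (glob 3) (glob 4)) ;;
  assign 8 (add (glob 7) (call2 mulF (glob 2) (add (glob 0) (const 2))))

/-- Tabulates the numbers of paths. -/
def prepareCnt : Prog :=
  forLoop 9 10 (sub (glob 8) (glob 7)) (assignMem (add (glob 7) (glob 9)) cntF) ;;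
  -- The address is the start of the last row, so the entry counts all accepted paths from the start
  -- node.
  assign 14 (load (sub (glob 8) (glob 2)))

def Initial (x : Input) (s : State) : Prop := s = inputState x.G x.l

def SelReady (x : Input) (s : State) : Prop :=
  SelEnv x.inst s.reg s.mem ∧ s.reg 1 = x.l ∧ s.reg 2 = x.n ^ 3 + x.n + 3

/-- The state when `r` solutions are to be output yet. -/
def MainReady (x : Input) (r : ℕ) (s : State) : Prop :=
  TableEnv x.inst ((x.n + 2) * s.reg 2) s.reg s.mem ∧ s.reg 14 = r

/-- For `j < n`, division with remainder recovers `i` and `j` from the address `i * n + j`. -/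
theorem inputState_mem_ne_zero {n : ℕ} {G : SimpleGraph (Fin n)} {l i j : ℕ}
    (hj : j < n) : (inputState G l).mem (i * n + j) ≠ 0 ↔ adjNat G i j := by
  simp only [inputState, ne_eq, ite_eq_right_iff, one_ne_zero, imp_false, not_not]
  constructor
  · rintro ⟨⟨a, ha⟩, ⟨b, hb⟩, hab, he⟩
    dsimp only at he
    have h1 : (n * i + j) / n = (n * a + b) / n := by rw [mul_comm, he, mul_comm]
    have h2 : (n * i + j) % n = (n * a + b) % n := by rw [mul_comm, he, mul_comm]
    rw [Nat.mul_add_div (by omega), Nat.mul_add_div (by omega), Nat.div_eq_of_lt hj,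
      Nat.div_eq_of_lt hb] at h1
    rw [Nat.mul_add_mod, Nat.mul_add_mod, Nat.mod_eq_of_lt hj, Nat.mod_eq_of_lt hb] at h2
    obtain rfl : i = a := by omega
    subst h2
    exact ⟨ha, hb, hab⟩
  · rintro ⟨hi, hj, h⟩
    exact ⟨_, _, h, rfl⟩

theorem hoare_prepareSel :
    Hoare Input.size Initial prepareSel (fun _ => []) SelReady := by
  have hw := Input.two_le_size
  refine .seq (Q := fun x s => s.mem = (inputState x.G x.l).mem ∧ s.reg 0 = x.n ∧ s.reg 1 = x.l ∧
    s.reg 2 = x.n) hw (.assign hw (by norm_num) fun x s hs => ⟨?_, fun s' h1 h2 h3 => ?_⟩) ?_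
  · have := hw x
    simpa [show s = _ from hs, inputState] using this
  · obtain rfl : s = _ := hs
    rw [h3, h1, h2 0, h2 1] <;> simp [inputState]
  refine .seq (Q := fun x s => s.mem = (inputState x.G x.l).mem ∧ s.reg 0 = x.n ∧ s.reg 1 = x.l ∧
    s.reg 2 = x.n ∧ s.reg 3 = x.n ^ 2) hw (.assign hw (by norm_num)
    fun x s ⟨a1, a2, a3, a4⟩ => ⟨?_, fun s' h1 h2 h3 => ⟨h3.trans a1, ?_, ?_, ?_, ?_⟩⟩) ?_
  · have := x.size_bounds
    omega
  · rw [h2 0, a2] <;> norm_num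
  · rw [h2 1, a3] <;> norm_num
  · rw [h2 2, a4] <;> norm_num
  · simp [h1, a2, eval_mulF, a4, sq]
  refine .seq (Q := fun x s => s.mem = (inputState x.G x.l).mem ∧ s.reg 0 = x.n ∧ s.reg 1 = x.l ∧
    s.reg 2 = x.n ∧ s.reg 3 = x.n ^ 2 ∧ s.reg 4 = x.n ^ 3) hw (.assign hw (by norm_num)
    fun x s ⟨a1, a2, a3, a4, a5⟩ => ⟨?_, fun s' h1 h2 h3 => ⟨h3.trans a1, ?_, ?_, ?_, ?_, ?_⟩⟩) ?_
  · have := x.size_bounds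
    omega
  · rw [h2 0, a2] <;> norm_num
  · rw [h2 1, a3] <;> norm_num
  · rw [h2 2, a4] <;> norm_num
  · rw [h2 3, a5] <;> norm_num
  · simp [h1, a2, a5, eval_mulF, a4, pow_succ]
  refine .seq (Q := fun x s => GraphEnv x.inst s.reg s.mem ∧ s.reg 1 = x.l ∧
    s.reg 2 = x.n ^ 3 + x.n + 3) hw (.assign hw (by norm_num)
    fun x s ⟨a1, a2, a3, a4, a5, a6⟩ => ⟨?_, fun s' h1 h2 h3 => ?_⟩) ?_
  · have := x.size_bounds
    omega
  · have g2 : s'.reg 2 = x.n ^ 3 + x.n + 3 := by simp [h1, a2, a6, add_assoc]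
    refine ⟨⟨Inst.good_ofGraph _, rfl, ?_, ?_, ?_, ?_, ?_, ?_, ?_⟩, ?_, g2⟩
    · rw [h2 0, a2] <;> first | rfl | norm_num
    · rw [h2 3, a5] <;> first | rfl | norm_num
    · rw [h2 4, a6] <;> first | rfl | norm_num
    · rw [g2, x.n_inst]; omega
    · rw [g2, x.n_inst]; omega
    · rw [g2]; omega
    · intro i hi j hj
      rw [h3, a1]
      exact inputState_mem_ne_zero hj
    · rw [h2 1, a3] <;> norm_num
  refine Hoare.forLoop_silent (m := fun x => x.n ^ 3) 1 (I := fun x i s =>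
      GraphEnv x.inst s.reg s.mem ∧ s.reg 1 = x.l ∧ s.reg 2 = x.n ^ 3 + x.n + 3 ∧
      ∀ p < i, s.mem (x.n ^ 2 + p) ≠ 0 ↔ Selected x.inst.adj x.inst.n p)
    hw (by norm_num) (by norm_num) (by norm_num) (by norm_num) ?_ ?_ ?_ ?_ ?_
  · rintro x i s s' ⟨h1, h2, h3, h4⟩ hr hm
    refine ⟨h1.congr ?_ ?_ ?_ ?_ (fun _ _ => by rw [hm]), ?_, ?_, by rwa [hm]⟩
    · exact hr 0 (by omega) (by omega) (by omega)
    · exact (hr 2 (by omega) (by omega) (by omega)).ge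
    · exact hr 3 (by omega) (by omega) (by omega)
    · exact hr 4 (by omega) (by omega) (by omega)
    · rw [hr 1 (by omega) (by omega) (by omega), h2]
    · rw [hr 2 (by omega) (by omega) (by omega), h3]
  · rintro x s ⟨h1, h2, h3⟩
    refine ⟨?_, h1.cube, h1, h2, h3, by simp⟩
    have := x.size_bounds
    omega
  · intro x
    have := x.size_bounds
    rw [pow_one]
    omega
  · refine .assignMem (fun y => hw y.1) fun ⟨x, i⟩ s ⟨hi, h9, h10, h1, h2, h3, h4⟩ =>
      ⟨?_, fun s' hr hm =>
        ⟨(hr 9 (by omega)).trans h9, (hr 10 (by omega)).trans h10, ?_, ?_, ?_, ?_⟩⟩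
    · have := x.size_bounds
      simp only at *
      omega
    · simp only [eval_add, eval_glob] at hm
      rw [show s.reg ((3 : Fin 24) : ℕ) = x.n ^ 2 from h1.base] at hm
      refine h1.congr (hr 0 (by omega)) (hr 2 (by omega)).ge (hr 3 (by omega)) (hr 4 (by omega)) ?_
      intro a ha
      rw [hm, Function.update_of_ne]
      rw [x.n_inst] at ha
      omega
    · rw [hr 1 (by omega), h2]
    · rw [hr 2 (by omega), h3]
    · simp only [eval_add, eval_glob] at hm
      rw [show s.reg ((3 : Fin 24) : ℕ) = x.n ^ 2 from h1.base,
        show s.reg ((9 : Fin 24) : ℕ) = i from h9] at hm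
      intro p hp
      rw [hm]
      by_cases hpi : p = i
      · subst hpi
        rw [Function.update_self]
        exact h1.holds_selectedF hi h9 h4
      · rw [Function.update_of_ne (by simpa using hpi)]
        exact h4 p (by simp at hp; omega)
  · rintro x s ⟨h1, h2, h3, h4⟩
    exact ⟨⟨h1, h4⟩, h2, h3⟩

open Ex

theorem hoare_prepareNode : Hoare Input.size SelReady prepareNode (fun _ => []) fun x s =>
    TableEnv x.inst 0 s.reg s.mem := by
  have hw := Input.two_le_size
  have hk : ∀ x : Input, x.inst.k ≤ x.n := fun x => Inst.k_le
  refine .seq (Q := fun x s => SelReady x s ∧ s.reg 5 = x.inst.k) hw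
    (.assign hw (by norm_num) fun x s ⟨a1, a2, a3⟩ => ⟨?_, fun s' h1 h2 h3 =>
      ⟨⟨a1.congr ?_ ?_ ?_ ?_ fun _ _ => by rw [h3], ?_, ?_⟩, ?_⟩⟩) ?_
  · have := x.size_bounds
    omega
  · exact h2 0 (by norm_num) (by norm_num)
  · exact (h2 2 (by norm_num) (by norm_num)).ge
  · exact h2 3 (by norm_num) (by norm_num)
  · exact h2 4 (by norm_num) (by norm_num)
  · rw [h2 1 (by norm_num) (by norm_num), a2]
  · rw [h2 2 (by norm_num) (by norm_num), a3]
  · rw [h1, eval_call1, eval_glob, show s.reg ((0 : Fin 24) : ℕ) = x.inst.n from a1.n,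
      a1.eval_idxF le_rfl]
    rfl
  refine .seq (Q := fun x s => SelReady x s ∧ s.reg 5 = x.inst.k ∧ s.reg 6 = x.inst.B) hw
    (.assign hw (by norm_num) fun x s ⟨⟨a1, a2, a3⟩, a4⟩ => ⟨?_, fun s' h1 h2 h3 =>
      ⟨⟨a1.congr ?_ ?_ ?_ ?_ fun _ _ => by rw [h3], ?_, ?_⟩, ?_, ?_⟩⟩) ?_
  · have := x.size_bounds
    omega
  · exact h2 0 (by norm_num) (by norm_num)
  · exact (h2 2 (by norm_num) (by norm_num)).ge
  · exact h2 3 (by norm_num) (by norm_num)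
  · exact h2 4 (by norm_num) (by norm_num)
  · rw [h2 1 (by norm_num) (by norm_num), a2]
  · rw [h2 2 (by norm_num) (by norm_num), a3]
  · rw [h2 5 (by norm_num) (by norm_num), a4]
  · rw [h1]
    have h := hk x
    simp only [eval_add, eval_call2, eval_glob, eval_const]
    rw [show s.reg ((0 : Fin 24) : ℕ) = x.inst.n from a1.n,
      show s.reg ((5 : Fin 24) : ℕ) = x.inst.k from a4, eval_powF (by omega) (by omega),
      eval_powF (by omega) (by omega)]
    rfl
  refine .seq (Q := fun x s => SelEnv x.inst s.reg s.mem ∧ s.reg 1 = x.l ∧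
      s.reg 2 = x.inst.B + (x.n ^ 3 + x.n + 3) ∧ s.reg 5 = x.inst.k ∧ s.reg 6 = x.inst.B) hw
    (.assign hw (by norm_num) fun x s ⟨⟨a1, a2, a3⟩, a4, a5⟩ => ⟨?_, fun s' h1 h2 h3 =>
      ?_⟩) ?_
  · have := x.size_bounds
    omega
  · have g : s'.reg 2 = x.inst.B + (x.n ^ 3 + x.n + 3) := by simp [h1, a3, a5]
    refine ⟨a1.congr ?_ ?_ ?_ ?_ fun _ _ => by rw [h3], ?_, g, ?_, ?_⟩
    · exact h2 0 (by norm_num) (by norm_num)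
    · rw [g, a3]; omega
    · exact h2 3 (by norm_num) (by norm_num)
    · exact h2 4 (by norm_num) (by norm_num)
    · rw [h2 1 (by norm_num) (by norm_num), a2]
    · rw [h2 5 (by norm_num) (by norm_num), a4]
    · rw [h2 6 (by norm_num) (by norm_num), a5]
  refine .seq (Q := fun x s => NodeEnv x.inst s.reg s.mem) hw
    (.assign hw (by norm_num) fun x s ⟨a1, a2, a3, a4, a5⟩ => ⟨?_, fun s' h1 h2 h3 =>
      ?_⟩) ?_
  · have := x.size_bounds
    omega
  · have hB := (Inst.pow_lt_B (I := x.inst)).2.2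
    have hs := x.size_bounds
    have g : s'.reg 2 = x.inst.B ^ 5 := by
      rw [h1]
      simp only [eval_call2, eval_glob, eval_const]
      rw [show s.reg ((6 : Fin 24) : ℕ) = x.inst.B from a5, eval_powF (by omega) (by omega)]
    refine ⟨a1.congr ?_ ?_ ?_ ?_ fun _ _ => by rw [h3], ?_, ?_, ?_, g⟩
    · exact h2 0 (by norm_num) (by norm_num)
    · rw [g, a3]; rw [Input.size] at hs; omega
    · exact h2 3 (by norm_num) (by norm_num)
    · exact h2 4 (by norm_num) (by norm_num)
    · rw [h2 1 (by norm_num) (by norm_num), a2]; rfl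
    · rw [h2 5 (by norm_num) (by norm_num), a4]
    · rw [h2 6 (by norm_num) (by norm_num), a5]
  refine .seq (Q := fun x s => NodeEnv x.inst s.reg s.mem ∧ s.reg 7 = x.n ^ 2 + x.n ^ 3) hw
    (.assign hw (by norm_num) fun x s a1 => ⟨?_, fun s' h1 h2 h3 =>
      ⟨a1.congr (fun i hi => h2 i (by omega) (by omega)) fun _ _ => by rw [h3], ?_⟩⟩) ?_
  · rw [a1.N]; rfl
  · rw [h1, eval_add]
    exact congrArg₂ _ a1.base a1.cube
  refine .assign hw (by norm_num) fun x s ⟨a1, a2⟩ => ⟨?_, fun s' h1 h2 h3 =>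
      ⟨a1.congr (fun i hi => h2 i (by omega) (by omega)) fun _ _ => by rw [h3], ?_, ?_, ?_⟩⟩
  · rw [a1.N]; rfl
  · rw [h2 7 (by norm_num) (by norm_num), a2]; rfl
  · rw [h1, h2 7 (by norm_num) (by norm_num), h2 2 (by norm_num) (by norm_num)]
    have hn := a1.n_lt
    have hB := (Inst.pow_lt_B (I := x.inst)).2.2
    have := a1.B_le
    simp only [eval_call2, eval_glob, eval_const, eval_add]
    rw [show s.reg ((0 : Fin 24) : ℕ) = x.inst.n from a1.n, eval_mulF (by omega), mul_comm]
    rfl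
  · omega

theorem Ex.TableEnv.N_pos {I : Inst} {j : ℕ} {γ μ : ℕ → ℕ} (E : TableEnv I j γ μ) : 0 < γ 2 :=
  (Nat.zero_le _).trans_lt E.n_lt

theorem hoare_prepareCnt : Hoare Input.size (fun x s => TableEnv x.inst 0 s.reg s.mem) prepareCnt
    (fun _ => []) fun x => MainReady x (numSolutions x.G x.l) := by
  have hw := Input.two_le_size
  refine .seq (Q := fun x s => TableEnv x.inst ((x.n + 2) * s.reg 2) s.reg s.mem) hw
    (Hoare.forLoop_silent (m := fun x => (x.n + 2) * x.inst.B ^ 5) (I := fun x i s =>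
      TableEnv x.inst i s.reg s.mem) 2
    hw (by norm_num) (by norm_num) (by norm_num) (by norm_num) ?_ ?_ ?_ ?_ ?_) ?_
  · rintro x i s s' h1 hr hm
    exact h1.congr (fun i hi => hr i (by omega) (by omega) (by omega)) (fun _ _ => by rw [hm])
  · rintro x s h1
    refine ⟨by rw [h1.N]; rfl, ?_, h1⟩
    rw [eval_sub, ← h1.N]
    have := h1.pb
    simp only [eval_glob]
    change s.reg 8 - s.reg 7 = _
    rw [this]
    simp [x.n_inst]
  · intro x
    have := x.size_bounds
    rw [sq]
    refine Nat.mul_le_mul ?_ ?_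
    · omega
    · rw [Input.size]; omega
  · refine .assignMem (fun y => hw y.1) fun ⟨x, i⟩ s ⟨hi, h9, h10, h1⟩ =>
      ⟨?_, fun s' hr hm => ⟨(hr 9 (by omega)).trans h9, (hr 10 (by omega)).trans h10, ?_⟩⟩
    · rw [h1.N]; rfl
    · dsimp only at *
      rw [← h1.N] at hi
      have hN := h1.N_pos
      -- Cell `i` of the table is entry `i % N` of row `i / N`; the previous row that it depends on
      -- is already complete.
      have hdm : s.reg 9 = (i / s.reg 2) * s.reg 2 + i % s.reg 2 := by
        rw [h9, Nat.div_add_mod']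
      have hlt := Nat.mod_lt i hN
      have hdiv : i / s.reg 2 ≤ x.n + 1 := Nat.lt_succ_iff.1 (Nat.div_lt_of_lt_mul (by linarith))
      have hv : eval s.reg s.mem cntF [] = x.inst.layered.cnt (i / s.reg 2) (i % s.reg 2) := by
        refine h1.eval_cntF hdiv hlt hdm fun j hj e he => h1.table j ?_ e he ?_
        · rw [x.n_inst]; omega
        · have := Nat.div_add_mod' i (s.reg 2)
          rw [hj, Nat.succ_mul] at this
          omega
      rw [hv, eval_add, eval_glob, eval_glob] at hm
      change s'.mem = Function.update s.mem (s.reg 7 + s.reg 9) _ at hm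
      rw [h9] at hm
      have h2 : TableEnv x.inst i s'.reg s'.mem := by
        refine h1.congr (fun i hi => hr i (by omega)) fun a ha => ?_
        rw [hm, Function.update_of_ne (by omega)]
      refine ⟨h2.toNodeEnv, h2.tb, h2.pb, fun b hb e he hbe => ?_⟩
      rcases Nat.lt_succ_iff_lt_or_eq.1 hbe with hlt' | heq
      · exact h2.table b hb e he hlt'
      · rw [hm, hr 7 (by norm_num), heq, Function.update_self]
        rw [hr 2 (by norm_num)] at heq he
        rw [← heq, mul_comm b, Nat.mul_add_div hN, Nat.div_eq_of_lt he, Nat.mul_add_mod,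
          Nat.mod_eq_of_lt he, add_zero]
  · intro x s h
    rwa [h.N]
  · refine .assign hw (by norm_num) fun x s h => ⟨by rw [h.N]; rfl, fun s' h1 h2 h3 => ⟨?_, ?_⟩⟩
    · rw [h2 2 (by norm_num) (by norm_num)]
      exact h.congr (fun i hi => h2 i (by omega) (by omega)) fun _ _ => by rw [h3]
    · have h8 := h.pb
      have hN := h.N_pos
      have ht := h.table (x.n + 1) le_rfl 0 hN (by
        rw [add_zero]; exact Nat.mul_lt_mul_of_pos_right (by omega) hN)
      rw [h1, eval_load, eval_sub, eval_glob, eval_glob, numSolutions]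
      change s.mem (s.reg 8 - s.reg 2) = _
      rw [h8, x.n_inst, show s.reg 7 + (x.n + 2) * s.reg 2 - s.reg 2 =
        s.reg 7 + ((x.n + 1) * s.reg 2 + 0) by
          rw [show x.n + 2 = x.n + 1 + 1 from rfl, Nat.succ_mul]; omega]
      exact ht

open Ex

/-! ### The output of one solution -/

/-- Computes path number `glob 14 - 1`, and decreases this number by one. -/
def findPath : Prog :=
  assign 14 (sub (glob 14) (const 1)) ;; assign 13 (glob 14) ;; assign 12 (const 0) ;;
  assignMem (glob 8) (const 0) ;;
  forLoop 11 15 (add (glob 0) (const 1))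
    -- Registers 12 and 13 are the two components of `unrank`. The new node waits in register 16, as
    -- the remainder is computed from the old node.
    (assign 16 (call3 selF (glob 11) (glob 12) (glob 13)) ;;
    assign 13 (sub (glob 13) (call3 preF (glob 11) (glob 12) (glob 16))) ;;
    assign 12 (glob 16) ;; assignMem (add (glob 8) (add (glob 11) (const 1))) (glob 12))

def writeLabels : Prog :=
  forLoop 9 10 (glob 0) (assign 17 (call1 labelF (glob 9)) ;; .write 17)

/-- The memory contains the first `i + 1` nodes of path number `r`. -/
def PathReady (x : Input) (r i : ℕ) (s : State) : Prop :=
  MainReady x r s ∧ ∀ a ≤ i, s.mem (s.reg 8 + a) = x.inst.layered.path r a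

theorem MainReady.congr {x : Input} {r : ℕ} {s s' : State} (h : MainReady x r s)
    (hr : ∀ i < 9, s'.reg i = s.reg i) (h14 : s'.reg 14 = s.reg 14)
    (hm : ∀ a < s.reg 8, s'.mem a = s.mem a) : MainReady x r s' := by
  refine ⟨?_, h14.trans h.2⟩
  rw [hr 2 (by omega)]
  exact h.1.congr hr fun a ha => hm a (by rw [h.1.pb]; exact ha)

theorem MainReady.hasTable {x : Input} {r : ℕ} {s : State} (h : MainReady x r s) :
    NodeEnv.HasTable x.inst s.reg s.mem := fun b hb e he => h.1.table b hb e he (by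
  rw [x.n_inst] at hb
  nlinarith)

theorem MainReady.size {x : Input} {r : ℕ} {s : State} (h : MainReady x r s) :
    s.reg 2 + 2 ≤ x.size := by
  rw [h.1.N]; rfl

theorem PathReady.congr {x : Input} {r i : ℕ} {s s' : State} (h : PathReady x r i s)
    (hr : ∀ i < 9, s'.reg i = s.reg i) (h14 : s'.reg 14 = s.reg 14)
    (hm : s'.mem = s.mem) : PathReady x r i s' :=
  ⟨h.1.congr hr h14 fun a _ => by rw [hm], fun a ha => by rw [hm, hr 8 (by omega), h.2 a ha]⟩

theorem Layered.unrank_lt {Λ : Layered} {r a : ℕ} (hr : r < Λ.cnt Λ.m 0) (hN : 0 < Λ.N)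
    (ha : a ≤ Λ.m) : (Λ.unrank r a).1 < Λ.N := by
  rcases a with _ | a
  · exact hN
  · exact ((unrank_spec hr ha).2 (by omega)).1

theorem Ex.TableEnv.unrank_lt {x : Input} {j r a : ℕ} {γ μ : ℕ → ℕ} (E : TableEnv x.inst j γ μ)
    (hr : r < numSolutions x.G x.l) (ha : a ≤ x.n + 1) :
    (x.inst.layered.unrank r a).1 < γ 2 := by
  rw [E.N_eq]
  refine Layered.unrank_lt hr ?_ ha
  rw [← E.N_eq]
  exact E.N_pos

theorem hoare_findPath :
    Hoare (fun y : Input × ℕ => y.1.size)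
      (fun y s => y.2 < numSolutions y.1.G y.1.l ∧ MainReady y.1 (y.2 + 1) s) findPath
      (fun _ => []) (fun y s => y.2 < numSolutions y.1.G y.1.l ∧
        PathReady y.1 y.2 (y.1.n + 1) s) := by
  have hw : ∀ y : Input × ℕ, 2 ≤ y.1.size := fun y => y.1.two_le_size
  refine .seq (Q := fun y s => y.2 < numSolutions y.1.G y.1.l ∧ MainReady y.1 y.2 s) hw
    (.assign hw (by norm_num) fun y s ⟨h0, h⟩ => ⟨h.size, fun s' h1 h2 h3 => ⟨h0, ?_, ?_⟩⟩) ?_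
  · rw [h2 2 (by norm_num) (by norm_num)]
    exact h.1.congr (fun i hi => h2 i (by omega) (by omega)) fun _ _ => by rw [h3]
  · rw [h1, eval_sub, eval_glob]
    change s.reg 14 - 1 = y.2
    rw [h.2]; rfl
  refine .seq (Q := fun y s => y.2 < numSolutions y.1.G y.1.l ∧ MainReady y.1 y.2 s ∧
      s.reg 13 = y.2) hw
    (.assign hw (by norm_num) fun y s ⟨h0, h⟩ => ⟨h.size, fun s' h1 h2 h3 => ⟨h0, ?_, ?_⟩⟩) ?_
  · exact h.congr (fun i hi => h2 i (by omega) (by omega)) (h2 14 (by norm_num) (by norm_num))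
      fun _ _ => by rw [h3]
  · exact h1.trans h.2
  refine .seq (Q := fun y s => y.2 < numSolutions y.1.G y.1.l ∧ MainReady y.1 y.2 s ∧
      s.reg 13 = y.2 ∧ s.reg 12 = 0) hw
    (.assign hw (by norm_num) fun y s ⟨h0, h, h4⟩ => ⟨h.size, fun s' h1 h2 h3 =>
      ⟨h0, ?_, ?_, h1⟩⟩) ?_
  · exact h.congr (fun i hi => h2 i (by omega) (by omega)) (h2 14 (by norm_num) (by norm_num))
      fun _ _ => by rw [h3]
  · rw [h2 13 (by norm_num) (by norm_num), h4]
  refine .seq (Q := fun y s => y.2 < numSolutions y.1.G y.1.l ∧ PathReady y.1 y.2 0 s ∧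
      s.reg 13 = y.2 ∧ s.reg 12 = 0) hw
    (.assignMem hw fun y s ⟨h0, h, h4, h5⟩ => ⟨h.size, fun s' h2 h3 => ⟨h0, ⟨?_, ?_⟩, ?_, ?_⟩⟩) ?_
  · refine h.congr (fun i hi => h2 i (by omega)) (h2 14 (by norm_num)) fun a ha => ?_
    rw [h3]
    exact Function.update_of_ne ha.ne ..
  · intro a ha
    obtain rfl : a = 0 := by omega
    rw [h2 8 (by norm_num), h3]
    exact Function.update_self ..
  · rw [h2 13 (by norm_num), h4]
  · rw [h2 12 (by norm_num), h5]
  refine Hoare.forLoop_silent (m := fun y => y.1.n + 1) (I := fun y i s =>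
      y.2 < numSolutions y.1.G y.1.l ∧ PathReady y.1 y.2 i s ∧
      s.reg 13 = (y.1.inst.layered.unrank y.2 i).2 ∧
      s.reg 12 = (y.1.inst.layered.unrank y.2 i).1) 1
    hw (by norm_num) (by norm_num) (by norm_num) (by norm_num) ?_ ?_ ?_ ?_ ?_
  · rintro y i s s' ⟨h0, h1, h2, h3⟩ hr hm
    refine ⟨h0, h1.congr (fun i hi => hr i (by omega) (by omega) (by omega)) ?_ hm, ?_, ?_⟩
    · exact hr 14 (by omega) (by omega) (by omega)
    · rw [hr 13 (by omega) (by omega) (by omega), h2]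
    · rw [hr 12 (by omega) (by omega) (by omega), h3]
  · rintro y s ⟨h0, h1, h2, h3⟩
    exact ⟨h1.1.size, congrArg (· + 1) h1.1.1.n, h0, h1, h2, h3⟩
  · intro y
    have := y.1.size_bounds
    rw [pow_one]
    omega
  · have hw : ∀ z : (Input × ℕ) × ℕ, 2 ≤ z.1.1.size := fun z => z.1.1.two_le_size
    -- The part of the invariant that is unaffected by assignments to registers 12, 13 and 16.
    let J : (Input × ℕ) × ℕ → State → Prop := fun z s => z.2 < z.1.1.n + 1 ∧ s.reg 11 = z.2 ∧
      s.reg 15 = z.1.1.n + 1 - z.2 ∧ z.1.2 < numSolutions z.1.1.G z.1.1.l ∧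
      PathReady z.1.1 z.1.2 z.2 s
    have hJ : ∀ z s (s' : State), J z s → (∀ i < 24, i ≠ 12 → i ≠ 13 → i ≠ 16 →
        s'.reg i = s.reg i) → s'.mem = s.mem → J z s' := by
      rintro z s s' ⟨h1, h2, h3, h4, h5⟩ hr hm
      refine ⟨h1, ?_, ?_, h4, h5.congr (fun i hi => hr i (by omega) (by omega) (by omega)
        (by omega)) (hr 14 (by omega) (by omega) (by omega) (by omega)) hm⟩
      · rw [hr 11 (by omega) (by omega) (by omega) (by omega), h2]
      · rw [hr 15 (by omega) (by omega) (by omega) (by omega), h3]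
    refine .seq (Q := fun z s => J z s ∧ s.reg 13 = (z.1.1.inst.layered.unrank z.1.2 z.2).2 ∧
        s.reg 12 = (z.1.1.inst.layered.unrank z.1.2 z.2).1 ∧
        s.reg 16 = (z.1.1.inst.layered.unrank z.1.2 (z.2 + 1)).1) hw
      (.assign hw (by norm_num) fun z s ⟨h1, h2, h3, h4, h5, h6, h7⟩ => ⟨h5.1.size,
        fun s' g1 g2 g3 => ⟨?_, ?_, ?_, ?_⟩⟩) ?_
    · exact hJ z s s' ⟨h1, h2, h3, h4, h5⟩ (fun i hi _ _ hne => g2 i hi hne) g3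
    · rw [g2 13 (by norm_num) (by norm_num), h6]
    · rw [g2 12 (by norm_num) (by norm_num), h7]
    · have hlt := h5.1.1.unrank_lt h4 h1.le
      rw [g1, eval_call3, eval_glob, eval_glob, eval_glob]
      change eval s.reg s.mem selF [s.reg 11, s.reg 12, s.reg 13] = _
      rw [h2, h6, h7, h5.1.1.eval_selF h5.1.hasTable (Nat.lt_succ_iff.1 h1) hlt, h5.1.1.N_eq]
      rfl
    refine .seq (Q := fun z s => J z s ∧
        s.reg 13 = (z.1.1.inst.layered.unrank z.1.2 (z.2 + 1)).2 ∧
        s.reg 16 = (z.1.1.inst.layered.unrank z.1.2 (z.2 + 1)).1) hw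
      (.assign hw (by norm_num) fun z s ⟨h1, h2, h3, h4⟩ => ⟨h1.2.2.2.2.1.size,
        fun s' g1 g2 g3 => ⟨?_, ?_, ?_⟩⟩) ?_
    · exact hJ z s s' h1 (fun i hi _ hne _ => g2 i hi hne) g3
    · obtain ⟨h11, h12, h13, h14, h15⟩ := h1
      have hlt := h15.1.1.unrank_lt h14 h11.le
      have hlt' := h15.1.1.unrank_lt h14 (a := z.2 + 1) h11
      rw [g1, eval_sub, eval_call3, eval_glob, eval_glob, eval_glob, eval_glob]
      change s.reg 13 - eval s.reg s.mem preF [s.reg 11, s.reg 12, s.reg 16] = _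
      rw [h2, h12, h3, h4, h15.1.1.eval_preF h15.1.hasTable (Nat.lt_succ_iff.1 h11) hlt hlt'.le]
      rfl
    · rw [g2 16 (by norm_num) (by norm_num), h4]
    refine .seq (Q := fun z s => J z s ∧
        s.reg 13 = (z.1.1.inst.layered.unrank z.1.2 (z.2 + 1)).2 ∧
        s.reg 12 = (z.1.1.inst.layered.unrank z.1.2 (z.2 + 1)).1) hw
      (.assign hw (by norm_num) fun z s ⟨h1, h2, h3⟩ => ⟨h1.2.2.2.2.1.size,
        fun s' g1 g2 g3 => ⟨?_, ?_, ?_⟩⟩) ?_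
    · exact hJ z s s' h1 (fun i hi hne _ _ => g2 i hi hne) g3
    · rw [g2 13 (by norm_num) (by norm_num), h2]
    · exact g1.trans h3
    refine .assignMem hw fun z s ⟨⟨h1, h2, h3, h4, h5⟩, h6, h7⟩ => ⟨h5.1.size,
        fun s' g2 g3 => ⟨?_, ?_, h4, ⟨?_, ?_⟩, ?_, ?_⟩⟩
    · rw [g2 11 (by norm_num), h2]
    · rw [g2 15 (by norm_num), h3]
    · refine h5.1.congr (fun i hi => g2 i (by omega)) (g2 14 (by norm_num)) fun a ha => ?_
      rw [g3, Function.update_of_ne]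
      change a ≠ s.reg 8 + _
      omega
    · intro a ha
      change s'.mem = Function.update s.mem (s.reg 8 + (s.reg 11 + 1)) (s.reg 12) at g3
      rw [g2 8 (by norm_num), g3, h2]
      rcases Nat.le_succ_iff.1 ha with ha | rfl
      · rw [Function.update_of_ne (by omega), h5.2 a ha]
      · rw [Function.update_self, h7]; rfl
    · rw [g2 13 (by norm_num), h6]
    · rw [g2 12 (by norm_num), h7]
  · exact fun y s h => ⟨h.1, h.2.1⟩

/-- The word that describes solution number `r`. -/
noncomputable def solutionWord (x : Input) (r : ℕ) : List ℕ :=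
  (List.range x.n).map (x.inst.labeling (x.inst.layered.path r))

theorem hoare_writeLabels :
    Hoare (fun y : Input × ℕ => y.1.size)
      (fun y s => y.2 < numSolutions y.1.G y.1.l ∧ PathReady y.1 y.2 (y.1.n + 1) s) writeLabels
      (fun y => solutionWord y.1 y.2) (fun y s => MainReady y.1 y.2 s) := by
  have hw : ∀ y : Input × ℕ, 2 ≤ y.1.size := fun y => y.1.two_le_size
  have := Hoare.forLoop (j := 9) (r := 10) (m := fun y : Input × ℕ => y.1.n) (M := glob 0)
    (P := fun y s => y.2 < numSolutions y.1.G y.1.l ∧ PathReady y.1 y.2 (y.1.n + 1) s)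
    (body := assign 17 (call1 labelF (glob 9)) ;; .write 17)
    (I := fun y _ s =>
      y.2 < numSolutions y.1.G y.1.l ∧ PathReady y.1 y.2 (y.1.n + 1) s)
    (out := fun y v => [y.1.inst.labeling (y.1.inst.layered.path y.2) v]) (e := 1)
    hw (by norm_num) (by norm_num) (by norm_num) (by norm_num) ?_ ?_ ?_ ?_
  · refine (this.post fun y s h => h.2.1).imp fun c hc y s hs => ?_
    have := hc y s hs
    dsimp only at this
    rwa [← List.map_eq_flatMap] at this
  · rintro y i s s' ⟨h0, h1⟩ hr hm
    exact ⟨h0, h1.congr (fun i hi => hr i (by omega) (by omega) (by omega))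
      (hr 14 (by omega) (by omega) (by omega)) hm⟩
  · rintro y s ⟨h0, h1⟩
    exact ⟨h1.1.size, h1.1.1.n, h0, h1⟩
  · intro y
    have := y.1.size_bounds
    rw [pow_one]
    omega
  · have hw : ∀ z : (Input × ℕ) × ℕ, 2 ≤ z.1.1.size := fun z => z.1.1.two_le_size
    refine .seq (Q := fun z s =>
      s.reg 17 = z.1.1.inst.labeling (z.1.1.inst.layered.path z.1.2) z.2 ∧
      s.reg 9 = z.2 ∧ s.reg 10 = z.1.1.n - z.2 ∧ z.1.2 < numSolutions z.1.1.G z.1.1.l ∧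
      PathReady z.1.1 z.1.2 (z.1.1.n + 1) s) hw
      (.assign hw (by norm_num) fun z s ⟨h1, h2, h3, h4, h5⟩ => ⟨h5.1.size,
        fun s' g1 g2 g3 => ⟨?_, ?_, ?_, h4, ?_⟩⟩) (.write fun z s h => ⟨h.1, h.2⟩)
    · rw [g1, eval_call1, eval_glob]
      change eval s.reg s.mem labelF [s.reg 9] = _
      rw [h2]
      refine h5.1.1.eval_labelF h1 (fun a ha _ => h5.1.1.unrank_lt h4 ha) h5.2
    · rw [g2 9 (by norm_num) (by norm_num), h2]
    · rw [g2 10 (by norm_num) (by norm_num), h3]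
    · exact h5.congr (fun i hi => g2 i (by omega) (by omega))
        (g2 14 (by norm_num) (by norm_num)) g3

/-! ### The algorithm -/

/-- The algorithm: it counts the solutions, and then outputs them from the last one on. -/
def enumerate : Prog :=
  (prepareSel ;; prepareNode ;; prepareCnt) ;; .loop 14 ((findPath ;; writeLabels) ;; .emit)

theorem hoare_prepare : Hoare Input.size Initial (prepareSel ;; prepareNode ;; prepareCnt)
    (fun _ => []) fun x => MainReady x (numSolutions x.G x.l) :=
  .seq Input.two_le_size hoare_prepareSel
    (.seq Input.two_le_size hoare_prepareNode hoare_prepareCnt)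

theorem hoare_body : Hoare (fun y : Input × ℕ => y.1.size)
    (fun y s => y.2 < numSolutions y.1.G y.1.l ∧ MainReady y.1 (y.2 + 1) s)
    (findPath ;; writeLabels) (fun y => solutionWord y.1 y.2) (fun y s => MainReady y.1 y.2 s) :=
  .seq (fun y => y.1.two_le_size) hoare_findPath hoare_writeLabels

theorem phases_of_notMem {t : List Event} (h : Event.emitted ∉ t) : phases t = [t] :=
  List.splitOn_eq_singleton h

theorem phases_append {t t' : List Event} (h : Event.emitted ∉ t) :
    phases (t ++ .emitted :: t') = t :: phases t' :=
  List.splitOn_append_cons_self_of_not_mem h t'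

theorem outputs_append {t t' : List Event} (h : Event.emitted ∉ t) :
    outputs (t ++ .emitted :: t') = wordOf t :: outputs t' := by
  have : phases t' ≠ [] := List.splitOn_ne_nil _ _
  rw [outputs, phases_append h, List.dropLast_cons_of_ne_nil this, List.map_cons, outputs]

/-- A loop whose body writes one word and completes it. -/
theorem exists_exec_loop_emit {p : Prog} {r T : ℕ} {I : ℕ → State → Prop} {out : ℕ → List ℕ}
    (h0 : ∀ i s, I i s → s.reg r = i) :
    ∀ m s, I m s → (∀ i < m, ∀ s, I (i + 1) s → Writes p s T (out i) (I i)) →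
      ∃ tr s', Exec (.loop r (p ;; .emit)) s tr s' ∧ ∀ t, Event.emitted ∉ t → wordOf t = [] →
        outputs (t ++ tr) = (List.range m).reverse.map out ∧
        ∀ seg ∈ phases (t ++ tr), seg.length ≤ t.length + T + 1 := by
  intro m
  induction m with
  | zero =>
    intro s hs _
    refine ⟨_, s, .loop_done (h0 0 s hs), fun t ht _ => ?_⟩
    have h : phases (t ++ [Event.tick]) = [t ++ [Event.tick]] :=
      phases_of_notMem (by simpa using ht)
    rw [outputs, h]
    simp
  | succ m ih =>
    intro s hs hp
    obtain ⟨seg, s1, e1, h1, h2, h3, h4⟩ := hp m (by omega) s hs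
    obtain ⟨tr, s2, e2, H⟩ := ih s1 h4 fun i hi => hp i (by omega)
    -- The prefix `t` accounts for the preprocessing, which counts towards the first phase only;
    -- after an emission the next phase starts empty.
    obtain ⟨g1, g2⟩ := H [] (by simp) rfl
    refine ⟨_, s2, .loop_again (by rw [h0 _ s hs]; omega) (.seq e1 (.emit s1)) e2,
      fun t ht hw => ?_⟩
    have heq : t ++ Event.tick :: (seg ++ [Event.emitted] ++ tr) =
        (t ++ Event.tick :: seg) ++ Event.emitted :: ([] ++ tr) := by simp
    have hn : Event.emitted ∉ t ++ Event.tick :: seg := by simp [ht, h1]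
    rw [heq]
    constructor
    · rw [outputs_append hn, g1, wordOf_append, wordOf_tick, hw, h2, List.range_succ,
        List.reverse_append]
      rfl
    · rw [phases_append hn]
      intro seg' hseg
      rcases List.mem_cons.1 hseg with rfl | hseg
      · simp; omega
      · have := g2 seg' hseg
        simp at this
        omega

/-- The run of the algorithm: its output, and a bound for its delay. -/
theorem exists_exec_enumerate : ∃ c, ∀ x : Input, ∃ tr s,
    Exec enumerate (inputState x.G x.l) tr s ∧
      outputs tr = (List.range (numSolutions x.G x.l)).reverse.map (solutionWord x) ∧
      ∀ seg ∈ phases tr, seg.length ≤ x.size ^ c := by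
  obtain ⟨c, hc⟩ := hoare_prepare
  obtain ⟨d, hd⟩ := hoare_body
  refine ⟨c + d + 2, fun x => ?_⟩
  obtain ⟨t, s, e, h1, h2, h3, h4⟩ := hc x (inputState x.G x.l) rfl
  obtain ⟨tr, s', e', H⟩ := exists_exec_loop_emit (p := findPath ;; writeLabels)
    (T := x.size ^ d) (I := fun r s => MainReady x r s) (out := solutionWord x) (fun r s h => h.2)
    _ s h4 fun i hi s hs => hd (x, i) s ⟨hi, hs⟩
  obtain ⟨g1, g2⟩ := H t h1 h2
  refine ⟨_, s', .seq e e', g1, fun seg hseg => (g2 seg hseg).trans ?_⟩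
  have hw := x.two_le_size
  have e1 := Nat.pow_le_pow_right (show 0 < x.size by omega) (show c ≤ c + d by omega)
  have e2 := Nat.pow_le_pow_right (show 0 < x.size by omega) (show d ≤ c + d by omega)
  have e3 := Nat.one_le_pow (c + d) x.size (by omega)
  have e4 := Nat.mul_le_mul_left (x.size ^ (c + d)) (Nat.pow_le_pow_left hw 2)
  rw [pow_add _ (c + d)]
  omega

theorem describes_solution (x : Input) (r : ℕ) :
    Describes (solutionWord x r) (solution x.G x.l r) := by
  refine ⟨by simp [solutionWord], fun i j => ?_⟩
  have h : ∀ i : Fin x.n, (solutionWord x r)[(i : ℕ)]? =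
      some (x.inst.labeling (x.inst.layered.path r) i) := fun i => by
    simp [solutionWord]
  rw [h, h, Option.some_inj, solution, part_partOf_eq_iff]
  rfl

theorem enumeratesSolutions_of_outputs {x : Input} {tr : List Event}
    (h : outputs tr = (List.range (numSolutions x.G x.l)).reverse.map (solutionWord x)) :
    EnumeratesSolutions x.G x.l tr := by
  refine ⟨(List.range (numSolutions x.G x.l)).reverse.map (solution x.G x.l), ?_, fun P => ?_, ?_⟩
  · refine List.Nodup.map_on (fun a ha b hb => ?_) (List.nodup_reverse.2 List.nodup_range)
    simp only [List.mem_reverse, List.mem_range] at ha hb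
    exact solution_injective ha hb
  · simp only [List.mem_map, List.mem_reverse, List.mem_range]
    constructor
    · rintro ⟨r, hr, rfl⟩
      exact isSolution_solution hr
    · exact exists_solution_eq
  · rw [h, List.forall₂_map_left_iff, List.forall₂_map_right_iff]
    exact List.forall₂_same.2 fun r _ => describes_solution x r

/-! ### The delay -/

/-- The sum is at most twice the larger summand. This keeps the parts depending on `t` and on `n`
additively separate. -/
theorem add_pow_le_two_pow_mul (a b e : ℕ) : (a + b) ^ e ≤ 2 ^ e * a ^ e + 2 ^ e * b ^ e := by
  rw [← mul_pow, ← mul_pow]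
  rcases le_total a b with h | h
  · exact (Nat.pow_le_pow_left (by omega) e).trans (Nat.le_add_left _ _)
  · exact (Nat.pow_le_pow_left (by omega) e).trans (Nat.le_add_right _ _)

/-- Both `k ^ k` and `2 ^ k` are at most `t ^ (9 t)`. Since `t ≥ 2`, two constant factors 2 become
factors `t`, and `9 t + 2 ≤ 11 t ^ 3` gives the exponent; the constant 40 is shared with
`size_pow_le_of_le_one`. -/
theorem size_pow_le (e : ℕ) {k n t : ℕ} (hk : k ≤ 3 * t) (ht : 2 ≤ t) :
    (k ^ k + 2 ^ k + n + n + 5) ^ e ≤ t ^ (11 * e * t ^ 3) + 40 ^ e * (n + 1) ^ e := by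
  have h3 : 3 * t ≤ t ^ 3 := by nlinarith [Nat.mul_le_mul ht ht]
  have h1 : k ^ k ≤ t ^ (9 * t) := calc
    k ^ k ≤ (3 * t) ^ k := Nat.pow_le_pow_left hk k
    _ ≤ (3 * t) ^ (3 * t) := Nat.pow_le_pow_right (by omega) hk
    _ ≤ (t ^ 3) ^ (3 * t) := Nat.pow_le_pow_left h3 _
    _ = t ^ (9 * t) := by rw [← pow_mul]; ring_nf
  have h2 : 2 ^ k ≤ t ^ (9 * t) := (Nat.pow_le_pow_left ht k).trans
    (Nat.pow_le_pow_right (by omega) (by omega))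
  calc (k ^ k + 2 ^ k + n + n + 5) ^ e ≤ (2 * t ^ (9 * t) + 5 * (n + 1)) ^ e :=
        Nat.pow_le_pow_left (by omega) e
    _ ≤ 2 ^ e * (2 * t ^ (9 * t)) ^ e + 2 ^ e * (5 * (n + 1)) ^ e := add_pow_le_two_pow_mul _ _ _
    _ ≤ t ^ (11 * e * t ^ 3) + 40 ^ e * (n + 1) ^ e := by
        refine Nat.add_le_add ?_ ?_
        · rw [← mul_pow]
          calc (2 * (2 * t ^ (9 * t))) ^ e ≤ (t * (t * t ^ (9 * t))) ^ e := by gcongr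
            _ = t ^ ((9 * t + 2) * e) := by rw [← pow_succ', ← pow_succ', ← pow_mul]
            _ ≤ t ^ (11 * e * t ^ 3) := by
                refine Nat.pow_le_pow_right (by omega) ?_
                calc (9 * t + 2) * e ≤ 11 * t ^ 3 * e := Nat.mul_le_mul_right _ (by omega)
                  _ = 11 * e * t ^ 3 := by ring
        · rw [← mul_pow, ← mul_pow]
          exact Nat.pow_le_pow_left (by omega) e

/-- For `t ≤ 1` the exponential term of the delay does not grow with the constant, but then `k ≤ 3`,
and `3 ^ 3 + 2 ^ 3 + 5 = 40` is absorbed by the polynomial term. -/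
theorem size_pow_le_of_le_one (e : ℕ) {k n : ℕ} (hk : k ≤ 3) :
    (k ^ k + 2 ^ k + n + n + 5) ^ e ≤ 40 ^ e * (n + 1) ^ e := by
  rw [← mul_pow]
  refine Nat.pow_le_pow_left ?_ e
  interval_cases k <;> norm_num <;> omega

theorem Input.size_le (x : Input) : x.size ≤ x.inst.B ^ 6 := by
  have hB := (Inst.pow_lt_B (I := x.inst)).2.2
  have h1 := Nat.mul_le_mul_left (x.inst.B ^ 5) (show 5 ≤ x.inst.B by omega)
  have h2 := Nat.one_le_pow 5 x.inst.B (by omega)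
  rw [← pow_succ, show 5 + 1 = 6 from rfl] at h1
  rw [Input.size]
  omega

theorem size_pow_le_delay (c : ℕ) : ∃ C : ℕ, ∀ (x : Input) (t : ℕ), distToCluster x.G ≤ t →
    ((x.size ^ c : ℕ) : ℝ) ≤ (2 : ℝ) ^ ((C : ℝ) * (t : ℝ) ^ 3 * Real.logb 2 (t : ℝ)) +
      (C : ℝ) * ((x.n : ℝ) + 1) ^ C := by
  set e := 6 * c with he
  obtain ⟨C, h11, h40, hCe⟩ : ∃ C, 11 * e ≤ C ∧ 40 ^ e ≤ C ∧ e ≤ C :=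
    ⟨11 * e + 40 ^ e, Nat.le_add_right _ _, Nat.le_add_left _ _,
      by nlinarith [Nat.zero_le (40 ^ e)]⟩
  refine ⟨C, fun x t ht => ?_⟩
  have hk : x.inst.k ≤ 3 * t := (Inst.k_ofGraph_le x.l).trans (by omega)
  have hs : x.size ^ c ≤ x.inst.B ^ e := by
    rw [he, pow_mul]; exact Nat.pow_le_pow_left x.size_le c
  have hn : 40 ^ e * (x.n + 1) ^ e ≤ C * (x.n + 1) ^ C :=
    Nat.mul_le_mul h40 (Nat.pow_le_pow_right (by omega) hCe)
  rcases Nat.lt_or_ge t 2 with h | h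
  · have h1 : ((x.size ^ c : ℕ) : ℝ) ≤ ((C * (x.n + 1) ^ C : ℕ) : ℝ) :=
      Nat.cast_le.2 ((hs.trans (size_pow_le_of_le_one e (by omega))).trans hn)
    push_cast at h1 ⊢
    have : (0 : ℝ) ≤ (2 : ℝ) ^ ((C : ℝ) * (t : ℝ) ^ 3 * Real.logb 2 (t : ℝ)) := by positivity
    linarith
  · have h1 : x.size ^ c ≤ t ^ (C * t ^ 3) + C * (x.n + 1) ^ C :=
      (hs.trans (size_pow_le e hk h)).trans (Nat.add_le_add
        (Nat.pow_le_pow_right (by omega) (Nat.mul_le_mul_right _ h11)) hn)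
    -- With `t ≥ 2`, the logarithm turns the exponential term into the power `t ^ (C t ^ 3)`.
    have h2 : (2 : ℝ) ^ ((C : ℝ) * (t : ℝ) ^ 3 * Real.logb 2 (t : ℝ)) =
        (t : ℝ) ^ (C * t ^ 3) := by
      rw [mul_comm, Real.rpow_mul (by norm_num), Real.rpow_logb (by norm_num) (by norm_num)
        (by positivity), ← Real.rpow_natCast _ (C * t ^ 3)]
      push_cast
      rfl
    rw [h2]
    exact_mod_cast h1

end MatchingMulticut

theorem mainTheorem7 :
    ∃ (A : MatchingMulticut.Prog) (C : ℕ),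
      ∀ (n : ℕ) (G : SimpleGraph (Fin n)) (ℓ : ℕ),
        ∃ (tr : List MatchingMulticut.Event) (s : MatchingMulticut.State),
          MatchingMulticut.Exec A (MatchingMulticut.inputState G ℓ) tr s ∧
          MatchingMulticut.EnumeratesSolutions G ℓ tr ∧
          ∀ t : ℕ, MatchingMulticut.distToCluster G ≤ t →
            MatchingMulticut.DelayAtMost tr
              ((2 : ℝ) ^ ((C : ℝ) * (t : ℝ) ^ 3 * Real.logb 2 (t : ℝ)) +
                (C : ℝ) * ((n : ℝ) + 1) ^ C) := by
  obtain ⟨c, hc⟩ := MatchingMulticut.exists_exec_enumerate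
  obtain ⟨C, hC⟩ := MatchingMulticut.size_pow_le_delay c
  refine ⟨MatchingMulticut.enumerate, C, fun n G l => ?_⟩
  obtain ⟨tr, s, h1, h2, h3⟩ := hc ⟨n, G, l⟩
  exact ⟨tr, s, h1, MatchingMulticut.enumeratesSolutions_of_outputs h2, fun t ht seg hseg =>
    (Nat.cast_le.2 (h3 seg hseg)).trans (hC ⟨n, G, l⟩ t ht)⟩
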